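/- An instance of Min-$k$-Knapsack consists of $n$ elements with costs $c_e\ge 0$, a budget $B\ge 0$, a number $k$, and independent random weights $X_e$ with values in $\{0,1,\dots,m\}$ and known distributions. A set $S$ of elements is feasible if $\sum_{e\in S}c_e\le B$. An adaptive policy $\pi$ probes elements one by one; the weight $X_e$ is revealed when $e$ is probed, and later choices (which element to probe next, when to stop) may depend on the weights seen so far. Let $S^{(\pi)}$ be the random set of probed elements; $\pi$ is admissible if $S^{(\pi)}$ is always feasible. The objective $f(S)$ is the sum of the $k$ smallest weights of elements of $S$; if $|S|<k$, each of the $k-|S|$ missing weights is counted as $w$, where $w\in[m,\infty]$ is fixed (for instance $w=m$, or $w=\infty$, which makes it necessary to probe $k$ elements). A policy is an $(\alpha,\beta)$-approximation if $S^{(\pi)}$ is always the union of at most $\beta$ feasible sets and $\mathbb{E}[f(S^{(\pi)})]\le\alpha\cdot\inf_{\pi'}\mathbb{E}[f(S^{(\pi')})]$, where $\pi'$ ranges over the admissible adaptive policies. **Theorem.** For Min-$k$-Knapsack with weights in $\{0,\dots,m\}$ there is an efficiently computable adaptive policy that is an $(8,\,O(\log\log m\cdot\log^2 k))$-approximation.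 Precisely: there are a constant $C$, a polynomial $T$ and a single program of a real random access machine (unit-cost $+,-,\times,\div,\ln$ and comparisons on real numbers, addition, truncated subtraction and comparisons on natural numbers, indirect addressing, access to the numbers $n,m,k,B,c_e,\Pr[X_e=v]$, and probing of elements) such that on every instance the program carries out, for all weights in at most $T(n+m)$ steps, an adaptive policy that, for every $w\in[m,\infty]$, is an $(8,\beta)$-approximation with $$\beta = C\cdot\max\{1,\ln\ln m\}\cdot\max\{1,\ln k\}^2,$$ where $\max\{1,\ln\ln m\}$ is read as $1$ if $m\le 1$ and $\max\{1,\ln k\}$ as $1$ if $k=0$. -/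

import Mathlib

open scoped ENNReal NNReal

noncomputable section

namespace MinKKnapsack

/-- An input: `n` elements, weights in `{0, …, m}`, the number `k` of smallest weights that are
paid for, a knapsack budget, and for each element its cost and the known law of its random
weight. The weights of different elements are independent. -/
structure Problem where
  n : ℕ
  m : ℕ
  k : ℕ
  budget : ℝ≥0
  cost : Fin n → ℝ≥0
  law : Fin n → PMF (Fin (m + 1))

/-- A realization of all the weights. -/
abbrev Outcome (I : Problem) : Type := Fin I.n → Fin (I.m + 1)

/-- The probability of a realization: the weights are independent. -/
def outcomeProb (I : Problem) (x : Outcome I) : ℝ≥0∞ := ∏ e, I.law e (x e)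

/-- The knapsack constraint. -/
def Feasible (I : Problem) (S : Finset (Fin I.n)) : Prop := ∑ e ∈ S, I.cost e ≤ I.budget

/-- An adaptive policy is a decision tree: it ends, or probes an element and continues in a way
that depends on the weight that is revealed. -/
inductive Policy (I : Problem) : Type
  | done : Policy I
  | probe (e : Fin I.n) (next : Fin (I.m + 1) → Policy I) : Policy I

/-- The set of elements that the policy has probed when it ends. -/
def Policy.selected {I : Problem} : Policy I → Outcome I → Finset (Fin I.n)
  | .done, _ => ∅
  | .probe e next, x => insert e ((next (x e)).selected x)

/-- The policy respects the constraint, whatever the weights are. -/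
def Policy.Admissible {I : Problem} (π : Policy I) : Prop := ∀ x, Feasible I (π.selected x)

/-- The sum of the `k` smallest weights in `S`. If `S` has fewer than `k` elements, then every
missing one is counted with weight `w`. -/
def objective (I : Problem) (w : ℝ≥0∞) (x : Outcome I) (S : Finset (Fin I.n)) : ℝ≥0∞ :=
  ((((S.val.map fun e => (x e : ℕ)).sort (· ≤ ·)).take I.k).sum : ℕ)
    + ((I.k - S.card : ℕ) : ℝ≥0∞) * w

/-- The expected objective value of a policy. -/
def Policy.expectedObjective {I : Problem} (π : Policy I) (w : ℝ≥0∞) : ℝ≥0∞ :=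
  ∑ x : Outcome I, outcomeProb I x * objective I w x (π.selected x)

/-- The optimal expected objective value of an adaptive policy that respects the constraint. -/
def optimum (I : Problem) (w : ℝ≥0∞) : ℝ≥0∞ :=
  ⨅ (π : Policy I) (_ : π.Admissible), π.expectedObjective w

/-- The policy is an `(α, β)`-approximation: the set it selects is always a union of at most `β`
feasible sets, and its expected objective value is at most `α` times the optimum. -/
def Policy.IsApproximation {I : Problem} (π : Policy I) (w α : ℝ≥0∞) (β : ℝ) : Prop :=
  (∀ x, ∃ F : Finset (Finset (Fin I.n)),
      (F.card : ℝ) ≤ β ∧ (∀ A ∈ F, Feasible I A) ∧ F.sup id = π.selected x) ∧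
    π.expectedObjective w ≤ α * optimum I w

/-! The model of computation: while programs on a real random access machine. The machine has a
memory of natural numbers and a memory of real numbers, both with indirect addressing. Unit cost
operations are addition and truncated subtraction of natural numbers (there is no multiplication
of natural numbers), the field operations and the natural logarithm of real numbers, comparisons,
reading the input, and probing an element. -/

/-- Expressions with natural values; `mem a` is the content of the cell with address `a`. -/
inductive NatExp : Type
  | const (a : ℕ) : NatExp
  | mem (a : NatExp) : NatExp
  | add (a b : NatExp) : NatExp
  | sub (a b : NatExp) : NatExp

/-- Expressions with real values; `cost e` and `prob e v` read the cost of element number `e` and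
the probability that its weight is `v`. -/
inductive RealExp : Type
  | ofNat (a : NatExp) : RealExp
  | mem (a : NatExp) : RealExp
  | budget : RealExp
  | cost (e : NatExp) : RealExp
  | prob (e v : NatExp) : RealExp
  | add (a b : RealExp) : RealExp
  | sub (a b : RealExp) : RealExp
  | mul (a b : RealExp) : RealExp
  | div (a b : RealExp) : RealExp
  | log (a : RealExp) : RealExp

/-- Tests. -/
inductive Test : Type
  | natLT (a b : NatExp) : Test
  | realLT (a b : RealExp) : Test
  | not (t : Test) : Test
  | and (t u : Test) : Test

/-- Programs. `setNat a b` and `setReal a b` store the value of `b` at address `a`; `probe a e`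
probes element number `e` and stores its weight at address `a` of the natural memory. -/
inductive Program : Type
  | skip : Program
  | setNat (a b : NatExp) : Program
  | setReal (a : NatExp) (b : RealExp) : Program
  | probe (a e : NatExp) : Program
  | seq (p q : Program) : Program
  | ite (t : Test) (p q : Program) : Program
  | while (t : Test) (p : Program) : Program

/-- The state of the machine: the two memories and the set of elements probed so far. -/
structure State (I : Problem) where
  nat : ℕ → ℕ
  real : ℕ → ℝ
  probed : Finset (Fin I.n)

/-- At the start the natural memory holds `n`, `m`, `k` and nothing has been probed. -/
def State.initial (I : Problem) : State I where
  nat := fun i => if i = 0 then I.n else if i = 1 then I.m else if i = 2 then I.k else 0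
  real := fun _ => 0
  probed := ∅

def NatExp.eval {I : Problem} (s : State I) : NatExp → ℕ
  | .const a => a
  | .mem a => s.nat (a.eval s)
  | .add a b => a.eval s + b.eval s
  | .sub a b => a.eval s - b.eval s

def RealExp.eval {I : Problem} (s : State I) : RealExp → ℝ
  | .ofNat a => (a.eval s : ℝ)
  | .mem a => s.real (a.eval s)
  | .budget => (I.budget : ℝ)
  | .cost e => if h : e.eval s < I.n then (I.cost ⟨e.eval s, h⟩ : ℝ) else 0
  | .prob e v =>
      if h : e.eval s < I.n ∧ v.eval s < I.m + 1 then
        (I.law ⟨e.eval s, h.1⟩ ⟨v.eval s, h.2⟩).toReal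
      else 0
  | .add a b => a.eval s + b.eval s
  | .sub a b => a.eval s - b.eval s
  | .mul a b => a.eval s * b.eval s
  | .div a b => a.eval s / b.eval s
  | .log a => Real.log (a.eval s)

def Test.Holds {I : Problem} (s : State I) : Test → Prop
  | .natLT a b => a.eval s < b.eval s
  | .realLT a b => a.eval s < b.eval s
  | .not t => ¬ t.Holds s
  | .and t u => t.Holds s ∧ u.Holds s

/-- Probing an element reveals its weight and adds it to the set of probed elements. A number that
does not belong to an element has no effect. -/
def State.doProbe {I : Problem} (x : Outcome I) (s : State I) (a e : ℕ) : State I :=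
  if h : e < I.n then
    { s with
      nat := Function.update s.nat a (x ⟨e, h⟩ : ℕ)
      probed := insert ⟨e, h⟩ s.probed }
  else s

/-- `Exec x p s s' t`: if the weights are `x`, which the program can learn only by probing, then
`p` started in state `s` halts in state `s'` after `t` steps. A step is one command or one test of
a condition; the expressions in a fixed program have bounded size, so that this is the number of
unit cost operations up to a constant factor. -/
inductive Exec {I : Problem} (x : Outcome I) : Program → State I → State I → ℕ → Prop
  | skip (s : State I) : Exec x .skip s s 1
  | setNat (a b : NatExp) (s : State I) :
      Exec x (.setNat a b) s { s with nat := Function.update s.nat (a.eval s) (b.eval s) } 1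
  | setReal (a : NatExp) (b : RealExp) (s : State I) :
      Exec x (.setReal a b) s { s with real := Function.update s.real (a.eval s) (b.eval s) } 1
  | probe (a e : NatExp) (s : State I) :
      Exec x (.probe a e) s (s.doProbe x (a.eval s) (e.eval s)) 1
  | seq {p q : Program} {s s₁ s₂ : State I} {t₁ t₂ : ℕ} :
      Exec x p s s₁ t₁ → Exec x q s₁ s₂ t₂ → Exec x (.seq p q) s s₂ (t₁ + t₂)
  | iteTrue {c : Test} {p q : Program} {s s' : State I} {t : ℕ} :
      c.Holds s → Exec x p s s' t → Exec x (.ite c p q) s s' (t + 1)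
  | iteFalse {c : Test} {p q : Program} {s s' : State I} {t : ℕ} :
      ¬ c.Holds s → Exec x q s s' t → Exec x (.ite c p q) s s' (t + 1)
  | whileTrue {c : Test} {p : Program} {s s₁ s₂ : State I} {t₁ t₂ : ℕ} :
      c.Holds s → Exec x p s s₁ t₁ → Exec x (.while c p) s₁ s₂ t₂ →
        Exec x (.while c p) s s₂ (t₁ + t₂ + 1)
  | whileFalse {c : Test} {p : Program} {s : State I} :
      ¬ c.Holds s → Exec x (.while c p) s s 1

/-- The program carries out the policy within `T` steps: for all weights it halts in time, and has
then probed exactly the elements that the policy selects. -/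
def Program.Implements (p : Program) {I : Problem} (π : Policy I) (T : ℕ) : Prop :=
  ∀ x : Outcome I, ∃ (s : State I) (t : ℕ),
    t ≤ T ∧ Exec x p (State.initial I) s t ∧ s.probed = π.selected x

end MinKKnapsack

end

open scoped ENNReal NNReal

noncomputable section

namespace MinKKnapsack

variable {I : Problem}

/-! The objective is a sum of deficits. Let `deficit v S` be the number of weights below `v` that
`S` still lacks to have `k` of them. Then the objective is the sum of `deficit v S` over `1 ≤ v ≤
m`, plus `w - m` for every missing element (`objective_eq`). As the deficit decreases in `v`, the
thresholds `2 ^ j` determine the sum up to a factor `2`. So it suffices to probe a set whose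
expected deficit is, for all `j` at once, comparable with that of an arbitrary admissible policy
`π`.

Fix a threshold `g`. An element succeeds if its weight is below `g`; it fails with probability
`surv`, and its hazard is `-log surv`. For a deficit of about `D`, a batch takes about `D / 24`
cheap elements with the smallest `surv`, then elements with the largest hazard per cost until the
budget is exceeded. A feasible set contains only few elements that are better than the cheap ones
taken, because those are expensive, and the hazard of its other elements is at most that of the
greedy part. Optional stopping against the lower tail of a Poisson process shows that even the
adaptive `π` then has few successes at least with `exp (-D / 3)` times the probability that the
batch has fewer than `D / 200` (`tail_le_optFail`). A constant number of further batches outweighs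
this factor (`fail_of_not_exhausted`), unless no feasible set that is left promises more than `D /
8` successes; in that case a deficit that is still almost `D` can be charged to `π`
(`deficit_of_exhausted`).

The bound `D` runs through `k * (199 / 200) ^ i`. On each level a binary search over the exponents
looks for the thresholds at which a trial brings the deficit down to `199 / 200 * D`. Exponents
below `lo` are given up for good, at a moment when their deficit is at most `D`. The potential of an
exponent `j` consists of `3` times the expected deficit of `π`, until `j` is given up, and of `1 /
(1000 * D)` times a deficit of `π` for every trial that may still come; it does not increase in
expectation (`Phase.cev_potential_step`). At the end `D < 1`, so exponents that were not given up
have deficit `0`. The weights `1 / (1000 * D)` add up to at most `1 / 5`; summing over `j` with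
coefficients `2 ^ j` gives `3 + 4 / 5`, and condensation doubles this to `7.6`.

A trial is covered by a constant number of feasible sets, and there are `O(log k)` levels with
`O(log log m)` trials each. If `k ≥ 2 * n`, every policy misses at least half of the `k` weights,
and probing nothing is good enough; otherwise all quantities are polynomial in `n + m`, and a
program carries out the procedure step by step (`runs_mainProgram`). -/

/-! ### Expectations and resampling -/

/-- The probability of a realization as a real number. -/
def prob (x : Outcome I) : ℝ := ∏ e, (I.law e (x e)).toReal

/-- Expectation over all realizations. -/
def ev (G : Outcome I → ℝ) : ℝ := ∑ x, prob x * G x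

/-- Expectation conditioned on the weights `y` of the elements of `R`. -/
def cev (R : Finset (Fin I.n)) (y : Outcome I) (G : Outcome I → ℝ) : ℝ :=
  ev fun x => G (R.piecewise y x)

lemma prob_nonneg (x : Outcome I) : 0 ≤ prob x :=
  Finset.prod_nonneg fun _ _ => ENNReal.toReal_nonneg

lemma sum_law (e : Fin I.n) : ∑ u, (I.law e u).toReal = 1 := by
  rw [← ENNReal.toReal_sum fun u _ => PMF.apply_ne_top _ _]
  have := PMF.tsum_coe (I.law e)
  rw [tsum_fintype] at this
  simp [this]

lemma ev_prod (φ : ∀ _ : Fin I.n, Fin (I.m + 1) → ℝ) :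
    ev (fun x : Outcome I => ∏ e, φ e (x e)) = ∏ e, ∑ u, (I.law e u).toReal * φ e u := by
  rw [Finset.prod_univ_sum]
  simp only [ev, prob, Fintype.piFinset_univ, Finset.prod_mul_distrib]

lemma ev_prod_on (W : Finset (Fin I.n)) (φ : ∀ _ : Fin I.n, Fin (I.m + 1) → ℝ) :
    ev (fun x : Outcome I => ∏ e ∈ W, φ e (x e)) =
      ∏ e ∈ W, ∑ u, (I.law e u).toReal * φ e u := by
  have h := ev_prod (I := I) fun e u => if e ∈ W then φ e u else 1
  simp only [Finset.prod_ite_mem, Finset.univ_inter] at h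
  rw [h]
  rw [← Finset.prod_subset (Finset.subset_univ W)]
  · exact Finset.prod_congr rfl fun e he => by simp [he]
  · intro e _ he
    simp [he, sum_law]

lemma sum_prob : ∑ x : Outcome I, prob x = 1 := by
  have := ev_prod (I := I) fun _ _ => 1
  simpa [ev, sum_law] using this

lemma ev_const (c : ℝ) : ev (fun _ : Outcome I => c) = c := by
  simp [ev, ← Finset.sum_mul, sum_prob]

lemma ev_mono {F G : Outcome I → ℝ} (h : ∀ x, F x ≤ G x) : ev F ≤ ev G :=
  Finset.sum_le_sum fun x _ => mul_le_mul_of_nonneg_left (h x) (prob_nonneg x)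

lemma ev_add (F G : Outcome I → ℝ) : ev (fun x => F x + G x) = ev F + ev G := by
  simp [ev, mul_add, Finset.sum_add_distrib]

lemma ev_sub (F G : Outcome I → ℝ) : ev (fun x => F x - G x) = ev F - ev G := by
  simp [ev, mul_sub, Finset.sum_sub_distrib]

lemma ev_mul (c : ℝ) (G : Outcome I → ℝ) : ev (fun x => c * G x) = c * ev G := by
  simp only [ev, Finset.mul_sum]
  exact Finset.sum_congr rfl fun x _ => by ring

lemma ev_sum {ι : Type*} (s : Finset ι) (G : ι → Outcome I → ℝ) :
    ev (fun x => ∑ i ∈ s, G i x) = ∑ i ∈ s, ev (G i) := by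
  simp only [ev, Finset.mul_sum]
  exact Finset.sum_comm

lemma ev_nonneg {G : Outcome I → ℝ} (h : ∀ x, 0 ≤ G x) : 0 ≤ ev G := by
  simpa [ev_const] using ev_mono h

lemma ev_coord (e : Fin I.n) (φ : Fin (I.m + 1) → ℝ) :
    ev (fun x : Outcome I => φ (x e)) = ∑ u, (I.law e u).toReal * φ u := by
  simpa using ev_prod_on (I := I) {e} fun _ => φ

lemma cev_const (R : Finset (Fin I.n)) (y : Outcome I) (c : ℝ) : cev R y (fun _ => c) = c :=
  ev_const c

lemma cev_mono {R : Finset (Fin I.n)} {y : Outcome I} {F G : Outcome I → ℝ}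
    (h : ∀ x, (∀ e ∈ R, x e = y e) → F x ≤ G x) : cev R y F ≤ cev R y G :=
  ev_mono fun x => h _ fun e he => by simp [he]

lemma cev_congr {R : Finset (Fin I.n)} {y : Outcome I} {F G : Outcome I → ℝ}
    (h : ∀ x, (∀ e ∈ R, x e = y e) → F x = G x) : cev R y F = cev R y G :=
  le_antisymm (cev_mono fun x hx => (h x hx).le) (cev_mono fun x hx => (h x hx).ge)

lemma cev_nonneg {R : Finset (Fin I.n)} {y : Outcome I} {G : Outcome I → ℝ}
    (h : ∀ x, 0 ≤ G x) : 0 ≤ cev R y G := ev_nonneg fun _ => h _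

lemma cev_add (R : Finset (Fin I.n)) (y : Outcome I) (F G : Outcome I → ℝ) :
    cev R y (fun x => F x + G x) = cev R y F + cev R y G := ev_add _ _

lemma cev_sub (R : Finset (Fin I.n)) (y : Outcome I) (F G : Outcome I → ℝ) :
    cev R y (fun x => F x - G x) = cev R y F - cev R y G := ev_sub _ _

lemma cev_mul (R : Finset (Fin I.n)) (y : Outcome I) (c : ℝ) (G : Outcome I → ℝ) :
    cev R y (fun x => c * G x) = c * cev R y G := ev_mul _ _

lemma cev_sum {ι : Type*} (R : Finset (Fin I.n)) (y : Outcome I) (s : Finset ι)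
    (G : ι → Outcome I → ℝ) :
    cev R y (fun x => ∑ i ∈ s, G i x) = ∑ i ∈ s, cev R y (G i) := ev_sum _ _

lemma cev_empty (y : Outcome I) (G : Outcome I → ℝ) : cev ∅ y G = ev G := by
  simp [cev]

lemma cev_congr_known {R : Finset (Fin I.n)} {y y' : Outcome I} (h : ∀ e ∈ R, y e = y' e)
    (G : Outcome I → ℝ) : cev R y G = cev R y' G := by
  unfold cev
  congr 1
  funext x
  congr 1
  funext e
  by_cases he : e ∈ R <;> simp [he, h]

lemma prob_piecewise_mul (R : Finset (Fin I.n)) (x y : Outcome I) :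
    prob (R.piecewise x y) * prob (R.piecewise y x) = prob x * prob y := by
  simp only [prob, ← Finset.prod_mul_distrib]
  refine Finset.prod_congr rfl fun e _ => ?_
  by_cases he : e ∈ R <;> simp [he, mul_comm]

/-- Two independent realizations may exchange their coordinates outside `R`: this is an involution
that preserves the product of the two probabilities. -/
lemma ev_cev (R : Finset (Fin I.n)) (G : Outcome I → ℝ) : ev (fun x => cev R x G) = ev G := by
  have key : ∑ p : Outcome I × Outcome I, prob p.1 * prob p.2 * G (R.piecewise p.1 p.2) =
      ∑ p : Outcome I × Outcome I, prob p.1 * prob p.2 * G p.1 := by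
    refine Finset.sum_nbij' (fun p => (R.piecewise p.1 p.2, R.piecewise p.2 p.1))
      (fun p => (R.piecewise p.1 p.2, R.piecewise p.2 p.1)) (by simp) (by simp) ?_ ?_ ?_
    · rintro ⟨a, b⟩ _
      ext e <;> by_cases he : e ∈ R <;> simp [he]
    · rintro ⟨a, b⟩ _
      ext e <;> by_cases he : e ∈ R <;> simp [he]
    · rintro ⟨a, b⟩ _
      simp [prob_piecewise_mul]
  rw [Fintype.sum_prod_type, Fintype.sum_prod_type] at key
  simp only [cev, ev]
  calc ∑ x, prob x * ∑ x', prob x' * G (R.piecewise x x')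
      = ∑ x, ∑ x', prob x * prob x' * G (R.piecewise x x') := by
        simp [Finset.mul_sum, mul_assoc]
    _ = _ := key
    _ = ∑ x, prob x * G x := by
        refine Finset.sum_congr rfl fun x _ => ?_
        simp only [mul_right_comm (prob x)]
        rw [← Finset.mul_sum, sum_prob, mul_one]

/-- The tower property; it allows an estimate to be made after more weights have been revealed. -/
lemma cev_cev {R R' : Finset (Fin I.n)} (h : R ⊆ R') (y : Outcome I) (G : Outcome I → ℝ) :
    cev R y (fun x => cev R' x G) = cev R y G := by
  have := ev_cev R' fun x => G (R.piecewise y x)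
  rw [cev, cev, ← this]
  refine congrArg ev (funext fun x => congrArg ev (funext fun x' => congrArg G ?_))
  ext e
  by_cases he : e ∈ R
  · simp [he, h he]
  · by_cases he' : e ∈ R' <;> simp [he, he']

lemma cev_insert {R : Finset (Fin I.n)} {e : Fin I.n} (he : e ∉ R) (y : Outcome I)
    (G : Outcome I → ℝ) :
    cev R y G = ∑ u, (I.law e u).toReal * cev (insert e R) (Function.update y e u) G := by
  rw [← cev_cev (Finset.subset_insert e R), ← ev_coord]
  unfold cev
  refine congrArg ev (funext fun x => ?_)
  refine cev_congr_known (fun f hf => ?_) G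
  rcases Finset.mem_insert.1 hf with rfl | hf
  · simp [he]
  · have : f ≠ e := fun h => he (h ▸ hf)
    simp [hf, this]

/-- Functions of disjoint sets of coordinates are independent. -/
lemma cev_mul_indep {R A B : Finset (Fin I.n)} (y : Outcome I) {F G : Outcome I → ℝ}
    (hRA : R ⊆ A)
    (hF : ∀ x x', (∀ e ∈ A, x e = x' e) → F x = F x')
    (hG : ∀ x x', (∀ e ∈ B, x e = x' e) → G x = G x') (hAB : Disjoint A B) :
    cev R y (fun x => F x * G x) = cev R y F * ev G := by
  rw [← cev_cev hRA]
  have : ∀ x, cev A x (fun x => F x * G x) = ev G * F x := by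
    intro x
    rw [mul_comm, ← ev_mul]
    refine congrArg ev (funext fun x' => congrArg₂ (· * ·) (hF _ _ ?_) (hG _ _ ?_))
    · intro e he
      simp [he]
    · intro e he
      simp [Finset.disjoint_right.1 hAB he]
  simp only [this, cev_mul]
  ring

/-! ### Successes and optional stopping -/

/-- The number of elements of `U` whose weight is below the threshold `g`. -/
def cnt (g : ℕ) (U : Finset (Fin I.n)) (x : Outcome I) : ℕ :=
  (U.filter fun e => (x e : ℕ) < g).card

/-- How many weights below `g` are missing in `U`. -/
def deficit (g : ℕ) (U : Finset (Fin I.n)) (x : Outcome I) : ℕ := I.k - cnt g U x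

/-- The probability that the weight of `e` is at least `g`. -/
def surv (I : Problem) (g : ℕ) (e : Fin I.n) : ℝ :=
  ∑ u : Fin (I.m + 1), if g ≤ u then (I.law e u).toReal else 0

lemma surv_nonneg (g : ℕ) (e : Fin I.n) : 0 ≤ surv I g e :=
  Finset.sum_nonneg fun u _ => by split_ifs <;> simp

lemma sum_law_lt (g : ℕ) (e : Fin I.n) :
    (∑ u : Fin (I.m + 1), if (u : ℕ) < g then (I.law e u).toReal else 0) = 1 - surv I g e := by
  rw [eq_sub_iff_add_eq, surv, ← Finset.sum_add_distrib, ← sum_law e]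
  refine Finset.sum_congr rfl fun u _ => ?_
  by_cases h : (u : ℕ) < g
  · simp [h]
  · simp [h, not_lt.1 h]

lemma surv_le_one (g : ℕ) (e : Fin I.n) : surv I g e ≤ 1 := by
  have := sum_law_lt g e
  have h : 0 ≤ ∑ u : Fin (I.m + 1), if (u : ℕ) < g then (I.law e u).toReal else 0 :=
    Finset.sum_nonneg fun u _ => by split_ifs <;> simp
  linarith

lemma sum_law_ite (g : ℕ) (e : Fin I.n) (a b : ℝ) :
    ∑ u : Fin (I.m + 1), (I.law e u).toReal * (if (u : ℕ) < g then a else b) =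
      (1 - surv I g e) * a + surv I g e * b := by
  rw [← sum_law_lt, surv, Finset.sum_mul, Finset.sum_mul, ← Finset.sum_add_distrib]
  refine Finset.sum_congr rfl fun u _ => ?_
  by_cases h : (u : ℕ) < g
  · simp [h]
  · simp [h, not_lt.1 h]

lemma cnt_congr {g : ℕ} {U : Finset (Fin I.n)} {x y : Outcome I} (h : ∀ e ∈ U, x e = y e) :
    cnt g U x = cnt g U y := by
  unfold cnt
  congr 1
  exact Finset.filter_congr fun e he => by rw [h e he]

lemma cnt_mono {g : ℕ} {U V : Finset (Fin I.n)} (h : U ⊆ V) (x : Outcome I) :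
    cnt g U x ≤ cnt g V x :=
  Finset.card_le_card (Finset.filter_subset_filter _ h)

lemma cnt_mono_left {g g' : ℕ} (h : g ≤ g') (U : Finset (Fin I.n)) (x : Outcome I) :
    cnt g U x ≤ cnt g' U x :=
  Finset.card_le_card (Finset.monotone_filter_right _ fun _ _ he => lt_of_lt_of_le he h)

lemma cnt_union_le (g : ℕ) (U V : Finset (Fin I.n)) (x : Outcome I) :
    cnt g (U ∪ V) x ≤ cnt g U x + cnt g V x := by
  unfold cnt
  rw [Finset.filter_union]
  exact Finset.card_union_le _ _

lemma cnt_union {U V : Finset (Fin I.n)} (h : Disjoint U V) (g : ℕ) (x : Outcome I) :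
    cnt g (U ∪ V) x = cnt g U x + cnt g V x := by
  unfold cnt
  rw [Finset.filter_union, Finset.card_union_of_disjoint]
  exact Finset.disjoint_filter_filter h

lemma cnt_le_card (g : ℕ) (U : Finset (Fin I.n)) (x : Outcome I) : cnt g U x ≤ U.card :=
  Finset.card_filter_le _ _

lemma cnt_insert {g : ℕ} {U : Finset (Fin I.n)} {e : Fin I.n} (he : e ∉ U) (x : Outcome I)
    (u : Fin (I.m + 1)) :
    cnt g (insert e U) (Function.update x e u) = cnt g U x + if (u : ℕ) < g then 1 else 0 := by
  have : cnt g U (Function.update x e u) = cnt g U x :=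
    cnt_congr fun f hf => by
      have : f ≠ e := fun h => he (h ▸ hf)
      simp [this]
  rw [← this]
  unfold cnt
  rw [Finset.filter_insert]
  split_ifs with h1 h2 h2
  · rw [Finset.card_insert_of_notMem (by simp [he])]
  · simp at h1; omega
  · simp at h1; omega
  · rfl

lemma deficit_congr {g : ℕ} {U : Finset (Fin I.n)} {x y : Outcome I} (h : ∀ e ∈ U, x e = y e) :
    deficit g U x = deficit g U y := by rw [deficit, deficit, cnt_congr h]

lemma deficit_anti {g : ℕ} {U V : Finset (Fin I.n)} (h : U ⊆ V) (x : Outcome I) :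
    deficit g V x ≤ deficit g U x := Nat.sub_le_sub_left (cnt_mono h x) _

lemma deficit_anti_left {g g' : ℕ} (h : g ≤ g') (U : Finset (Fin I.n)) (x : Outcome I) :
    deficit g' U x ≤ deficit g U x := Nat.sub_le_sub_left (cnt_mono_left h U x) _

/-- The elements that a policy selects after all weights in `R` have been fixed. -/
lemma selected_probe (e : Fin I.n) (next : Fin (I.m + 1) → Policy I) (x : Outcome I) :
    (Policy.probe e next).selected x = insert e ((next (x e)).selected x) := rfl

/-- If a function of the probed elements and their weights does not decrease in expectation when
an element is probed, then it does not decrease in expectation under an adaptive policy. -/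
lemma optional_stopping (Q : Finset (Fin I.n) → Prop) (hQ : ∀ U V, U ⊆ V → Q V → Q U)
    (Φ : Finset (Fin I.n) → Outcome I → ℝ)
    (hloc : ∀ U x x', (∀ e ∈ U, x e = x' e) → Φ U x = Φ U x') (R₀ : Finset (Fin I.n))
    (hstep : ∀ U e x, e ∉ U → R₀ ⊆ U → Q (insert e U) →
      Φ U x ≤ ∑ u, (I.law e u).toReal * Φ (insert e U) (Function.update x e u))
    (π : Policy I) : ∀ (R : Finset (Fin I.n)) (y : Outcome I), R₀ ⊆ R →
      (∀ x, Q (R ∪ π.selected (R.piecewise y x))) →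
      Φ R y ≤ cev R y fun x => Φ (R ∪ π.selected x) x := by
  induction π with
  | done =>
    intro R y _ _
    simp only [Policy.selected, Finset.union_empty]
    rw [cev_congr (G := fun _ => Φ R y), cev_const]
    intro x hx
    exact hloc _ _ _ hx
  | probe e next ih =>
    intro R y hR hsel
    -- A repeated probe reveals nothing: the tree continues in the branch of the known weight.
    by_cases he : e ∈ R
    · have h1 : ∀ x, (∀ f ∈ R, x f = y f) →
          R ∪ (Policy.probe e next).selected x = R ∪ (next (y e)).selected x := by
        intro x hx
        rw [selected_probe, hx e he, Finset.union_insert,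
          Finset.insert_eq_of_mem (Finset.mem_union_left _ he)]
      rw [cev_congr (G := fun x => Φ (R ∪ (next (y e)).selected x) x)
        fun x hx => by rw [h1 x hx]]
      refine ih (y e) R y hR fun x => ?_
      rw [← h1 _ fun f hf => by simp [hf]]
      exact hsel x
    · have h1 : ∀ u x, (∀ f ∈ insert e R, x f = Function.update y e u f) →
          R ∪ (Policy.probe e next).selected x = insert e R ∪ (next u).selected x := by
        intro u x hx
        have : x e = u := by simpa using hx e (Finset.mem_insert_self _ _)
        rw [selected_probe, this, Finset.union_insert, Finset.insert_union]
      -- Every run of the subtree for the weight `u` is a run of the whole tree with `x e = u`, so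
      -- the constraint is inherited.
      have h2 : ∀ u x, Q (insert e R ∪ (next u).selected
          ((insert e R).piecewise (Function.update y e u) x)) := by
        intro u x
        rw [← h1 u _ fun f hf => by simp only [Finset.piecewise, hf, if_true]]
        have hx : (insert e R).piecewise (Function.update y e u) x =
            R.piecewise y (Function.update x e u) := by
          ext f
          by_cases hfe : f = e
          · subst hfe; simp [he]
          · by_cases hf : f ∈ R <;> simp [hf, hfe]
        rw [hx]
        exact hsel _
      rw [cev_insert he]
      calc Φ R y ≤ ∑ u, (I.law e u).toReal * Φ (insert e R) (Function.update y e u) :=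
            hstep R e y he hR (hQ _ _ Finset.subset_union_left (h2 0 y))
        _ ≤ _ := Finset.sum_le_sum fun u _ =>
            mul_le_mul_of_nonneg_left ?_ ENNReal.toReal_nonneg
      rw [cev_congr (G := fun x => Φ (insert e R ∪ (next u).selected x) x)
        fun x hx => by rw [h1 u x hx]]
      exact ih u (insert e R) _ (hR.trans (Finset.subset_insert _ _)) (h2 u)

/-- The expected number of successes of a policy outside `R` is at most the largest sum of
success probabilities of a set that it can select. -/
lemma cev_cnt_le {R : Finset (Fin I.n)} {y : Outcome I} (g : ℕ) (π : Policy I) {M : ℝ}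
    (hM : ∀ x, ∑ e ∈ π.selected x \ R, (1 - surv I g e) ≤ M) :
    cev R y (fun x => (cnt g (π.selected x \ R) x : ℝ)) ≤ M := by
  -- The sum of the success probabilities minus the number of successes is a martingale.
  have := optional_stopping (I := I) (fun _ => True) (fun _ _ _ _ => trivial)
    (fun U x => ∑ e ∈ U \ R, (1 - surv I g e) - cnt g (U \ R) x)
    (fun U x x' h => by
      rw [cnt_congr fun e he => h e (Finset.mem_sdiff.1 he).1]) R
    (fun U e x he hR _ => by
      have heR : e ∉ R := fun h => he (hR h)
      have hd : insert e U \ R = insert e (U \ R) := Finset.insert_sdiff_of_notMem _ heR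
      have he' : e ∉ U \ R := by simp [he]
      simp only [hd, cnt_insert he', Finset.sum_insert he']
      have := sum_law_ite (I := I) g e 1 0
      have h1 := sum_law (I := I) e
      set S := ∑ e ∈ U \ R, (1 - surv I g e)
      rw [← sub_nonneg]
      have : ∑ u : Fin (I.m + 1), (I.law e u).toReal *
          (1 - surv I g e + S - ((cnt g (U \ R) x + if (u : ℕ) < g then 1 else 0 : ℕ) : ℝ)) =
          (1 - surv I g e + S - cnt g (U \ R) x) * ∑ u : Fin (I.m + 1), (I.law e u).toReal -
          ∑ u : Fin (I.m + 1), (I.law e u).toReal * (if (u : ℕ) < g then 1 else 0) := by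
        rw [Finset.mul_sum, ← Finset.sum_sub_distrib]
        refine Finset.sum_congr rfl fun u _ => ?_
        push_cast
        ring
      rw [this, h1]
      linarith) π R y subset_rfl (fun _ => trivial)
  simp only [Finset.sdiff_self, Finset.sum_empty, cnt, Finset.filter_empty, Finset.card_empty,
    Nat.cast_zero, sub_zero, Finset.union_sdiff_left] at this
  rw [cev_sub] at this
  have h2 : cev R y (fun x => ∑ e ∈ π.selected x \ R, (1 - surv I g e)) ≤ M := by
    rw [← cev_const R y M]
    exact cev_mono fun x _ => hM x
  unfold cnt
  linarith

/-! ### Comparison with a Poisson process -/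

/-- The probability that at most `j` events of a Poisson process occur up to time `A` is bounded
below by this function. -/
def poissonBound (j : ℕ) (c : ℕ) (A : ℝ) : ℝ :=
  if c ≤ j then Real.exp (-A) * (1 + A / j) ^ (j - c) else 0

/-- The terminal value of the submartingale: `(1 + A / j) ^ j ≤ exp A` keeps it below the indicator
of at most `j` successes. For `j = 0` the quotient `A / j` is `0`. -/
lemma poissonBound_le_one {j c : ℕ} {A : ℝ} (hA : 0 ≤ A) :
    poissonBound j c A ≤ if c ≤ j then 1 else 0 := by
  unfold poissonBound
  split_ifs with h
  · rw [Real.exp_neg, inv_mul_le_iff₀ (Real.exp_pos _), mul_one]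
    have h0 : 0 ≤ A / j := by positivity
    calc (1 + A / j) ^ (j - c) ≤ (1 + A / j) ^ j :=
          pow_le_pow_right₀ (by linarith) (Nat.sub_le _ _)
      _ ≤ Real.exp (A / j) ^ j := by
          gcongr
          linarith [Real.add_one_le_exp (A / j)]
      _ ≤ Real.exp A := by
          rw [← Real.exp_nat_mul, Real.exp_le_exp]
          rcases Nat.eq_zero_or_pos j with rfl | hj
          · simpa using hA
          · field_simp
            exact le_rfl
  · exact le_rfl

/-- An element of hazard `a` succeeds with probability `1 - exp (-a)`. For `c < j`, with `y = 1 + A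
/ j` and `i + 1 = j - c`, the claim reduces to `(1 + a / (y * j)) ^ (i + 1) ≤ 1 + (exp a - 1) / y`.
-/
lemma poissonBound_step {j c : ℕ} {A a : ℝ} (ha : 0 ≤ a) (hA : 0 ≤ A) :
    poissonBound j c (A + a) ≤
      (1 - Real.exp (-a)) * poissonBound j (c + 1) A + Real.exp (-a) * poissonBound j c A := by
  unfold poissonBound
  rcases lt_trichotomy c j with h | rfl | h
  · have hj : (0 : ℝ) < j := by exact_mod_cast (Nat.zero_le c).trans_lt h
    have hj0 : j - c ≤ j := Nat.sub_le _ _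
    obtain ⟨i, hi⟩ : ∃ i, j - c = i + 1 := ⟨j - c - 1, by omega⟩
    have hi' : j - (c + 1) = i := by omega
    rw [if_pos h.le, if_pos (show c + 1 ≤ j by omega), if_pos h.le, hi', hi]
    rw [hi] at hj0
    set y : ℝ := 1 + A / j with hy
    have hy1 : 1 ≤ y := by
      have : 0 ≤ A / j := by positivity
      linarith
    have hy0 : 0 < y := by linarith
    have e1 : 1 + (A + a) / j = y * (1 + a / y / j) := by
      rw [hy] at hy0 ⊢
      field_simp
      ring
    have e2 : (1 + a / y / j) ^ (i + 1) ≤ 1 + (Real.exp a - 1) / y := by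
      have h0 : 0 ≤ a / y / j := by positivity
      calc (1 + a / y / j) ^ (i + 1) ≤ (1 + a / y / j) ^ j :=
            pow_le_pow_right₀ (by linarith) hj0
        _ ≤ Real.exp (a / y / j) ^ j := by
            gcongr
            linarith [Real.add_one_le_exp (a / y / j)]
        _ = Real.exp (a / y) := by
            rw [← Real.exp_nat_mul]
            congr 1
            field_simp
        _ ≤ _ := by
            -- Convexity of `exp` between `0` and `a`, at the point `a / y`.
            have h1 : 0 ≤ 1 / y := by positivity
            have h2 : 0 ≤ 1 - 1 / y := by rw [sub_nonneg, div_le_one hy0]; exact hy1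
            have hc := convexOn_exp.2 (Set.mem_univ a) (Set.mem_univ 0) h1 h2 (by ring)
            simp only [smul_eq_mul, mul_zero, add_zero, Real.exp_zero, mul_one] at hc
            rw [show 1 / y * a = a / y by ring] at hc
            calc _ ≤ _ := hc
              _ = _ := by ring
    have e3 : Real.exp (-(A + a)) * Real.exp a = Real.exp (-A) := by
      rw [← Real.exp_add]; congr 1; ring
    have e4 : Real.exp (-a) * Real.exp (-A) = Real.exp (-(A + a)) := by
      rw [← Real.exp_add]; congr 1; ring
    rw [e1, mul_pow]
    calc Real.exp (-(A + a)) * (y ^ (i + 1) * (1 + a / y / j) ^ (i + 1))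
        ≤ Real.exp (-(A + a)) * (y ^ (i + 1) * (1 + (Real.exp a - 1) / y)) := by gcongr
      _ = Real.exp (-(A + a)) * (y ^ (i + 1) + (Real.exp a - 1) * y ^ i) := by
          rw [pow_succ]; field_simp
      _ = Real.exp (-A) * y ^ i + Real.exp (-(A + a)) * y ^ (i + 1)
            - Real.exp (-(A + a)) * y ^ i := by rw [← e3]; ring
      _ = _ := by rw [← e4]; ring
      _ ≤ _ := le_rfl
  · simp only [le_refl, if_true, Nat.sub_self, pow_zero, mul_one,
      Nat.not_succ_le_self, if_false, mul_zero, zero_add, ← Real.exp_add]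
    rw [show -(A + a) = -a + -A by ring]
  · rw [if_neg (by omega), if_neg (by omega), if_neg (by omega)]
    simp

/-- A policy fails to have more than `j` successes among the elements of `s` at least with the
probability with which the corresponding Poisson process does, if the hazards of the elements of
`s` that it selects never add up to more than `A`. -/
lemma poissonBound_le_cev {R : Finset (Fin I.n)} {y : Outcome I} (g j : ℕ) (π : Policy I)
    (s : Fin I.n → Prop) [DecidablePred s] (hs : ∀ e, s e → 0 < surv I g e) {A : ℝ}
    (Q : Finset (Fin I.n) → Prop) (hQ : ∀ U V, U ⊆ V → Q V → Q U)
    (hπ : ∀ x, Q (π.selected x))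
    (hA : ∀ U, Q U → Disjoint U R → (∀ e ∈ U, s e) → ∑ e ∈ U, -Real.log (surv I g e) ≤ A) :
    Real.exp (-A) * (1 + A / j) ^ j ≤
      cev R y (fun x => if cnt g ((π.selected x \ R).filter s) x ≤ j then 1 else 0) := by
  have hlog : ∀ e, 0 ≤ -Real.log (surv I g e) := fun e =>
    neg_nonneg.2 (Real.log_nonpos (surv_nonneg g e) (surv_le_one g e))
  have hA' : ∀ U, Q (U \ R) →
      ∑ e ∈ (U \ R).filter s, -Real.log (surv I g e) ≤ A := fun U hU =>
    hA _ (hQ _ _ (Finset.filter_subset _ _) hU)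
      (Finset.disjoint_of_subset_left (Finset.filter_subset _ _) Finset.sdiff_disjoint)
      fun e he => (Finset.mem_filter.1 he).2
  have hQ' : ∀ x, Q ((R ∪ π.selected x) \ R) := fun x => by
    rw [Finset.union_sdiff_left]
    exact hQ _ _ Finset.sdiff_subset (hπ x)
  -- The second argument of the bound is the part of `A` not yet used up by probed elements of `s`;
  -- other elements leave it unchanged.
  have := optional_stopping (I := I) (fun U => Q (U \ R))
    (fun U V h hV => hQ _ _ (Finset.sdiff_subset_sdiff h subset_rfl) hV)
    (fun U x => poissonBound j (cnt g ((U \ R).filter s) x)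
      (A - ∑ e ∈ (U \ R).filter s, -Real.log (surv I g e)))
    (fun U x x' h => by
      rw [cnt_congr fun e he => h e (Finset.mem_sdiff.1 (Finset.mem_filter.1 he).1).1]) R
    (fun U e x he hR hq => by
      have heR : e ∉ R := fun h => he (hR h)
      have hd : insert e U \ R = insert e (U \ R) := Finset.insert_sdiff_of_notMem _ heR
      have he' : e ∉ (U \ R).filter s := by simp [he]
      have hle := hA' _ hq
      rw [hd, Finset.filter_insert] at hle
      simp only [hd, Finset.filter_insert]
      split_ifs at hle ⊢ with hse
      · rw [Finset.sum_insert he'] at hle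
        simp only [cnt_insert he', Finset.sum_insert he']
        set c := cnt g ((U \ R).filter s) x
        set S := ∑ e ∈ (U \ R).filter s, -Real.log (surv I g e)
        set a := -Real.log (surv I g e) with ha
        have hea : Real.exp (-a) = surv I g e := by
          rw [ha, neg_neg, Real.exp_log (hs e hse)]
        have h1 := poissonBound_step (j := j) (c := c) (A := A - (a + S)) (hlog e) (by linarith)
        rw [hea] at h1
        rw [show A - S = A - (a + S) + a by ring]
        refine h1.trans (le_of_eq ?_)
        rw [← sum_law_ite]
        refine Finset.sum_congr rfl fun u _ => ?_
        split_ifs <;> simp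
      · rw [← one_mul (poissonBound _ _ _), ← sum_law e, Finset.sum_mul]
        refine Finset.sum_le_sum fun u _ => le_of_eq ?_
        have hc : cnt g ((U \ R).filter s) (Function.update x e u) =
            cnt g ((U \ R).filter s) x := cnt_congr fun f hf => by
          have : f ≠ e := fun h => he (h ▸ (Finset.mem_sdiff.1 (Finset.mem_filter.1 hf).1).1)
          simp [this]
        rw [hc]) π R y subset_rfl (fun x => hQ' _)
  simp only [Finset.sdiff_self, Finset.filter_empty, Finset.sum_empty, sub_zero,
    Finset.union_sdiff_left] at this
  rw [poissonBound, if_pos (by simp [cnt])] at this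
  simp only [cnt, Finset.filter_empty, Finset.card_empty, Nat.sub_zero] at this ⊢
  refine this.trans (cev_mono fun x _ => ?_)
  refine poissonBound_le_one ?_
  have := hA' _ (hQ' x)
  rw [Finset.union_sdiff_left] at this
  linarith

/-! ### Greedy selection -/

section Greedy

variable {n : ℕ}

open Classical in
/-- The first element with the smallest key among the elements `e < i` with property `p`. -/
def pickUpTo (p : Fin n → Prop) (key : Fin n → ℝ) : ℕ → Option (Fin n)
  | 0 => none
  | i + 1 =>
    if h : i < n then
      if p ⟨i, h⟩ ∧ ∀ b ∈ pickUpTo p key i, key ⟨i, h⟩ < key b then some ⟨i, h⟩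
      else pickUpTo p key i
    else pickUpTo p key i

/-- The first element with the smallest key among the elements with property `p`. -/
def pick (p : Fin n → Prop) (key : Fin n → ℝ) : Option (Fin n) := pickUpTo p key n

lemma pickUpTo_spec (p : Fin n → Prop) (key : Fin n → ℝ) (i : ℕ) :
    (pickUpTo p key i = none → ∀ e : Fin n, (e : ℕ) < i → ¬ p e) ∧
    ∀ b, pickUpTo p key i = some b → p b ∧ ∀ e : Fin n, (e : ℕ) < i → p e → key b ≤ key e := by
  induction i with
  | zero => simp [pickUpTo]
  | succ i ih =>
    obtain ⟨ih1, ih2⟩ := ih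
    unfold pickUpTo
    by_cases h : i < n
    · rw [dif_pos h]
      split_ifs with hp
      · refine ⟨by simp, fun b hb => ?_⟩
        obtain rfl := Option.some.inj hb
        refine ⟨hp.1, fun e he hpe => ?_⟩
        rcases Nat.lt_succ_iff_lt_or_eq.1 he with he | he
        · cases hb' : pickUpTo p key i with
          | none => exact absurd hpe (ih1 hb' e he)
          | some b' => exact (hp.2 b' hb').le.trans ((ih2 b' hb').2 e he hpe)
        · exact le_of_eq (congrArg key (Fin.ext he.symm))
      · constructor
        · intro hn e he
          rcases Nat.lt_succ_iff_lt_or_eq.1 he with he | he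
          · exact ih1 hn e he
          · intro hpe
            apply hp
            have : e = ⟨i, h⟩ := Fin.ext he
            exact ⟨this ▸ hpe, by simp [hn]⟩
        · intro b hb
          refine ⟨(ih2 b hb).1, fun e he hpe => ?_⟩
          rcases Nat.lt_succ_iff_lt_or_eq.1 he with he | he
          · exact (ih2 b hb).2 e he hpe
          · have : e = ⟨i, h⟩ := Fin.ext he
            subst this
            by_contra hlt
            exact hp ⟨hpe, fun b' hb' => by
              rw [hb] at hb'
              obtain rfl := Option.mem_some_iff.1 hb'
              exact not_le.1 hlt⟩
    · rw [dif_neg h]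
      exact ⟨fun hn e _ => ih1 hn e (by omega),
        fun b hb => ⟨(ih2 b hb).1, fun e _ => (ih2 b hb).2 e (by omega)⟩⟩

lemma pick_none {p : Fin n → Prop} {key : Fin n → ℝ} (h : pick p key = none) (e : Fin n) :
    ¬ p e := (pickUpTo_spec p key n).1 h e e.2

lemma pick_some {p : Fin n → Prop} {key : Fin n → ℝ} {b : Fin n} (h : pick p key = some b) :
    p b ∧ ∀ e, p e → key b ≤ key e :=
  ⟨((pickUpTo_spec p key n).2 b h).1, fun e => ((pickUpTo_spec p key n).2 b h).2 e e.2⟩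

lemma pick_eq_none {p : Fin n → Prop} {key : Fin n → ℝ} (h : ∀ e, ¬ p e) :
    pick p key = none := by
  cases hb : pick p key with
  | none => rfl
  | some b => exact absurd (pick_some hb).1 (h b)

/-- Add `c` elements with property `q` and smallest keys to a set, and return also the key of the
last one, or `1` if no element was left. -/
def top (q : Fin n → Prop) (key : Fin n → ℝ) : ℕ → Finset (Fin n) → ℝ → Finset (Fin n) × ℝ
  | 0, R, ρ => (R, ρ)
  | c + 1, R, _ =>
    match pick (fun e => e ∉ R ∧ q e) key with
    | none => top q key c R 1
    | some e => top q key c (insert e R) (key e)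

open Classical in
/-- Add elements with property `q` and smallest keys to a set until their total cost exceeds
`B`. -/
def fill (q : Fin n → Prop) (key cost : Fin n → ℝ) (B : ℝ) :
    ℕ → Finset (Fin n) → ℝ → Finset (Fin n)
  | 0, R, _ => R
  | f + 1, R, cs =>
    if cs ≤ B then
      match pick (fun e => e ∉ R ∧ q e) key with
      | none => R
      | some e => fill q key cost B f (insert e R) (cs + cost e)
    else R

lemma top_of_none {q : Fin n → Prop} {key : Fin n → ℝ} {R : Finset (Fin n)}
    (h : ∀ e, ¬ (e ∉ R ∧ q e)) (c : ℕ) : top q key c R 1 = (R, 1) := by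
  induction c with
  | zero => rfl
  | succ c ih => rw [top, pick_eq_none h]; exact ih

lemma sdiff_insert_cases {R R' : Finset (Fin n)} {b : Fin n} (hb : b ∉ R)
    (h : insert b R ⊆ R') : R' \ R = insert b (R' \ insert b R) ∧ b ∉ R' \ insert b R := by
  refine ⟨?_, by simp⟩
  ext e
  by_cases he : e = b
  · subst he
    simp [hb, h (Finset.mem_insert_self _ _)]
  · simp [he]

/-- The returned number is the largest key chosen, or the default `1` when the elements with
property `q` run out. For `c = 0` it would be the unrelated input `ρ`, hence `1 ≤ c`. -/
lemma top_spec (q : Fin n → Prop) (key : Fin n → ℝ) (c : ℕ) (R : Finset (Fin n)) (ρ : ℝ) :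
    R ⊆ (top q key c R ρ).1 ∧ ((top q key c R ρ).1 \ R).card ≤ c ∧
    (∀ e ∈ (top q key c R ρ).1 \ R, q e) ∧
    (1 ≤ c → ((((top q key c R ρ).1 \ R).card = c ∧
        (∀ e ∈ (top q key c R ρ).1 \ R, key e ≤ (top q key c R ρ).2) ∧
        ∃ e ∈ (top q key c R ρ).1 \ R, key e = (top q key c R ρ).2) ∨ (top q key c R ρ).2 = 1) ∧
      ∀ e ∉ (top q key c R ρ).1, key e < (top q key c R ρ).2 → ¬ q e) := by
  induction c generalizing R ρ with
  | zero => simp [top]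
  | succ c ih =>
    rw [top]
    cases hb : pick (fun e => e ∉ R ∧ q e) key with
    | none =>
      have hn := pick_none hb
      simp only [top_of_none hn c]
      simp only [Finset.sdiff_self, Finset.card_empty, Finset.notMem_empty]
      refine ⟨subset_rfl, by omega, by simp, fun _ => ⟨Or.inr trivial, fun e he _ hq => ?_⟩⟩
      exact hn e ⟨he, hq⟩
    | some b =>
      obtain ⟨⟨hbR, hqb⟩, hmin⟩ := pick_some hb
      dsimp only
      obtain ⟨h1, h2, h3, h4⟩ := ih (insert b R) (key b)
      set R' := (top q key c (insert b R) (key b)).1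
      set ρ' := (top q key c (insert b R) (key b)).2 with hρ'
      obtain ⟨hd, hd'⟩ := sdiff_insert_cases hbR h1
      refine ⟨(Finset.subset_insert _ _).trans h1, ?_, ?_, fun _ => ?_⟩
      · rw [hd, Finset.card_insert_of_notMem hd']; omega
      · rw [hd]
        intro e he
        rcases Finset.mem_insert.1 he with rfl | he
        · exact hqb
        · exact h3 e he
      · rcases Nat.eq_zero_or_pos c with rfl | hc
        · have hR' : R' = insert b R := rfl
          have hρ : ρ' = key b := rfl
          refine ⟨Or.inl ⟨?_, ?_, ?_⟩, ?_⟩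
          · rw [hd, Finset.card_insert_of_notMem hd', hR']; simp
          · rw [hd, hR', hρ]; simp
          · rw [hd, hρ]; exact ⟨b, by simp, rfl⟩
          · intro e he hlt hq
            rw [hR'] at he
            exact absurd (hmin e ⟨fun h => he (by simp [h]), hq⟩) (not_le.2 (hρ ▸ hlt))
        · obtain ⟨h5, h6⟩ := h4 hc
          refine ⟨?_, h6⟩
          rcases h5 with ⟨h5, h7, e', he', h8⟩ | h5
          · refine Or.inl ⟨?_, ?_, e', ?_, h8⟩
            · rw [hd, Finset.card_insert_of_notMem hd', h5]
            · rw [hd]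
              intro e he
              rcases Finset.mem_insert.1 he with rfl | he
              · rw [← h8]
                refine hmin e' ⟨fun h => ?_, h3 e' he'⟩
                exact (Finset.mem_sdiff.1 he').2 (by simp [h])
              · exact h7 e he
            · rw [hd]; exact Finset.mem_insert_of_mem he'
          · exact Or.inr h5

/-- `f` is fuel; as `R` has at most `n` elements, `n + 1 ≤ f + R.card` prevents it from running out.
The last clause says that only the last choice exceeds the budget. -/
lemma fill_spec (q : Fin n → Prop) (key cost : Fin n → ℝ) (B : ℝ) (f : ℕ) (R : Finset (Fin n))
    (cs : ℝ) (hf : n + 1 ≤ f + R.card) :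
    R ⊆ fill q key cost B f R cs ∧
    (∀ e ∈ fill q key cost B f R cs \ R, q e ∧
      ∀ e' ∉ fill q key cost B f R cs, q e' → key e ≤ key e') ∧
    ((∀ e' ∉ fill q key cost B f R cs, ¬ q e') ∨
      B < cs + ∑ e ∈ fill q key cost B f R cs \ R, cost e) ∧
    (fill q key cost B f R cs = R ∨ ∃ b ∈ fill q key cost B f R cs \ R,
      cs + ∑ e ∈ (fill q key cost B f R cs \ R).erase b, cost e ≤ B) := by
  induction f generalizing R cs with
  | zero =>
    have := Finset.card_le_univ R
    simp at this
    omega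
  | succ f ih =>
    rw [fill]
    by_cases hcs : cs ≤ B
    · rw [if_pos hcs]
      cases hb : pick (fun e => e ∉ R ∧ q e) key with
      | none =>
        have hn := pick_none hb
        simp only [Finset.sdiff_self]
        exact ⟨subset_rfl, by simp, Or.inl fun e he hq => hn e ⟨he, hq⟩, Or.inl trivial⟩
      | some b =>
        obtain ⟨⟨hbR, hqb⟩, hmin⟩ := pick_some hb
        dsimp only
        obtain ⟨h1, h2, h3, h4⟩ := ih (insert b R) (cs + cost b)
          (by rw [Finset.card_insert_of_notMem hbR]; omega)
        set R' := fill q key cost B f (insert b R) (cs + cost b)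
        obtain ⟨hd, hd'⟩ := sdiff_insert_cases hbR h1
        refine ⟨(Finset.subset_insert _ _).trans h1, ?_, ?_, Or.inr ?_⟩
        · rw [hd]
          intro e he
          rcases Finset.mem_insert.1 he with rfl | he
          · exact ⟨hqb, fun e' he' hq' =>
              hmin e' ⟨fun h => he' (h1 (Finset.mem_insert_of_mem h)), hq'⟩⟩
          · exact h2 e he
        · refine h3.imp id fun h => ?_
          rw [hd, Finset.sum_insert hd']
          linarith
        · rcases h4 with h4 | ⟨b', hb', h4⟩
          · refine ⟨b, by rw [hd]; simp, ?_⟩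
            rw [hd, Finset.erase_insert hd', h4]
            simpa using hcs
          · have hne : b ≠ b' := fun h => hd' (h ▸ hb')
            refine ⟨b', by rw [hd]; exact Finset.mem_insert_of_mem hb', ?_⟩
            rw [hd, Finset.erase_insert_of_ne hne, Finset.sum_insert (by simp)]
            linarith
    · rw [if_neg hcs]
      simp only [Finset.sdiff_self]
      exact ⟨subset_rfl, by simp, Or.inr (by simpa using hcs), Or.inl trivial⟩

/-- Choosing elements by cost per value until the budget is exceeded yields at least the value of
every set that respects the budget. -/
lemma greedy_value_le {S U : Finset (Fin n)} {cost val : Fin n → ℝ} {B : ℝ}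
    (hc : ∀ e, 0 ≤ cost e) (hvS : ∀ e ∈ S, 0 < val e) (hvU : ∀ e ∈ U \ S, 0 < val e)
    (hkey : ∀ e ∈ S, ∀ e' ∈ U \ S, cost e / val e ≤ cost e' / val e')
    (hS : B < ∑ e ∈ S, cost e) (hU : ∑ e ∈ U, cost e ≤ B) :
    ∑ e ∈ U, val e ≤ ∑ e ∈ S, val e := by
  have hne : S.Nonempty := by
    by_contra h
    rw [Finset.not_nonempty_iff_eq_empty.1 h, Finset.sum_empty] at hS
    have := Finset.sum_nonneg fun e (_ : e ∈ U) => hc e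
    linarith
  obtain ⟨b, hb, hmax⟩ := Finset.exists_max_image S (fun e => cost e / val e) hne
  -- The worst ratio in `S` separates the two sets: ratios are at most `θ` on `S` and at least `θ`
  -- on `U \ S`.
  set θ := cost b / val b with hθ
  have h1 : ∀ e ∈ S, cost e ≤ θ * val e := fun e he => by
    have := hmax e he
    rwa [div_le_iff₀ (hvS e he)] at this
  have h2 : ∀ e ∈ U \ S, θ * val e ≤ cost e := fun e he => by
    have := hkey b hb e he
    rwa [le_div_iff₀ (hvU e he)] at this
  have hθ0 : 0 ≤ θ := div_nonneg (hc b) (hvS b hb).le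
  have sS := Finset.sum_inter_add_sum_sdiff S U cost
  have sU := Finset.sum_inter_add_sum_sdiff U S cost
  have vS := Finset.sum_inter_add_sum_sdiff S U val
  have vU := Finset.sum_inter_add_sum_sdiff U S val
  rw [Finset.inter_comm] at sU vU
  have c1 : ∑ e ∈ S \ U, cost e ≤ θ * ∑ e ∈ S \ U, val e := by
    rw [Finset.mul_sum]
    exact Finset.sum_le_sum fun e he => h1 e (Finset.mem_sdiff.1 he).1
  have c2 : θ * ∑ e ∈ U \ S, val e ≤ ∑ e ∈ U \ S, cost e := by
    rw [Finset.mul_sum]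
    exact Finset.sum_le_sum h2
  have hlt : θ * ∑ e ∈ U \ S, val e < θ * ∑ e ∈ S \ U, val e := by linarith
  have := lt_of_mul_lt_mul_left hlt hθ0
  linarith

end Greedy

/-! ### Batches -/

/-- The number of elements that a batch takes for their success probability alone. -/
def topCount (D : ℝ) : ℕ := ⌊D / 24⌋₊ + 1

/-- The first part of a batch. -/
def batchTop (I : Problem) (g : ℕ) (D : ℝ) (R : Finset (Fin I.n)) : Finset (Fin I.n) × ℝ :=
  top (fun e => (I.cost e : ℝ) * (topCount D : ℕ) ≤ I.budget) (surv I g) (topCount D) R 1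

/-- The elements that are eligible for the second part of a batch. -/
def Eligible (I : Problem) (g : ℕ) (ρ : ℝ) (e : Fin I.n) : Prop :=
  ρ ≤ surv I g e ∧ surv I g e < 1 ∧ (I.cost e : ℝ) ≤ I.budget

/-- The second part of a batch. -/
def batchFill (I : Problem) (g : ℕ) (ρ : ℝ) (R : Finset (Fin I.n)) : Finset (Fin I.n) :=
  -- The key is cost per hazard. A sure success would have hazard `-Real.log 0 = 0`, which is why
  -- `BatchSpec.hazard_fill` assumes `0 < ρ`.
  fill (Eligible I g ρ) (fun e => (I.cost e : ℝ) / (0 - Real.log (surv I g e)))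
    (fun e => (I.cost e : ℝ)) I.budget (I.n + 1) R 0

/-- A set `R` after a batch for the threshold `g` and at most `D` missing weights. -/
def batch (I : Problem) (g : ℕ) (D : ℝ) (R : Finset (Fin I.n)) : Finset (Fin I.n) :=
  batchFill I g (batchTop I g D R).2 (batchTop I g D R).1

lemma feasible_iff {S : Finset (Fin I.n)} :
    Feasible I S ↔ ∑ e ∈ S, (I.cost e : ℝ) ≤ I.budget := by
  unfold Feasible
  rw [← NNReal.coe_le_coe, NNReal.coe_sum]

lemma Feasible.subset {S T : Finset (Fin I.n)} (hT : Feasible I T) (h : S ⊆ T) :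
    Feasible I S := le_trans (Finset.sum_le_sum_of_subset h) hT

lemma Feasible.cost_le {S : Finset (Fin I.n)} (hS : Feasible I S) {e : Fin I.n} (he : e ∈ S) :
    (I.cost e : ℝ) ≤ I.budget := by
  have := hS.subset (Finset.singleton_subset_iff.2 he)
  simpa [feasible_iff] using this

/-- What the analysis uses about a batch from `R` to `R₂`, with first part `R₁ \ R`. -/
structure BatchSpec (g : ℕ) (D ρ : ℝ) (R R₁ R₂ : Finset (Fin I.n)) : Prop where
  sub₁ : R ⊆ R₁
  sub₂ : R₁ ⊆ R₂
  rho_nonneg : 0 ≤ ρ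
  rho_le_one : ρ ≤ 1
  card_top_le : (R₁ \ R).card ≤ topCount D
  -- When the cheap elements run out, `ρ = 1`: every remaining element that can succeed at all is
  -- expensive.
  card_top : (R₁ \ R).card = topCount D ∨ ρ = 1
  surv_top : ∀ e ∈ R₁ \ R, surv I g e ≤ ρ
  feasible_top : Feasible I (R₁ \ R)
  -- Such elements cost more than `budget / topCount D` each, since a cheap one would have been
  -- taken into the first part.
  card_big : ∀ U, Feasible I U → Disjoint U R₁ → (∀ e ∈ U, surv I g e < ρ) →
    U.card + 1 ≤ topCount D
  surv_fill : ∀ e ∈ R₂ \ R₁, ρ ≤ surv I g e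
  hazard_fill : 0 < ρ → ∀ U, Feasible I U → Disjoint U R₁ → (∀ e ∈ U, ρ ≤ surv I g e) →
    ∑ e ∈ U, -Real.log (surv I g e) ≤ ∑ e ∈ R₂ \ R₁, -Real.log (surv I g e)
  -- All choices but the last fit into the budget together, and the last one fits alone.
  feasible_fill : ∃ A A', Feasible I A ∧ Feasible I A' ∧ R₂ = R₁ ∪ A ∪ A'

lemma batchTop_spec (g : ℕ) (D : ℝ) (R : Finset (Fin I.n)) :
    R ⊆ (batchTop I g D R).1 ∧ ((batchTop I g D R).1 \ R).card ≤ topCount D ∧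
    (∀ e ∈ (batchTop I g D R).1 \ R, (I.cost e : ℝ) * (topCount D : ℕ) ≤ I.budget) ∧
    ((((batchTop I g D R).1 \ R).card = topCount D ∧
        (∀ e ∈ (batchTop I g D R).1 \ R, surv I g e ≤ (batchTop I g D R).2) ∧
        ∃ e ∈ (batchTop I g D R).1 \ R, surv I g e = (batchTop I g D R).2) ∨
      (batchTop I g D R).2 = 1) ∧
    ∀ e ∉ (batchTop I g D R).1, surv I g e < (batchTop I g D R).2 →
      ¬ (I.cost e : ℝ) * (topCount D : ℕ) ≤ I.budget := by
  obtain ⟨h1, h2, h3, h4⟩ := top_spec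
    (fun e => (I.cost e : ℝ) * (topCount D : ℕ) ≤ I.budget) (surv I g) (topCount D) R 1
  exact ⟨h1, h2, h3, h4 (Nat.le_add_left _ _)⟩

lemma batch_spec (g : ℕ) (D : ℝ) (R : Finset (Fin I.n)) :
    BatchSpec g D (batchTop I g D R).2 R (batchTop I g D R).1 (batch I g D R) := by
  obtain ⟨h1, h2, h3, h4, h5⟩ := batchTop_spec g D R
  set R₁ := (batchTop I g D R).1 with hR₁
  set ρ := (batchTop I g D R).2 with hρ
  obtain ⟨f1, f2, f3, f4⟩ := fill_spec (Eligible I g ρ)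
    (fun e => (I.cost e : ℝ) / (0 - Real.log (surv I g e))) (fun e => (I.cost e : ℝ)) I.budget
    (I.n + 1) R₁ 0 (Nat.le_add_right _ _)
  have hbt : fill (Eligible I g ρ)
    (fun e => (I.cost e : ℝ) / (0 - Real.log (surv I g e))) (fun e => (I.cost e : ℝ)) I.budget
    (I.n + 1) R₁ 0 = batch I g D R := rfl
  rw [hbt] at f1 f2 f3 f4
  have hpos : (0 : ℝ) < (topCount D : ℕ) := by
    unfold topCount; positivity
  have hfeas1 : ∀ e ∈ batch I g D R \ R₁, Feasible I {e} := fun e he => by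
    rw [feasible_iff, Finset.sum_singleton]
    exact (f2 e he).1.2.2
  refine ⟨h1, f1, ?_, ?_, h2, h4.imp (fun h => h.1) id, ?_, ?_, ?_, fun e he => (f2 e he).1.1, ?_, ?_⟩
  · rcases h4 with ⟨-, -, e, -, he⟩ | h
    · rw [← he]; exact surv_nonneg g e
    · rw [h]; exact zero_le_one
  · rcases h4 with ⟨-, -, e, -, he⟩ | h
    · rw [← he]; exact surv_le_one g e
    · rw [h]
  · rcases h4 with ⟨-, h, -⟩ | h
    · exact h
    · rw [h]; exact fun e _ => surv_le_one g e
  · rw [feasible_iff]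
    calc ∑ e ∈ R₁ \ R, (I.cost e : ℝ) ≤ ∑ e ∈ R₁ \ R, (I.budget : ℝ) / (topCount D : ℕ) :=
          Finset.sum_le_sum fun e he => by
            rw [le_div_iff₀ hpos]; exact h3 e he
      _ = (R₁ \ R).card * ((I.budget : ℝ) / (topCount D : ℕ)) := by simp
      _ ≤ (topCount D : ℕ) * ((I.budget : ℝ) / (topCount D : ℕ)) := by gcongr
      _ = I.budget := by field_simp
  · intro U hU hd hs
    by_contra hcard
    have hcard' : topCount D ≤ U.card := by omega
    have hne : U.Nonempty := by
      rw [← Finset.card_pos]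
      exact lt_of_lt_of_le (Nat.succ_pos _) hcard'
    rw [feasible_iff] at hU
    have hlt : ∑ e ∈ U, (I.budget : ℝ) / (topCount D : ℕ) < ∑ e ∈ U, (I.cost e : ℝ) :=
      Finset.sum_lt_sum_of_nonempty hne fun e he => by
        rw [div_lt_iff₀ hpos]
        exact not_le.1 (h5 e (Finset.disjoint_left.1 hd he) (hs e he))
    have : (I.budget : ℝ) ≤ ∑ e ∈ U, (I.budget : ℝ) / (topCount D : ℕ) := by
      rw [Finset.sum_const, nsmul_eq_mul]
      calc (I.budget : ℝ) = (topCount D : ℕ) * ((I.budget : ℝ) / (topCount D : ℕ)) := by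
            field_simp
        _ ≤ _ := by gcongr
    linarith
  · intro hρ0 U hU hd hs
    have hpos' : ∀ e, ρ ≤ surv I g e → surv I g e < 1 → 0 < -Real.log (surv I g e) :=
      fun e he he1 => neg_pos.2 (Real.log_neg (hρ0.trans_le he) he1)
    -- Elements that cannot succeed have hazard `0` and may be dropped; the rest of `U` is eligible
    -- or already taken.
    have hU' : ∑ e ∈ U.filter (fun e => surv I g e < 1), -Real.log (surv I g e) =
        ∑ e ∈ U, -Real.log (surv I g e) := by
      refine Finset.sum_filter_of_ne fun e _ hne => lt_of_le_of_ne (surv_le_one g e) fun h => ?_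
      rw [h, Real.log_one, neg_zero] at hne
      exact hne rfl
    rw [← hU']
    have hmem : ∀ e ∈ U.filter (fun e => surv I g e < 1), e ∉ batch I g D R →
        Eligible I g ρ e := fun e he _ => by
      obtain ⟨he, h1⟩ := Finset.mem_filter.1 he
      exact ⟨hs e he, h1, hU.cost_le he⟩
    rcases f3 with f3 | f3
    · refine Finset.sum_le_sum_of_subset_of_nonneg (fun e he => ?_) fun e he _ =>
        (hpos' e (f2 e he).1.1 (f2 e he).1.2.1).le
      by_cases hb : e ∈ batch I g D R
      · exact Finset.mem_sdiff.2 ⟨hb, Finset.disjoint_left.1 hd (Finset.mem_filter.1 he).1⟩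
      · exact absurd (hmem e he hb) (f3 e hb)
    · have hout : ∀ e ∈ U.filter (fun e => surv I g e < 1) \ (batch I g D R \ R₁),
          e ∉ batch I g D R ∧ Eligible I g ρ e := fun e he => by
        obtain ⟨he, hb⟩ := Finset.mem_sdiff.1 he
        have : e ∉ batch I g D R := fun h => hb (Finset.mem_sdiff.2
          ⟨h, Finset.disjoint_left.1 hd (Finset.mem_filter.1 he).1⟩)
        exact ⟨this, hmem e he this⟩
      refine greedy_value_le (cost := fun e => (I.cost e : ℝ)) (B := I.budget)
        (fun e => NNReal.coe_nonneg _) (fun e he => hpos' e (f2 e he).1.1 (f2 e he).1.2.1)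
        (fun e he => hpos' e (hout e he).2.1 (hout e he).2.2.1) (fun e he e' he' => ?_)
        (by simpa using f3) (feasible_iff.1 (hU.subset (Finset.filter_subset _ _)))
      simpa using (f2 e he).2 e' (hout e' he').1 (hout e' he').2
  · rcases f4 with f4 | ⟨b, hb, f4⟩
    · exact ⟨∅, ∅, by simp [Feasible], by simp [Feasible], by simpa using f4⟩
    · refine ⟨(batch I g D R \ R₁).erase b, {b}, ?_, hfeas1 b hb, ?_⟩
      · rw [feasible_iff]; simpa using f4
      · rw [Finset.union_assoc, Finset.union_singleton, Finset.insert_erase hb,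
          Finset.union_sdiff_of_subset f1]

/-! ### The probability that batches fail -/

lemma topCount_le {D : ℝ} (hD : 0 ≤ D) : (topCount D : ℝ) ≤ D / 24 + 1 := by
  unfold topCount
  push_cast
  linarith [Nat.floor_le (show 0 ≤ D / 24 by positivity)]

lemma lt_topCount (D : ℝ) : D / 24 < topCount D := by
  unfold topCount
  push_cast
  exact Nat.lt_floor_add_one _

/-- The probability that `W` has fewer than `D / 200` successes. -/
def tail (g : ℕ) (D : ℝ) (W : Finset (Fin I.n)) : ℝ :=
  ev fun x => if (cnt g W x : ℝ) < D / 200 then 1 else 0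

lemma tail_nonneg (g : ℕ) (D : ℝ) (W : Finset (Fin I.n)) : 0 ≤ tail g D W :=
  ev_nonneg fun x => by split_ifs <;> norm_num

lemma cev_eq_ev {R B : Finset (Fin I.n)} (y : Outcome I) {G : Outcome I → ℝ}
    (hG : ∀ x x', (∀ e ∈ B, x e = x' e) → G x = G x') (hAB : Disjoint R B) :
    cev R y G = ev G := by
  have := cev_mul_indep y (F := fun _ => 1) subset_rfl (fun _ _ _ => rfl) hG hAB
  simpa [cev_const] using this

lemma pow_cnt (g : ℕ) (W : Finset (Fin I.n)) (x : Outcome I) (z : ℝ) :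
    z ^ cnt g W x = ∏ e ∈ W, if (x e : ℕ) < g then z else 1 := by
  rw [cnt, Finset.prod_ite]
  simp

lemma ev_pow_cnt (g : ℕ) (W : Finset (Fin I.n)) (z : ℝ) :
    ev (fun x => z ^ cnt g W x) = ∏ e ∈ W, ((1 - surv I g e) * z + surv I g e) := by
  simp only [pow_cnt]
  rw [ev_prod_on W fun _ u => if (u : ℕ) < g then z else 1]
  exact Finset.prod_congr rfl fun e _ => by rw [sum_law_ite, mul_one]

/-- Chernoff bound: on the event `z ^ cnt g W x` is at least `z ^ ⌊D / 200⌋₊`, because `z ≤ 1`. -/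
lemma tail_le_moment (g : ℕ) (D : ℝ) (W : Finset (Fin I.n)) {z : ℝ} (hz : 0 < z)
    (hz1 : z ≤ 1) :
    tail g D W ≤ (z ^ ⌊D / 200⌋₊)⁻¹ * ∏ e ∈ W, ((1 - surv I g e) * z + surv I g e) := by
  rw [← ev_pow_cnt, ← ev_mul]
  refine ev_mono fun x => ?_
  split_ifs with h
  · rw [inv_mul_eq_div, one_le_div (by positivity)]
    exact pow_le_pow_of_le_one hz.le hz1 (Nat.le_floor h.le)
  · positivity

/-- Outside the first part, a feasible set has at most `topCount D - 1 ≤ D / 24` elements with `surv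
I g e < ρ`, so only those with `ρ ≤ surv I g e` need probabilistic control. -/
lemma cnt_decompose {g : ℕ} {D ρ : ℝ} {R R₁ R₂ : Finset (Fin I.n)}
    (h : BatchSpec g D ρ R R₁ R₂) (hD : 0 ≤ D) {S : Finset (Fin I.n)} (hS : Feasible I S)
    (x : Outcome I) :
    (cnt g (S \ R) x : ℝ) ≤ cnt g (R₁ \ R) x +
      cnt g ((S \ R₁).filter fun e => ρ ≤ surv I g e) x + D / 24 := by
  have hsub : S \ R ⊆ (R₁ \ R ∪ (S \ R₁).filter fun e => ρ ≤ surv I g e) ∪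
      (S \ R₁).filter fun e => surv I g e < ρ := by
    intro e he
    obtain ⟨he, heR⟩ := Finset.mem_sdiff.1 he
    by_cases h1 : e ∈ R₁
    · simp [h1, heR]
    · rcases le_or_gt ρ (surv I g e) with h2 | h2
      · simp [h1, he, h2]
      · simp [h1, he, h2]
  have hb := h.card_big _ (hS.subset ((Finset.filter_subset (fun e => surv I g e < ρ) _).trans
    (Finset.sdiff_subset (t := R₁))))
    (Finset.disjoint_of_subset_left (Finset.filter_subset _ _) Finset.sdiff_disjoint)
    (fun e he => (Finset.mem_filter.1 he).2)
  have h1 := (cnt_mono (g := g) hsub x).trans ((cnt_union_le _ _ _ _).trans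
    (Nat.add_le_add (cnt_union_le _ _ _ _) (cnt_le_card _ _ _)))
  have h2 : (cnt g (S \ R) x : ℝ) ≤ cnt g (R₁ \ R) x +
      cnt g ((S \ R₁).filter fun e => ρ ≤ surv I g e) x +
      ((S \ R₁).filter fun e => surv I g e < ρ).card := by exact_mod_cast h1
  have h3 : (((S \ R₁).filter fun e => surv I g e < ρ).card : ℝ) + 1 ≤ topCount D := by
    exact_mod_cast hb
  linarith [topCount_le hD]

/-- The hazard of the second part of a batch. -/
def hazard (g : ℕ) (W : Finset (Fin I.n)) : ℝ := ∑ e ∈ W, -Real.log (surv I g e)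

lemma hazard_nonneg (g : ℕ) (W : Finset (Fin I.n)) : 0 ≤ hazard g W :=
  Finset.sum_nonneg fun e _ => neg_nonneg.2 (Real.log_nonpos (surv_nonneg g e) (surv_le_one g e))

lemma exp_neg_hazard {g : ℕ} {W : Finset (Fin I.n)} (h : ∀ e ∈ W, 0 < surv I g e) :
    Real.exp (-hazard g W) = ∏ e ∈ W, surv I g e := by
  rw [hazard, ← Finset.sum_neg_distrib, Real.exp_sum]
  exact Finset.prod_congr rfl fun e he => by rw [neg_neg, Real.exp_log (h e he)]

/-- For `ρ = 0` all of the more than `D / 24` elements of the first part succeed almost surely; a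
union bound makes this precise. -/
lemma tail_eq_zero {g : ℕ} {D : ℝ} {R R₁ R₂ : Finset (Fin I.n)}
    (h : BatchSpec g D 0 R R₁ R₂) : tail g D (R₂ \ R) = 0 := by
  refine le_antisymm ?_ (tail_nonneg _ _ _)
  have hz : ∀ e ∈ R₁ \ R, surv I g e = 0 := fun e he =>
    le_antisymm (h.surv_top e he) (surv_nonneg g e)
  have hcard : (R₁ \ R).card = topCount D := h.card_top.resolve_right zero_ne_one
  calc tail g D (R₂ \ R)
      ≤ ev fun x => ∑ e ∈ R₁ \ R, if (x e : ℕ) < g then 0 else 1 := by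
        refine ev_mono fun x => ?_
        have hnn : ∀ e ∈ R₁ \ R, (0 : ℝ) ≤ if (x e : ℕ) < g then 0 else 1 := fun e _ => by
          split_ifs <;> norm_num
        split_ifs with hlt
        · by_contra hcon
          have hall : ∀ e ∈ R₁ \ R, (x e : ℕ) < g := by
            intro e he
            by_contra hge
            apply hcon
            refine le_trans ?_ (Finset.single_le_sum hnn he)
            rw [if_neg hge]
          have : cnt g (R₁ \ R) x = (R₁ \ R).card := by
            rw [cnt, Finset.filter_true_of_mem hall]
          have h2 : cnt g (R₁ \ R) x ≤ cnt g (R₂ \ R) x :=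
            cnt_mono (Finset.sdiff_subset_sdiff h.sub₂ subset_rfl) x
          have h3 : (topCount D : ℝ) ≤ cnt g (R₂ \ R) x := by
            rw [← hcard, ← this]; exact_mod_cast h2
          linarith [lt_topCount D]
        · exact Finset.sum_nonneg hnn
    _ = ∑ e ∈ R₁ \ R, surv I g e := by
        rw [ev_sum]
        refine Finset.sum_congr rfl fun e _ => ?_
        rw [ev_coord e fun u : Fin (I.m + 1) => if (u : ℕ) < g then (0 : ℝ) else 1, sum_law_ite]
        ring
    _ = 0 := Finset.sum_eq_zero hz
    _ ≤ 0 := le_rfl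

/-- The probability that a policy has at most `0.495 D` successes outside `R`. -/
def optFail (g : ℕ) (D : ℝ) (R : Finset (Fin I.n)) (y : Outcome I) (π : Policy I) : ℝ :=
  cev R y fun x => if (cnt g (π.selected x \ R) x : ℝ) ≤ 99 / 200 * D then 1 else 0

lemma optFail_nonneg (g : ℕ) (D : ℝ) (R : Finset (Fin I.n)) (y : Outcome I) (π : Policy I) :
    0 ≤ optFail g D R y π := cev_nonneg fun x => by split_ifs <;> norm_num

/-- By the greedy choice, the hazard of the second part bounds that of every feasible set of such
elements, so one value of `A` serves all branches of the policy. -/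
lemma exp_mul_le_cev {g : ℕ} {D ρ : ℝ} {R R₁ R₂ : Finset (Fin I.n)}
    (h : BatchSpec g D ρ R R₁ R₂) (hρ : 0 < ρ) {π : Policy I} (hπ : π.Admissible) (j : ℕ)
    (z : Outcome I) :
    Real.exp (-hazard g (R₂ \ R₁)) * (1 + hazard g (R₂ \ R₁) / j) ^ j ≤
      cev R₁ z fun x =>
        if cnt g ((π.selected x \ R₁).filter fun e => ρ ≤ surv I g e) x ≤ j then 1 else 0 := by
  classical
  exact poissonBound_le_cev g j π (fun e => ρ ≤ surv I g e) (fun e he => hρ.trans_le he)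
    (Feasible I) (fun U V h hV => hV.subset h) hπ fun U hU hd hs => h.hazard_fill hρ U hU hd hs

/-- For `D ≤ 200` failing means no success at all. If the first part has none, the policy has none
among the elements with `ρ ≤ surv I g e` at least with the probability that the second part has
none, and the expensive elements add at most `D / 24`. -/
lemma tail_le_of_small {g : ℕ} {D ρ : ℝ} {R R₁ R₂ : Finset (Fin I.n)}
    (h : BatchSpec g D ρ R R₁ R₂) (hρ : 0 < ρ) (hD : 0 ≤ D) (hD' : D ≤ 200)
    (y : Outcome I) {π : Policy I} (hπ : π.Admissible) :
    tail g D (R₂ \ R) ≤ optFail g D R y π := by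
  have hA := exp_mul_le_cev h hρ hπ 0
  have hdisj : Disjoint (R₁ \ R) (R₂ \ R₁) := by
    refine Finset.disjoint_left.2 fun e he he' => ?_
    exact (Finset.mem_sdiff.1 he').2 (Finset.mem_sdiff.1 he).1
  have hunion : R₂ \ R = (R₁ \ R) ∪ (R₂ \ R₁) := by
    ext e
    simp only [Finset.mem_sdiff, Finset.mem_union]
    have := @h.sub₁ e
    have := @h.sub₂ e
    tauto
  have hev : ∀ W : Finset (Fin I.n), ev (fun x => (0 : ℝ) ^ cnt g W x) = ∏ e ∈ W, surv I g e :=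
    fun W => by rw [ev_pow_cnt]; simp
  calc tail g D (R₂ \ R) ≤ ev fun x => (0 : ℝ) ^ cnt g (R₂ \ R) x := by
        refine ev_mono fun x => ?_
        split_ifs with hlt
        · have : (cnt g (R₂ \ R) x : ℝ) < 1 := by linarith
          have : cnt g (R₂ \ R) x = 0 := by
            have : cnt g (R₂ \ R) x < 1 := by exact_mod_cast this
            omega
          rw [this, pow_zero]
        · positivity
    _ = Real.exp (-hazard g (R₂ \ R₁)) * ev fun x => (0 : ℝ) ^ cnt g (R₁ \ R) x := by
        rw [hev, hev, hunion, Finset.prod_union hdisj, exp_neg_hazard, mul_comm]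
        exact fun e he => hρ.trans_le (h.surv_fill e he)
    _ = cev R y fun x => Real.exp (-hazard g (R₂ \ R₁)) * (0 : ℝ) ^ cnt g (R₁ \ R) x := by
        rw [cev_mul]
        congr 1
        refine (cev_eq_ev y (B := R₁ \ R) (fun x x' hx => ?_) Finset.disjoint_sdiff).symm
        rw [cnt_congr hx]
    _ ≤ cev R y fun x => cev R₁ x fun x' =>
          if (cnt g (π.selected x' \ R) x' : ℝ) ≤ 99 / 200 * D then 1 else 0 := by
        refine cev_mono fun x _ => ?_
        rcases Nat.eq_zero_or_pos (cnt g (R₁ \ R) x) with h0 | h0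
        · rw [h0, pow_zero, mul_one]
          have := hA x
          rw [pow_zero, mul_one] at this
          refine this.trans (cev_mono fun x' hx' => ?_)
          have h1 := cnt_decompose h hD (hπ x') x'
          have h2 : cnt g (R₁ \ R) x' = 0 := by
            rw [← h0]; exact cnt_congr fun e he => hx' e (Finset.mem_sdiff.1 he).1
          split_ifs with h3 h4 h4
          · exact le_rfl
          · refine absurd ?_ h4
            rw [Nat.le_zero.1 h3, h2] at h1
            norm_num at h1 ⊢
            linarith
          · exact zero_le_one
          · exact le_rfl
        · rw [zero_pow h0.ne', mul_zero]
          exact cev_nonneg fun x' => by split_ifs <;> norm_num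
    _ = optFail g D R y π := cev_cev h.sub₁ _ _

/-- With the hazard `A` of the second part and `Y = 1 + A / j`, the policy has few successes with
probability at least `exp (-A) * Y ^ j`. The Chernoff bound with `z = ρ / Y` yields the same
quantity for the batch, up to the factor `2 ^ topCount D * exp j ≤ exp (D / 3)`. -/
lemma tail_le_of_large {g : ℕ} {D ρ : ℝ} {R R₁ R₂ : Finset (Fin I.n)}
    (h : BatchSpec g D ρ R R₁ R₂) (hρ : 0 < ρ) (hD : 200 ≤ D)
    (y : Outcome I) {π : Policy I} (hπ : π.Admissible) :
    tail g D (R₂ \ R) ≤ Real.exp (D / 3) * optFail g D R y π := by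
  set j := ⌊D / 4⌋₊ with hj
  set ν := ⌊D / 200⌋₊ with hν
  set A := hazard g (R₂ \ R₁) with hA
  have hA0 : 0 ≤ A := hazard_nonneg _ _
  have hjD : (j : ℝ) ≤ D / 4 := Nat.floor_le (by positivity)
  have hjD' : D / 4 < j + 1 := Nat.lt_floor_add_one _
  have hνD : (ν : ℝ) ≤ D / 200 := Nat.floor_le (by positivity)
  have hj0 : (0 : ℝ) < j := by linarith
  have hνj : ν ≤ j := by
    have : (ν : ℝ) ≤ j := by linarith
    exact_mod_cast this
  have hνh : ν ≤ topCount D := by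
    have : (ν : ℝ) ≤ topCount D := by linarith [lt_topCount D]
    exact_mod_cast this
  have hD0 : 0 ≤ D := by linarith
  -- At most `topCount D` successes in the first part, `j ≤ D / 4` among the elements with `ρ ≤ surv
  -- I g e`, and `D / 24` others: together at most `99 / 200 * D`, as `D ≥ 200`.
  have hq : Real.exp (-A) * (1 + A / j) ^ j ≤ optFail g D R y π := by
    rw [optFail, ← cev_cev h.sub₁, ← cev_const R y (Real.exp (-A) * _)]
    refine cev_mono fun x _ => (exp_mul_le_cev h hρ hπ j x).trans (cev_mono fun x' hx' => ?_)
    have h1 := cnt_decompose h hD0 (hπ x') x'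
    have h2 : (cnt g (R₁ \ R) x' : ℝ) ≤ topCount D := by
      exact_mod_cast (cnt_le_card _ _ _).trans h.card_top_le
    have h5 := topCount_le hD0
    split_ifs with h3 h4 h4
    · exact le_rfl
    · refine absurd ?_ h4
      have h3' : (cnt g ((π.selected x' \ R₁).filter fun e => ρ ≤ surv I g e) x' : ℝ) ≤ j := by
        exact_mod_cast h3
      linarith
    · exact zero_le_one
    · exact le_rfl
  set Y : ℝ := 1 + A / j with hY
  have hY1 : 1 ≤ Y := by
    have : 0 ≤ A / j := by positivity
    linarith
  have hY0 : 0 < Y := by linarith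
  have hρ1 := h.rho_le_one
  -- This suits both parts: `surv I g e ≤ ρ` in the first gives factors of at most `2 * ρ`, and `ρ ≤
  -- surv I g e` in the second gives `z ≤ surv I g e / Y`.
  set z := ρ / Y with hz
  have hz0 : 0 < z := by positivity
  have hzρ : z ≤ ρ := div_le_self hρ.le hY1
  have hfac : ∀ e, 0 ≤ (1 - surv I g e) * z + surv I g e := fun e =>
    add_nonneg (mul_nonneg (by linarith [surv_le_one g e]) hz0.le) (surv_nonneg g e)
  have hdisj : Disjoint (R₁ \ R) (R₂ \ R₁) := by
    refine Finset.disjoint_left.2 fun e he he' => ?_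
    exact (Finset.mem_sdiff.1 he').2 (Finset.mem_sdiff.1 he).1
  have hunion : R₂ \ R = (R₁ \ R) ∪ (R₂ \ R₁) := by
    ext e
    simp only [Finset.mem_sdiff, Finset.mem_union]
    have := @h.sub₁ e
    have := @h.sub₂ e
    tauto
  have hp1 : ∏ e ∈ R₁ \ R, ((1 - surv I g e) * z + surv I g e) ≤ (2 * ρ) ^ topCount D := by
    rcases h.card_top with hc | hc
    · rw [← hc]
      rw [← Finset.prod_const]
      refine Finset.prod_le_prod (fun e _ => hfac e) fun e he => ?_
      have h1 := h.surv_top e he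
      have h2 := surv_nonneg g e
      nlinarith
    · refine (Finset.prod_le_one (fun e _ => hfac e) fun e _ => ?_).trans
        (one_le_pow₀ (by rw [hc]; norm_num))
      have h1 := surv_le_one g e
      have : z ≤ 1 := hzρ.trans hρ1
      nlinarith
  have hp2 : ∏ e ∈ R₂ \ R₁, ((1 - surv I g e) * z + surv I g e) ≤
      Real.exp (-A) * Real.exp j := by
    have h1 : ∀ e ∈ R₂ \ R₁, (1 - surv I g e) * z + surv I g e ≤
        surv I g e * Real.exp (Y⁻¹ * -Real.log (surv I g e)) := by
      intro e he
      have hr := h.surv_fill e he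
      have hr0 := hρ.trans_le hr
      have hl := Real.log_le_sub_one_of_pos hr0
      have hl' := Real.add_one_le_exp (Y⁻¹ * -Real.log (surv I g e))
      have hYi : 0 < Y⁻¹ := by positivity
      have hz' : z = ρ * Y⁻¹ := div_eq_mul_inv _ _
      calc (1 - surv I g e) * z + surv I g e
          ≤ -Real.log (surv I g e) * (surv I g e * Y⁻¹) + surv I g e := by
            rw [hz']
            have := surv_le_one g e
            gcongr
            · linarith
            · linarith
        _ = surv I g e * (Y⁻¹ * -Real.log (surv I g e) + 1) := by ring
        _ ≤ _ := by gcongr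
    refine (Finset.prod_le_prod (fun e _ => hfac e) h1).trans ?_
    rw [Finset.prod_mul_distrib, ← exp_neg_hazard fun e he => hρ.trans_le (h.surv_fill e he),
      ← Real.exp_sum, ← Finset.mul_sum]
    gcongr
    change Y⁻¹ * A ≤ j
    rw [inv_mul_le_iff₀ hY0, hY]
    have : A / j * j = A := by field_simp
    nlinarith
  -- As `ν ≤ topCount D` and `ρ ≤ 1`, the powers of `ρ` from the first part cancel those in `z ^ ν`.
  have hpow : (z ^ ν)⁻¹ * (2 * ρ) ^ topCount D ≤ Y ^ j * 2 ^ topCount D := by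
    have e1 : (z ^ ν)⁻¹ = Y ^ ν * (ρ ^ ν)⁻¹ := by
      rw [hz, div_pow]; field_simp
    rw [e1, mul_pow]
    have e2 : (ρ ^ ν)⁻¹ * ρ ^ topCount D ≤ 1 := by
      rw [inv_mul_le_iff₀ (by positivity), mul_one]
      exact pow_le_pow_of_le_one hρ.le hρ1 hνh
    have e3 : Y ^ ν ≤ Y ^ j := pow_le_pow_right₀ hY1 hνj
    calc Y ^ ν * (ρ ^ ν)⁻¹ * (2 ^ topCount D * ρ ^ topCount D)
        = Y ^ ν * 2 ^ topCount D * ((ρ ^ ν)⁻¹ * ρ ^ topCount D) := by ring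
      _ ≤ Y ^ ν * 2 ^ topCount D * 1 := by gcongr
      _ ≤ _ := by rw [mul_one]; gcongr
  have hexp : (2 : ℝ) ^ topCount D * Real.exp j ≤ Real.exp (D / 3) := by
    have h2 : (2 : ℝ) ≤ Real.exp 1 := by linarith [Real.add_one_le_exp (1 : ℝ)]
    calc (2 : ℝ) ^ topCount D * Real.exp j ≤ Real.exp 1 ^ topCount D * Real.exp j := by gcongr
      _ = Real.exp (topCount D + j) := by
          rw [← Real.exp_nat_mul, ← Real.exp_add, mul_one]
      _ ≤ _ := by
          rw [Real.exp_le_exp]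
          linarith [topCount_le hD0]
  calc tail g D (R₂ \ R)
      ≤ (z ^ ν)⁻¹ * ∏ e ∈ R₂ \ R, ((1 - surv I g e) * z + surv I g e) :=
        tail_le_moment g D _ hz0 (hzρ.trans hρ1)
    _ = (z ^ ν)⁻¹ * ((∏ e ∈ R₁ \ R, ((1 - surv I g e) * z + surv I g e)) *
          ∏ e ∈ R₂ \ R₁, ((1 - surv I g e) * z + surv I g e)) := by
        rw [hunion, Finset.prod_union hdisj]
    _ ≤ (z ^ ν)⁻¹ * ((2 * ρ) ^ topCount D * (Real.exp (-A) * Real.exp j)) := by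
        have := Finset.prod_nonneg fun e (_ : e ∈ R₂ \ R₁) => hfac e
        gcongr
    _ = ((z ^ ν)⁻¹ * (2 * ρ) ^ topCount D) * (Real.exp (-A) * Real.exp j) := by ring
    _ ≤ (Y ^ j * 2 ^ topCount D) * (Real.exp (-A) * Real.exp j) := by gcongr
    _ = (2 ^ topCount D * Real.exp j) * (Real.exp (-A) * Y ^ j) := by ring
    _ ≤ Real.exp (D / 3) * optFail g D R y π := by gcongr

/-- A batch fails with a probability that is not much larger than that of any policy. -/
lemma tail_le_optFail {g : ℕ} {D ρ : ℝ} {R R₁ R₂ : Finset (Fin I.n)}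
    (h : BatchSpec g D ρ R R₁ R₂) (hD : 1 ≤ D) (y : Outcome I) {π : Policy I}
    (hπ : π.Admissible) : tail g D (R₂ \ R) ≤ Real.exp (D / 3) * optFail g D R y π := by
  rcases h.rho_nonneg.eq_or_lt with rfl | hρ
  · rw [tail_eq_zero h]
    exact mul_nonneg (Real.exp_pos _).le (optFail_nonneg _ _ _ _ _)
  · rcases le_total D 200 with h1 | h1
    · refine (tail_le_of_small h hρ (by linarith) h1 y hπ).trans ?_
      refine le_mul_of_one_le_left (optFail_nonneg _ _ _ _ _) ?_
      rw [← Real.exp_zero, Real.exp_le_exp]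
      positivity
    · exact tail_le_of_large h hρ h1 y hπ

/-- No feasible set outside `R` promises more than `D / 8` successes. -/
def Exhausted (I : Problem) (g : ℕ) (D : ℝ) (R : Finset (Fin I.n)) : Prop :=
  ∀ U, Feasible I U → Disjoint U R → ∑ e ∈ U, (1 - surv I g e) ≤ D / 8

lemma Exhausted.mono {g : ℕ} {D : ℝ} {R R' : Finset (Fin I.n)} (h : Exhausted I g D R)
    (hR : R ⊆ R') : Exhausted I g D R' :=
  fun U hU hd => h U hU (Finset.disjoint_of_subset_right hR hd)

/-- If `ρ < 1 / 2`, the first part alone has more than `D / 24` elements that succeed with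
probability at least `1 / 2`. Otherwise a set that violates `Exhausted` has mean above `D / 8`, of
which at most `D / 24` comes from expensive elements. The rest is at most the mean of the first part
plus the hazard of the second, which is at most twice its mean because `surv I g e ≥ 1 / 2` there.
-/
lemma mean_batch {g : ℕ} {D ρ : ℝ} {R R₁ R₂ : Finset (Fin I.n)}
    (h : BatchSpec g D ρ R R₁ R₂) (hD : 0 ≤ D) (hR : ¬ Exhausted I g D R) :
    D / 48 ≤ ∑ e ∈ R₂ \ R, (1 - surv I g e) := by
  have hp : ∀ e, 0 ≤ 1 - surv I g e := fun e => by linarith [surv_le_one g e]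
  have hdisj : Disjoint (R₁ \ R) (R₂ \ R₁) := by
    refine Finset.disjoint_left.2 fun e he he' => ?_
    exact (Finset.mem_sdiff.1 he').2 (Finset.mem_sdiff.1 he).1
  have hunion : R₂ \ R = (R₁ \ R) ∪ (R₂ \ R₁) := by
    ext e
    simp only [Finset.mem_sdiff, Finset.mem_union]
    have := @h.sub₁ e
    have := @h.sub₂ e
    tauto
  rw [hunion, Finset.sum_union hdisj]
  have hP1 : 0 ≤ ∑ e ∈ R₁ \ R, (1 - surv I g e) := Finset.sum_nonneg fun e _ => hp e
  have hP2 : 0 ≤ ∑ e ∈ R₂ \ R₁, (1 - surv I g e) := Finset.sum_nonneg fun e _ => hp e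
  rcases lt_or_ge ρ (1 / 2) with hρ | hρ
  · have hc : (R₁ \ R).card = topCount D := h.card_top.resolve_right (by linarith)
    have : ∑ e ∈ R₁ \ R, (1 / 2 : ℝ) ≤ ∑ e ∈ R₁ \ R, (1 - surv I g e) :=
      Finset.sum_le_sum fun e he => by linarith [h.surv_top e he]
    rw [Finset.sum_const, nsmul_eq_mul, hc] at this
    linarith [lt_topCount D]
  · have hρ0 : 0 < ρ := by linarith
    unfold Exhausted at hR
    push Not at hR
    obtain ⟨U, hU, hd, hlt⟩ := hR
    have hsub : U ⊆ (R₁ \ R ∪ (U \ R₁).filter fun e => ρ ≤ surv I g e) ∪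
        (U \ R₁).filter fun e => surv I g e < ρ := by
      intro e he
      have heR : e ∉ R := Finset.disjoint_left.1 hd he
      by_cases h1 : e ∈ R₁
      · simp [h1, heR]
      · rcases le_or_gt ρ (surv I g e) with h2 | h2
        · simp [h1, he, h2]
        · simp [h1, he, h2]
    have hdis : ∀ s : Fin I.n → Prop, [DecidablePred s] → Disjoint ((U \ R₁).filter s) R₁ :=
      fun s _ => Finset.disjoint_of_subset_left (Finset.filter_subset _ _) Finset.sdiff_disjoint
    have hfe : ∀ s : Fin I.n → Prop, [DecidablePred s] → Feasible I ((U \ R₁).filter s) :=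
      fun s _ => hU.subset ((Finset.filter_subset _ _).trans Finset.sdiff_subset)
    have hb := h.card_big _ (hfe _) (hdis fun e => surv I g e < ρ)
      (fun e he => (Finset.mem_filter.1 he).2)
    have hb' : (((U \ R₁).filter fun e => surv I g e < ρ).card : ℝ) + 1 ≤ topCount D := by
      exact_mod_cast hb
    have hs := h.hazard_fill hρ0 _ (hfe _) (hdis fun e => ρ ≤ surv I g e)
      (fun e he => (Finset.mem_filter.1 he).2)
    have s1 : ∑ e ∈ U, (1 - surv I g e) ≤ ∑ e ∈ R₁ \ R, (1 - surv I g e) +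
        ∑ e ∈ (U \ R₁).filter (fun e => ρ ≤ surv I g e), (1 - surv I g e) +
        ∑ e ∈ (U \ R₁).filter (fun e => surv I g e < ρ), (1 - surv I g e) := by
      refine (Finset.sum_le_sum_of_subset_of_nonneg hsub fun e _ _ => hp e).trans ?_
      have u1 := Finset.sum_union_inter (s₁ := R₁ \ R ∪ (U \ R₁).filter fun e => ρ ≤ surv I g e)
        (s₂ := (U \ R₁).filter fun e => surv I g e < ρ) (f := fun e => 1 - surv I g e)
      have u2 := Finset.sum_union_inter (s₁ := R₁ \ R)
        (s₂ := (U \ R₁).filter fun e => ρ ≤ surv I g e) (f := fun e => 1 - surv I g e)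
      have n1 : ∀ V : Finset (Fin I.n), 0 ≤ ∑ e ∈ V, (1 - surv I g e) :=
        fun V => Finset.sum_nonneg fun e _ => hp e
      linarith [n1 ((R₁ \ R ∪ (U \ R₁).filter fun e => ρ ≤ surv I g e) ∩
        (U \ R₁).filter fun e => surv I g e < ρ),
        n1 ((R₁ \ R) ∩ (U \ R₁).filter fun e => ρ ≤ surv I g e)]
    have s2 : ∑ e ∈ (U \ R₁).filter (fun e => surv I g e < ρ), (1 - surv I g e) ≤
        ((U \ R₁).filter fun e => surv I g e < ρ).card := by
      rw [Finset.card_eq_sum_ones, Nat.cast_sum]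
      exact Finset.sum_le_sum fun e _ => by
        have := surv_nonneg g e
        push_cast
        linarith
    have s3 : ∑ e ∈ (U \ R₁).filter (fun e => ρ ≤ surv I g e), (1 - surv I g e) ≤
        ∑ e ∈ (U \ R₁).filter (fun e => ρ ≤ surv I g e), -Real.log (surv I g e) :=
      Finset.sum_le_sum fun e he => by
        have := Real.log_le_sub_one_of_pos (hρ0.trans_le (Finset.mem_filter.1 he).2)
        linarith
    have s4 : ∑ e ∈ R₂ \ R₁, -Real.log (surv I g e) ≤
        2 * ∑ e ∈ R₂ \ R₁, (1 - surv I g e) := by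
      rw [Finset.mul_sum]
      refine Finset.sum_le_sum fun e he => ?_
      have hr := h.surv_fill e he
      have hr0 : 0 < surv I g e := hρ0.trans_le hr
      have h1 := Real.one_sub_inv_le_log_of_pos hr0
      have h2 : (surv I g e)⁻¹ * surv I g e = 1 := inv_mul_cancel₀ hr0.ne'
      have h3 : (surv I g e)⁻¹ ≤ 2 := by
        rw [inv_le_comm₀ hr0 (by norm_num)]; linarith
      nlinarith [hp e]
    have := topCount_le hD
    linarith

/-- Chernoff bound with `z = 1 / 2` and mean at least `D / 48`: the exponent `-D / 96 + D / 200 *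
log 2` is at most `-D / 160`. -/
lemma tail_le_exp {g : ℕ} {D ρ : ℝ} {R R₁ R₂ : Finset (Fin I.n)}
    (h : BatchSpec g D ρ R R₁ R₂) (hD : 0 ≤ D) (hR : ¬ Exhausted I g D R) :
    tail g D (R₂ \ R) ≤ Real.exp (-(D / 160)) := by
  have hm := mean_batch h hD hR
  refine (tail_le_moment g D _ (z := 1 / 2) (by norm_num) (by norm_num)).trans ?_
  have h1 : ∏ e ∈ R₂ \ R, ((1 - surv I g e) * (1 / 2) + surv I g e) ≤
      ∏ e ∈ R₂ \ R, Real.exp (-(1 / 2 * (1 - surv I g e))) :=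
    Finset.prod_le_prod (fun e _ => by nlinarith [surv_nonneg g e, surv_le_one g e])
      fun e _ => by linarith [Real.add_one_le_exp (-(1 / 2 * (1 - surv I g e)))]
  rw [← Real.exp_sum, Finset.sum_neg_distrib, ← Finset.mul_sum] at h1
  have h2 : ((1 / 2 : ℝ) ^ ⌊D / 200⌋₊)⁻¹ = Real.exp (⌊D / 200⌋₊ * Real.log 2) := by
    rw [Real.exp_nat_mul, Real.exp_log (by norm_num)]
    simp
  rw [h2]
  refine (mul_le_mul_of_nonneg_left h1 (Real.exp_pos _).le).trans ?_
  rw [← Real.exp_add, Real.exp_le_exp]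
  have h3 : (⌊D / 200⌋₊ : ℝ) ≤ D / 200 := Nat.floor_le (by positivity)
  have h4 := Real.log_two_lt_d9
  have h5 : (0 : ℝ) < Real.log 2 := Real.log_pos (by norm_num)
  nlinarith

/-! ### Trials -/

lemma subset_batch (g : ℕ) (D : ℝ) (R : Finset (Fin I.n)) : R ⊆ batch I g D R :=
  (batch_spec g D R).sub₁.trans (batch_spec g D R).sub₂

lemma subset_batches (g : ℕ) (D : ℝ) (R : Finset (Fin I.n)) (t : ℕ) :
    R ⊆ (batch I g D)^[t] R := by
  induction t with
  | zero => exact subset_rfl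
  | succ t ih =>
    rw [Function.iterate_succ_apply']
    exact ih.trans (subset_batch _ _ _)

/-- The union has few successes only if both disjoint pieces do, and these are independent. -/
lemma tail_union_le {g : ℕ} {D : ℝ} {R R₁ R₂ : Finset (Fin I.n)} (h₁ : R ⊆ R₁) (h₂ : R₁ ⊆ R₂) :
    tail g D (R₂ \ R) ≤ tail g D (R₁ \ R) * tail g D (R₂ \ R₁) := by
  have hdisj : Disjoint (R₁ \ R) (R₂ \ R₁) := by
    refine Finset.disjoint_left.2 fun e he he' => ?_
    exact (Finset.mem_sdiff.1 he').2 (Finset.mem_sdiff.1 he).1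
  have hind := cev_mul_indep (I := I) (R := ∅) (A := R₁ \ R) (B := R₂ \ R₁) (fun _ => 0)
    (F := fun x => if (cnt g (R₁ \ R) x : ℝ) < D / 200 then 1 else 0)
    (G := fun x => if (cnt g (R₂ \ R₁) x : ℝ) < D / 200 then 1 else 0) (Finset.empty_subset _)
    (fun x x' h => by rw [cnt_congr h]) (fun x x' h => by rw [cnt_congr h]) hdisj
  rw [cev_empty, cev_empty] at hind
  unfold tail
  rw [← hind]
  refine ev_mono fun x => ?_
  have c1 : (cnt g (R₁ \ R) x : ℝ) ≤ cnt g (R₂ \ R) x := by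
    exact_mod_cast cnt_mono (Finset.sdiff_subset_sdiff h₂ subset_rfl) x
  have c2 : (cnt g (R₂ \ R₁) x : ℝ) ≤ cnt g (R₂ \ R) x := by
    exact_mod_cast cnt_mono (Finset.sdiff_subset_sdiff subset_rfl h₁) x
  split_ifs with h3 h4 h5 h5 <;> first | (exfalso; linarith) | norm_num

lemma tail_batches_le {g : ℕ} {D : ℝ} (hD : 0 ≤ D) (t : ℕ) (R : Finset (Fin I.n))
    (hR : ¬ Exhausted I g D ((batch I g D)^[t] R)) :
    tail g D ((batch I g D)^[t] R \ R) ≤ Real.exp (-(D / 160)) ^ t := by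
  induction t with
  | zero =>
    rw [pow_zero]
    refine (ev_mono (G := fun _ => 1) fun x => ?_).trans (ev_const 1).le
    split_ifs <;> norm_num
  | succ t ih =>
    rw [Function.iterate_succ_apply'] at hR ⊢
    have h1 : ¬ Exhausted I g D ((batch I g D)^[t] R) :=
      fun h => hR (h.mono (subset_batch _ _ _))
    refine (tail_union_le (subset_batches g D R t) (subset_batch _ _ _)).trans ?_
    rw [pow_succ]
    exact mul_le_mul (ih h1) (tail_le_exp (batch_spec g D _) hD h1) (tail_nonneg _ _ _)
      (pow_nonneg (Real.exp_pos _).le _)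

/-- The number of batches in a trial. -/
def trialLength : ℕ := 1 + 160 * 2001

/-- The set of probed elements after a trial. -/
def trialSet (I : Problem) (g : ℕ) (D : ℝ) (R : Finset (Fin I.n)) : Finset (Fin I.n) :=
  (batch I g D)^[trialLength] R

lemma subset_trialSet (g : ℕ) (D : ℝ) (R : Finset (Fin I.n)) : R ⊆ trialSet I g D R :=
  subset_batches g D R _

/-- The first batch is compared with the policy, at the price of a factor `exp (D / 3)`; the other
`160 * 2001` batches contribute `exp (-2001 * D)`. -/
lemma tail_trialSet_le {g : ℕ} {D : ℝ} (hD : 1 ≤ D) {R : Finset (Fin I.n)}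
    (hR : ¬ Exhausted I g D (trialSet I g D R)) (y : Outcome I) {π : Policy I}
    (hπ : π.Admissible) :
    tail g D (trialSet I g D R \ R) ≤ 1 / (2000 * D) * optFail g D R y π := by
  have hq := optFail_nonneg g D R y π
  have e1 : trialSet I g D R = (batch I g D)^[160 * 2001] (batch I g D R) := by
    rw [trialSet, trialLength, add_comm, Function.iterate_succ_apply]
  rw [e1] at hR ⊢
  refine (tail_union_le (subset_batch g D R) (subset_batches _ _ _ _)).trans ?_
  have h1 := tail_le_optFail (batch_spec g D R) hD y hπ
  have h2 := tail_batches_le (by linarith) _ _ hR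
  refine (mul_le_mul h1 h2 (tail_nonneg _ _ _) (by positivity)).trans ?_
  rw [mul_right_comm]
  refine mul_le_mul_of_nonneg_right ?_ hq
  rw [← Real.exp_nat_mul, ← Real.exp_add]
  have h3 := Real.add_one_le_exp (2000 * D)
  calc Real.exp (D / 3 + ((160 * 2001 : ℕ) : ℝ) * -(D / 160))
      ≤ Real.exp (-(2000 * D)) := by
        rw [Real.exp_le_exp]; push_cast; linarith
    _ ≤ 1 / (2000 * D) := by
        rw [Real.exp_neg, ← one_div]
        refine one_div_le_one_div_of_le (by positivity) (by linarith)

lemma deficit_cast {g : ℕ} {R : Finset (Fin I.n)} {x : Outcome I} (h : 0 < deficit g R x) :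
    (deficit g R x : ℝ) = I.k - cnt g R x := by
  unfold deficit at *
  rw [Nat.cast_sub (by omega)]

lemma le_deficit (g : ℕ) (R : Finset (Fin I.n)) (x : Outcome I) :
    (I.k : ℝ) - cnt g R x ≤ deficit g R x := by
  unfold deficit
  have : I.k ≤ (I.k - cnt g R x) + cnt g R x := by omega
  have : (I.k : ℝ) ≤ (I.k - cnt g R x : ℕ) + cnt g R x := by exact_mod_cast this
  linarith

lemma le_deficit_of_known {g : ℕ} {R S : Finset (Fin I.n)} {x y : Outcome I}
    (hx : ∀ e ∈ R, x e = y e) (h : 0 < deficit g R y) :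
    (deficit g R y : ℝ) - cnt g (S \ R) x ≤ deficit g S x := by
  have h1 := le_deficit g S x
  have h2 : cnt g S x ≤ cnt g R x + cnt g (S \ R) x :=
    (cnt_mono (by intro e; simp; tauto) x).trans (cnt_union_le g R (S \ R) x)
  have h3 : (cnt g S x : ℝ) ≤ cnt g R x + cnt g (S \ R) x := by exact_mod_cast h2
  rw [deficit_cast h, ← cnt_congr hx]
  linarith

/-- If no elements are left that help, then every policy has a large deficit. -/
lemma deficit_of_exhausted {g : ℕ} {D : ℝ} (hD : 0 ≤ D) {R : Finset (Fin I.n)}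
    (hR : Exhausted I g D R) {y : Outcome I} (hy : 199 / 200 * D < deficit g R y)
    {π : Policy I} (hπ : π.Admissible) :
    D ≤ 3 * cev R y fun x => (deficit g (π.selected x) x : ℝ) := by
  have h0 : 0 < deficit g R y := by
    have : (0 : ℝ) < deficit g R y := lt_of_le_of_lt (by positivity) hy
    exact_mod_cast this
  have h1 := cev_cnt_le (R := R) (y := y) g π (M := D / 8) fun x =>
    hR _ ((hπ x).subset Finset.sdiff_subset) Finset.sdiff_disjoint
  have h2 : cev R y (fun x => (deficit g R y : ℝ) - cnt g (π.selected x \ R) x) ≤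
      cev R y fun x => (deficit g (π.selected x) x : ℝ) :=
    cev_mono fun x hx => le_deficit_of_known hx h0
  rw [cev_sub, cev_const] at h2
  -- `199 / 200 - 1 / 8 ≥ 1 / 3`.
  linarith

/-- If elements are left that help, then a trial fails only rarely. -/
lemma fail_of_not_exhausted {g : ℕ} {D : ℝ} (hD : 1 ≤ D) {R : Finset (Fin I.n)}
    (hR : ¬ Exhausted I g D (trialSet I g D R)) {y : Outcome I} (hy : deficit g R y ≤ D)
    {π : Policy I} (hπ : π.Admissible) :
    (cev R y fun x => if 199 / 200 * D < deficit g (trialSet I g D R) x then D else 0) ≤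
      1 / (1000 * D) * cev R y fun x => (deficit g (π.selected x) x : ℝ) := by
  have hnn : 0 ≤ cev R y fun x => (deficit g (π.selected x) x : ℝ) :=
    cev_nonneg fun x => Nat.cast_nonneg _
  have hD0 : 0 < D := by linarith
  rcases le_or_gt (deficit g R y : ℝ) (199 / 200 * D) with hlt | hlt
  · refine le_trans (cev_mono (G := fun _ => 0) fun x hx => ?_)
      ((cev_const R y 0).le.trans (by positivity))
    rw [if_neg]
    rw [not_lt]
    refine le_trans ?_ hlt
    rw [← deficit_congr hx]
    exact_mod_cast deficit_anti (subset_trialSet g D R) x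
  · have h0 : 0 < deficit g R y := by
      have : (0 : ℝ) < deficit g R y := lt_of_le_of_lt (by positivity) hlt
      exact_mod_cast this
    -- The deficit is at most `D` before the trial, so more than `199 / 200 * D` afterwards means
    -- fewer than `D / 200` successes.
    have h1 : (cev R y fun x => if 199 / 200 * D < deficit g (trialSet I g D R) x then D else 0) ≤
        D * tail g D (trialSet I g D R \ R) := by
      rw [tail, ← cev_eq_ev (R := R) (B := trialSet I g D R \ R) y
        (fun x x' h => by rw [cnt_congr h]) Finset.disjoint_sdiff, ← cev_mul]
      refine cev_mono fun x hx => ?_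
      by_cases hf : 199 / 200 * D < deficit g (trialSet I g D R) x
      · rw [if_pos hf, if_pos, mul_one]
        have h0' : 0 < deficit g (trialSet I g D R) x := by
          have : (0 : ℝ) < deficit g (trialSet I g D R) x := lt_of_le_of_lt (by positivity) hf
          exact_mod_cast this
        rw [deficit_cast h0'] at hf
        have h2 := cnt_union (U := R) (V := trialSet I g D R \ R) Finset.disjoint_sdiff g x
        rw [Finset.union_sdiff_of_subset (subset_trialSet g D R)] at h2
        rw [h2, cnt_congr hx] at hf
        rw [deficit_cast h0] at hy
        push_cast at hf
        linarith
      · rw [if_neg hf]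
        split_ifs <;> simp [hD0.le]
    have h2 := tail_trialSet_le hD hR y hπ
    -- The deficit at `R` exceeds `199 / 200 * D`, so at most `99 / 200 * D` further successes leave
    -- the policy with at least `D / 2`.
    have h3 : D / 2 * optFail g D R y π ≤ cev R y fun x => (deficit g (π.selected x) x : ℝ) := by
      rw [optFail, ← cev_mul]
      refine cev_mono fun x hx => ?_
      have := le_deficit_of_known (S := π.selected x) hx h0
      split_ifs with h4
      · linarith
      · simp
    have hq := optFail_nonneg g D R y π
    calc _ ≤ _ := h1
      _ ≤ D * (1 / (2000 * D) * optFail g D R y π) := by gcongr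
      _ = 1 / (1000 * D) * (D / 2 * optFail g D R y π) := by field_simp; ring
      _ ≤ _ := by gcongr

/-- `S` is a union of at most `c` feasible sets. -/
def Covered (I : Problem) (S : Finset (Fin I.n)) (c : ℕ) : Prop :=
  ∃ F : Finset (Finset (Fin I.n)), F.card ≤ c ∧ (∀ A ∈ F, Feasible I A) ∧ F.sup id = S

lemma covered_empty : Covered I ∅ 0 := ⟨∅, by simp⟩

lemma Covered.union {S A : Finset (Fin I.n)} {c : ℕ} (h : Covered I S c) (hA : Feasible I A) :
    Covered I (S ∪ A) (c + 1) := by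
  obtain ⟨F, h1, h2, h3⟩ := h
  refine ⟨insert A F, (Finset.card_insert_le _ _).trans (by omega), ?_, ?_⟩
  · intro B hB
    rcases Finset.mem_insert.1 hB with rfl | hB
    · exact hA
    · exact h2 B hB
  · rw [Finset.sup_insert, h3, id, sup_comm, Finset.sup_eq_union]

lemma Covered.batch {S : Finset (Fin I.n)} {c : ℕ} (h : Covered I S c) (g : ℕ) (D : ℝ) :
    Covered I (batch I g D S) (c + 3) := by
  have hs := batch_spec g D S
  obtain ⟨A, A', hA, hA', he⟩ := hs.feasible_fill
  rw [he, ← Finset.union_sdiff_of_subset hs.sub₁]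
  exact ((h.union hs.feasible_top).union hA).union hA'

lemma Covered.trialSet {S : Finset (Fin I.n)} {c : ℕ} (h : Covered I S c) (g : ℕ) (D : ℝ) :
    Covered I (trialSet I g D S) (c + 3 * trialLength) := by
  unfold MinKKnapsack.trialSet
  generalize trialLength = t
  induction t with
  | zero => exact h
  | succ t ih =>
    rw [Function.iterate_succ_apply']
    exact ih.batch g D

/-! ### The adaptive procedure -/

/-- The state of the procedure: the probed elements, the number of the level, and the interval
`[lo, hi)` of exponents in which a sufficiently large threshold is being searched. -/
structure Phase (I : Problem) where
  probed : Finset (Fin I.n)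
  level : ℕ
  lo : ℕ
  hi : ℕ

/-- The bound for the deficit at the start of level `i`. -/
def target (I : Problem) (i : ℕ) : ℝ := I.k * (199 / 200) ^ i

/-- The largest exponent of a threshold. -/
def topExp (I : Problem) : ℕ := Nat.size I.m

/-- The set of probed elements after the next step. -/
def Phase.next (σ : Phase I) : Finset (Fin I.n) :=
  if 1 ≤ target I σ.level ∧ σ.lo < σ.hi then
    trialSet I (2 ^ ((σ.lo + σ.hi) / 2)) (target I σ.level) σ.probed
  else σ.probed

open Classical in
/-- One step of the procedure: a trial for the middle exponent, or the passage to the next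
level. -/
def Phase.step (x : Outcome I) (σ : Phase I) : Phase I :=
  if 1 ≤ target I σ.level then
    if σ.lo < σ.hi then
      if 199 / 200 * target I σ.level < deficit (2 ^ ((σ.lo + σ.hi) / 2)) σ.next x then
        ⟨σ.next, σ.level, (σ.lo + σ.hi) / 2 + 1, σ.hi⟩
      else ⟨σ.next, σ.level, σ.lo, (σ.lo + σ.hi) / 2⟩
    else ⟨σ.next, σ.level + 1, σ.lo, topExp I + 1⟩
  else σ

/-- The initial state of the procedure. -/
def Phase.start (I : Problem) : Phase I := ⟨∅, 0, 0, topExp I + 1⟩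

lemma Phase.subset_next (σ : Phase I) : σ.probed ⊆ σ.next := by
  unfold Phase.next
  split_ifs
  · exact subset_trialSet _ _ _
  · exact subset_rfl

lemma Phase.step_probed (x : Outcome I) (σ : Phase I) : (σ.step x).probed = σ.next := by
  unfold Phase.step
  split_ifs with h1
  · rfl
  · rfl
  · rfl
  · unfold Phase.next
    rw [if_neg (by tauto)]

/-- The elements of a step are fixed before their weights are read, and the branching uses weights
in `σ.next` only. This is what makes the procedure a decision tree. -/
lemma Phase.step_congr {σ : Phase I} {x x' : Outcome I} (h : ∀ e ∈ σ.next, x e = x' e) :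
    σ.step x = σ.step x' := by
  unfold Phase.step
  rw [deficit_congr h]

lemma target_nonneg (i : ℕ) : 0 ≤ target I i := by unfold target; positivity

lemma target_succ (i : ℕ) : target I (i + 1) = 199 / 200 * target I i := by
  unfold target; ring

lemma target_anti {i i' : ℕ} (h : i ≤ i') : target I i' ≤ target I i := by
  unfold target
  exact mul_le_mul_of_nonneg_left (pow_le_pow_of_le_one (by norm_num) (by norm_num) h)
    (Nat.cast_nonneg _)

lemma exists_target_lt_one (I : Problem) : ∃ i, target I i < 1 := by
  obtain ⟨i, hi⟩ := exists_pow_lt_of_lt_one (show (0 : ℝ) < 1 / (I.k + 1) by positivity)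
    (show (199 / 200 : ℝ) < 1 by norm_num)
  refine ⟨i, ?_⟩
  unfold target
  have : (0 : ℝ) < (199 / 200) ^ i := by positivity
  rw [lt_div_iff₀ (by positivity)] at hi
  nlinarith

open Classical in
/-- The number of levels. -/
def levels (I : Problem) : ℕ := Nat.find (exists_target_lt_one I)

lemma target_levels : target I (levels I) < 1 := by
  classical
  exact Nat.find_spec (exists_target_lt_one I)

lemma lt_levels_iff {i : ℕ} : i < levels I ↔ 1 ≤ target I i := by
  classical
  constructor
  · exact fun h => not_lt.1 (Nat.find_min (exists_target_lt_one I) h)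
  · intro h
    by_contra hn
    exact absurd (target_levels (I := I)) (not_lt.2 (h.trans (target_anti (not_lt.1 hn))))

/-- What holds in each state of the procedure. -/
structure Phase.Inv (σ : Phase I) (x : Outcome I) : Prop where
  hi_le : σ.hi ≤ topExp I + 1
  -- Exponents below `lo` have been given up; nothing is promised for them.
  deficit_lo : ∀ j ≤ topExp I, σ.lo ≤ j →
    (deficit (2 ^ j) σ.probed x : ℝ) ≤ target I σ.level
  deficit_hi : ∀ j ≤ topExp I, σ.hi ≤ j →
    (deficit (2 ^ j) σ.probed x : ℝ) ≤ target I (σ.level + 1)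

lemma deficit_pow_anti {j j' : ℕ} (h : j ≤ j') {R R' : Finset (Fin I.n)} (hR : R ⊆ R')
    (x : Outcome I) : (deficit (2 ^ j') R' x : ℝ) ≤ deficit (2 ^ j) R x := by
  exact_mod_cast (deficit_anti_left (Nat.pow_le_pow_right (by norm_num) h) R' x).trans
    (deficit_anti hR x)

lemma Phase.Inv.congr {σ : Phase I} {x x' : Outcome I} (h : σ.Inv x)
    (hx : ∀ e ∈ σ.probed, x' e = x e) : σ.Inv x' := by
  refine ⟨h.hi_le, fun j hj hlo => ?_, fun j hj hhi => ?_⟩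
  · rw [deficit_congr hx]; exact h.deficit_lo j hj hlo
  · rw [deficit_congr hx]; exact h.deficit_hi j hj hhi

lemma Phase.start_inv (x : Outcome I) : (Phase.start I).Inv x := by
  refine ⟨le_rfl, fun j _ _ => ?_, fun j hj hhi => ?_⟩
  · simp only [Phase.start, target, pow_zero, mul_one]
    exact_mod_cast Nat.sub_le _ _
  · simp only [Phase.start] at hhi
    omega

lemma Phase.Inv.step {σ : Phase I} {x : Outcome I} (h : σ.Inv x) : (σ.step x).Inv x := by
  have hmono : ∀ j, (deficit (2 ^ j) σ.next x : ℝ) ≤ deficit (2 ^ j) σ.probed x :=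
    fun j => deficit_pow_anti le_rfl σ.subset_next x
  unfold Phase.step
  split_ifs with h1 h2 h3
  · exact ⟨h.hi_le, fun j hj hlo => (hmono j).trans (h.deficit_lo j hj (by dsimp at hlo; omega)),
      fun j hj hhi => (hmono j).trans (h.deficit_hi j hj hhi)⟩
  · refine ⟨?_, fun j hj hlo => (hmono j).trans (h.deficit_lo j hj hlo), fun j hj hhi => ?_⟩
    · have := h.hi_le
      dsimp
      omega
    · rw [target_succ]
      exact (deficit_pow_anti hhi subset_rfl x).trans (not_lt.1 h3)
  -- The interval is empty, so `deficit_hi` covers all exponents from `lo` on and becomes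
  -- `deficit_lo` of the next level; with `hi = topExp I + 1` the new `deficit_hi` is void.
  · refine ⟨le_rfl, fun j hj hlo => (hmono j).trans (h.deficit_hi j hj ?_), fun j hj hhi => ?_⟩
    · dsimp at hlo; omega
    · dsimp at hhi; omega
  · exact h

/-- The expected deficit of a policy after the weights in `R` have been fixed. -/
def optDeficit (π : Policy I) (j : ℕ) (R : Finset (Fin I.n)) (y : Outcome I) : ℝ :=
  cev R y fun x => (deficit (2 ^ j) (π.selected x) x : ℝ)

lemma optDeficit_nonneg (π : Policy I) (j : ℕ) (R : Finset (Fin I.n)) (y : Outcome I) :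
    0 ≤ optDeficit π j R y := cev_nonneg fun _ => Nat.cast_nonneg _

lemma optDeficit_anti (π : Policy I) {j j' : ℕ} (h : j ≤ j') (R : Finset (Fin I.n))
    (y : Outcome I) : optDeficit π j' R y ≤ optDeficit π j R y :=
  cev_mono fun x _ => deficit_pow_anti h subset_rfl x

lemma cev_optDeficit (π : Policy I) (j : ℕ) {R R' : Finset (Fin I.n)} (h : R ⊆ R')
    (y : Outcome I) : cev R y (fun x => optDeficit π j R' x) = optDeficit π j R y :=
  cev_cev h _ _

/-! ### The potential of the procedure -/

/-- The trials that can still take place, for thresholds with exponents at least `j`. -/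
def Phase.remaining (σ : Phase I) (j : ℕ) : Finset (ℕ × ℕ) :=
  (Finset.range (levels I) ×ˢ Finset.Icc j (topExp I)).filter fun p =>
    σ.level < p.1 ∨ σ.level = p.1 ∧ σ.lo ≤ p.2 ∧ p.2 < σ.hi

/-- The potential of failing trials. -/
def trialPotential (π : Policy I) (s : Finset (ℕ × ℕ)) (R : Finset (Fin I.n))
    (y : Outcome I) : ℝ :=
  ∑ p ∈ s, 1 / (1000 * target I p.1) * optDeficit π p.2 R y

lemma trialWeight_nonneg (π : Policy I) (p : ℕ × ℕ) (R : Finset (Fin I.n)) (y : Outcome I) :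
    0 ≤ 1 / (1000 * target I p.1) * optDeficit π p.2 R y := by
  have := target_nonneg (I := I) p.1
  have := optDeficit_nonneg π p.2 R y
  positivity

lemma trialPotential_mono (π : Policy I) {s s' : Finset (ℕ × ℕ)} (h : s ⊆ s')
    (R : Finset (Fin I.n)) (y : Outcome I) :
    trialPotential π s R y ≤ trialPotential π s' R y :=
  Finset.sum_le_sum_of_subset_of_nonneg h fun p _ _ => trialWeight_nonneg π p R y

lemma cev_trialPotential (π : Policy I) (s : Finset (ℕ × ℕ)) {R R' : Finset (Fin I.n)}
    (h : R ⊆ R') (y : Outcome I) :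
    cev R y (fun x => trialPotential π s R' x) = trialPotential π s R y := by
  simp only [trialPotential, cev_sum, cev_mul, cev_optDeficit π _ h]

/-- The potential of a state for the exponent `j`. -/
def Phase.potential (π : Policy I) (j : ℕ) (σ : Phase I) (y : Outcome I) : ℝ :=
  -- An exponent that was given up carries its actual deficit, any other only a credit from the
  -- policy; the second summand prepays the failures of later trials.
  (if j < σ.lo then (deficit (2 ^ j) σ.probed y : ℝ) else 3 * optDeficit π j σ.probed y) +
    trialPotential π (σ.remaining j) σ.probed y

lemma Phase.remaining_step (σ : Phase I) (x : Outcome I) (j : ℕ) :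
    (σ.step x).remaining j ⊆ σ.remaining j := by
  intro p hp
  simp only [Phase.remaining, Finset.mem_filter] at hp ⊢
  refine ⟨hp.1, ?_⟩
  have h2 := hp.2
  clear hp
  revert h2
  unfold Phase.step
  split_ifs with h1 h2 h3 <;> (try dsimp) <;> omega

/-- Either outcome removes the middle exponent from `[lo, hi)`, so the term of this trial in the
potential is released. -/
lemma Phase.remaining_step_trial {σ : Phase I} (h1 : 1 ≤ target I σ.level)
    (h2 : σ.lo < σ.hi) (x : Outcome I) (j : ℕ) :
    (σ.step x).remaining j ⊆
      (σ.remaining j).erase (σ.level, (σ.lo + σ.hi) / 2) := by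
  intro p hp
  rw [Finset.mem_erase]
  refine ⟨?_, σ.remaining_step x j hp⟩
  rintro rfl
  have h3 := (Finset.mem_filter.1 hp).2
  revert h3
  unfold Phase.step
  rw [if_pos h1, if_pos h2]
  split_ifs <;> (try dsimp) <;> omega

lemma Phase.potential_step_of_lt (π : Policy I) {j : ℕ} {σ : Phase I} (h : j < σ.lo)
    (x : Outcome I) : (σ.step x).potential π j x ≤
      deficit (2 ^ j) σ.probed x + trialPotential π (σ.remaining j) σ.next x := by
  have hlo : σ.lo ≤ (σ.step x).lo := by
    unfold Phase.step
    split_ifs <;> (try dsimp) <;> omega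
  rw [Phase.potential, if_pos (h.trans_le hlo), Phase.step_probed]
  exact add_le_add (deficit_pow_anti le_rfl σ.subset_next x)
    (trialPotential_mono π (σ.remaining_step x j) _ _)

/-- The potential does not increase in expectation. -/
lemma Phase.cev_potential_step {π : Policy I} (hπ : π.Admissible) {j : ℕ} (hj : j ≤ topExp I)
    {σ : Phase I} {y : Outcome I} (hσ : σ.Inv y) :
    cev σ.probed y (fun x => (σ.step x).potential π j x) ≤ σ.potential π j y := by
  have hsub := σ.subset_next
  set S := σ.remaining j with hS
  set mid := (σ.lo + σ.hi) / 2 with hmid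
  rcases lt_or_ge j σ.lo with hlo | hlo
  · calc cev σ.probed y (fun x => (σ.step x).potential π j x)
        ≤ cev σ.probed y fun x => (deficit (2 ^ j) σ.probed y : ℝ) +
            trialPotential π S σ.next x := cev_mono fun x hx => by
          rw [← deficit_congr hx]; exact σ.potential_step_of_lt π hlo x
      _ = _ := by
          rw [cev_add, cev_const, cev_trialPotential π S hsub, Phase.potential, if_pos hlo]
  -- By the tower property, revealing the weights in `σ.next` does not change the terms of the
  -- policy in expectation.
  · have hbase : cev σ.probed y (fun x => 3 * optDeficit π j σ.next x +
        trialPotential π S σ.next x) = σ.potential π j y := by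
      rw [cev_add, cev_mul, cev_optDeficit π j hsub, cev_trialPotential π S hsub,
        Phase.potential, if_neg (not_lt.2 hlo)]
    have hstay : ∀ x, (σ.step x).lo ≤ j → (σ.step x).potential π j x ≤
        3 * optDeficit π j σ.next x + trialPotential π S σ.next x := fun x hx => by
      rw [Phase.potential, if_neg (not_lt.2 hx), Phase.step_probed]
      exact add_le_add le_rfl (trialPotential_mono π (σ.remaining_step x j) _ _)
    -- Only a failing trial with `j ≤ mid` can move `lo` beyond `j`.
    by_cases htr : 1 ≤ target I σ.level ∧ σ.lo < σ.hi ∧ j ≤ mid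
    · obtain ⟨h1, h2, h3⟩ := htr
      set D := target I σ.level with hD
      have hnext : σ.next = trialSet I (2 ^ mid) D σ.probed := by
        unfold Phase.next
        rw [if_pos ⟨h1, h2⟩]
      have hmidtop : mid ≤ topExp I := by
        have := hσ.hi_le; omega
      have hcase : ∀ x, ¬ 199 / 200 * D < deficit (2 ^ mid) σ.next x → (σ.step x).lo ≤ j := by
        intro x hx
        unfold Phase.step
        rw [if_pos h1, if_pos h2, if_neg hx]
        exact hlo
      have hfail : ∀ x, (∀ e ∈ σ.probed, x e = y e) →
          199 / 200 * D < deficit (2 ^ mid) σ.next x →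
          (σ.step x).potential π j x ≤ D + trialPotential π ((σ.step x).remaining j) σ.next x := by
        intro x hx hf
        have hlo' : j < (σ.step x).lo := by
          unfold Phase.step
          rw [if_pos h1, if_pos h2, if_pos hf]
          dsimp
          omega
        rw [Phase.potential, if_pos hlo', Phase.step_probed]
        refine add_le_add ?_ le_rfl
        refine (deficit_pow_anti le_rfl hsub x).trans ?_
        rw [deficit_congr hx]
        exact hσ.deficit_lo j hj hlo
      -- In the exhausted case the new deficit, at most `D`, is covered by `3 * optDeficit` at
      -- `mid`, hence at `j ≤ mid`, for every realization separately.
      by_cases hex : Exhausted I (2 ^ mid) D σ.next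
      · rw [← hbase]
        refine cev_mono fun x hx => ?_
        by_cases hf : 199 / 200 * D < deficit (2 ^ mid) σ.next x
        · refine (hfail x hx hf).trans (add_le_add ?_
            (trialPotential_mono π (σ.remaining_step x j) _ _))
          refine (deficit_of_exhausted (by linarith) hex hf hπ).trans ?_
          exact mul_le_mul_of_nonneg_left (optDeficit_anti π h3 _ _) (by norm_num)
        · exact hstay x (hcase x hf)
      -- Otherwise the expected loss is at most the term of this trial in the potential, which is
      -- released.
      · have hmem : (σ.level, mid) ∈ S := by
          simp only [hS, Phase.remaining, Finset.mem_filter, Finset.mem_product,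
            Finset.mem_range, Finset.mem_Icc]
          exact ⟨⟨lt_levels_iff.2 h1, h3, hmidtop⟩, Or.inr ⟨trivial, by omega, by omega⟩⟩
        have hDy : (deficit (2 ^ mid) σ.probed y : ℝ) ≤ D :=
          hσ.deficit_lo mid hmidtop (by omega)
        have hnot := fail_of_not_exhausted h1 (hnext ▸ hex) hDy hπ
        rw [← hnext] at hnot
        calc cev σ.probed y (fun x => (σ.step x).potential π j x)
            ≤ cev σ.probed y fun x =>
                (if 199 / 200 * D < deficit (2 ^ mid) σ.next x then D else 0) +
                (3 * optDeficit π j σ.next x +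
                  trialPotential π (S.erase (σ.level, mid)) σ.next x) := by
              refine cev_mono fun x hx => ?_
              have hsub' := trialPotential_mono π (σ.remaining_step_trial h1 h2 x j) σ.next x
              by_cases hf : 199 / 200 * D < deficit (2 ^ mid) σ.next x
              · rw [if_pos hf]
                have := hfail x hx hf
                have := optDeficit_nonneg π j σ.next x
                linarith
              · rw [if_neg hf, Phase.potential, if_neg (not_lt.2 (hcase x hf)),
                  Phase.step_probed]
                linarith
          _ = (cev σ.probed y fun x =>
                if 199 / 200 * D < deficit (2 ^ mid) σ.next x then D else 0) +
                (3 * optDeficit π j σ.probed y +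
                  trialPotential π (S.erase (σ.level, mid)) σ.probed y) := by
              rw [cev_add, cev_add, cev_mul, cev_optDeficit π j hsub,
                cev_trialPotential π _ hsub]
          _ ≤ 1 / (1000 * D) * optDeficit π mid σ.probed y +
                (3 * optDeficit π j σ.probed y +
                  trialPotential π (S.erase (σ.level, mid)) σ.probed y) :=
              add_le_add hnot le_rfl
          _ = σ.potential π j y := by
              rw [Phase.potential, if_neg (not_lt.2 hlo), ← hS]
              have := Finset.add_sum_erase S
                (fun p => 1 / (1000 * target I p.1) * optDeficit π p.2 σ.probed y) hmem
              unfold trialPotential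
              rw [← this]
              ring
    · rw [← hbase]
      refine cev_mono fun x _ => hstay x ?_
      unfold Phase.step
      split_ifs with h1 h2 h3
      · dsimp
        by_contra hcon
        exact htr ⟨h1, h2, by omega⟩
      · exact hlo
      · exact hlo
      · exact hlo

lemma Phase.cev_potential_iterate {π : Policy I} (hπ : π.Admissible) {j : ℕ}
    (hj : j ≤ topExp I) (N : ℕ) (σ : Phase I) (y : Outcome I) (hσ : σ.Inv y) :
    cev σ.probed y (fun x => ((Phase.step x)^[N] σ).potential π j x) ≤ σ.potential π j y := by
  induction N generalizing σ y with
  | zero =>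
    refine (cev_congr (G := fun _ => σ.potential π j y) fun x hx => ?_).le.trans
      (cev_const _ _ _).le
    simp only [Function.iterate_zero, id, Phase.potential, trialPotential, optDeficit,
      deficit_congr hx, cev_congr_known hx]
  | succ N ih =>
    rw [← cev_cev σ.subset_next]
    refine le_trans (cev_mono fun x hx => ?_) (σ.cev_potential_step hπ hj hσ)
    have h1 := ih (σ.step x) x (hσ.congr hx).step
    rw [σ.step_probed] at h1
    refine le_trans (cev_congr fun x' hx' => ?_).le h1
    rw [Function.iterate_succ_apply, σ.step_congr hx']

/-! ### Termination and the final deficit -/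

/-- The number of steps that are left. -/
def Phase.rank (σ : Phase I) : ℕ :=
  if σ.level < levels I then
    (levels I - 1 - σ.level) * (Nat.size (topExp I + 1) + 1) + Nat.size (σ.hi - σ.lo) + 1
  else 0

/-- A bound for the number of steps. -/
def numSteps (I : Problem) : ℕ := levels I * (Nat.size (topExp I + 1) + 1)

lemma Phase.rank_start : (Phase.start I).rank ≤ numSteps I := by
  unfold Phase.rank numSteps
  split_ifs with h
  · simp only [Phase.start] at h ⊢
    obtain ⟨l, hl⟩ : ∃ l, levels I = l + 1 := ⟨levels I - 1, by omega⟩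
    rw [hl]
    simp only [Nat.add_sub_cancel, Nat.sub_zero]
    ring_nf
    exact le_rfl
  · exact Nat.zero_le _

lemma size_div_two (a : ℕ) (ha : 0 < a) : Nat.size (a / 2) + 1 ≤ Nat.size a := by
  have h1 : 0 < Nat.size a := Nat.size_pos.2 ha
  have : Nat.size (a / 2) ≤ Nat.size a - 1 := by
    rw [Nat.size_le]
    have h2 := Nat.lt_size_self a
    obtain ⟨s, hs⟩ : ∃ s, Nat.size a = s + 1 := ⟨Nat.size a - 1, by omega⟩
    rw [hs, pow_succ] at h2
    rw [hs, Nat.add_sub_cancel]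
    omega
  omega

/-- A trial at least halves the search interval, so its binary length drops. A new level restores at
most `Nat.size (topExp I + 1)`, which is paid for by the decrease in the number of levels left. -/
lemma Phase.rank_step {σ : Phase I} (h : 1 ≤ target I σ.level) (x : Outcome I) :
    (σ.step x).rank < σ.rank := by
  have hl := lt_levels_iff.2 h
  have hr : σ.rank = (levels I - 1 - σ.level) * (Nat.size (topExp I + 1) + 1) +
      Nat.size (σ.hi - σ.lo) + 1 := by rw [Phase.rank, if_pos hl]
  rw [hr]
  unfold Phase.step
  rw [if_pos h]
  by_cases h2 : σ.lo < σ.hi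
  · have h3 := size_div_two (σ.hi - σ.lo) (by omega)
    have h4 : Nat.size (σ.hi - ((σ.lo + σ.hi) / 2 + 1)) ≤ Nat.size ((σ.hi - σ.lo) / 2) :=
      Nat.size_le_size (by omega)
    have h5 : Nat.size ((σ.lo + σ.hi) / 2 - σ.lo) ≤ Nat.size ((σ.hi - σ.lo) / 2) :=
      Nat.size_le_size (by omega)
    rw [if_pos h2]
    split_ifs
    · rw [Phase.rank]
      dsimp
      rw [if_pos hl]
      omega
    · rw [Phase.rank]
      dsimp
      rw [if_pos hl]
      omega
  · rw [if_neg h2, Phase.rank]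
    dsimp
    split_ifs with h3
    · obtain ⟨l, hl'⟩ : ∃ l, levels I - 1 - σ.level = l + 1 :=
        ⟨levels I - 1 - σ.level - 1, by omega⟩
      have h6 : levels I - 1 - (σ.level + 1) = l := by omega
      have h7 : Nat.size (topExp I + 1 - σ.lo) ≤ Nat.size (topExp I + 1) :=
        Nat.size_le_size (by omega)
      rw [h6, hl', add_mul]
      omega
    · omega

lemma Phase.step_of_lt {σ : Phase I} (h : target I σ.level < 1) (x : Outcome I) :
    σ.step x = σ := by
  unfold Phase.step
  rw [if_neg (not_le.2 h)]

lemma Phase.target_iterate (x : Outcome I) (N : ℕ) (σ : Phase I) (h : σ.rank ≤ N) :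
    target I ((Phase.step x)^[N] σ).level < 1 := by
  induction N generalizing σ with
  | zero =>
    by_contra hcon
    have := σ.rank_step (not_lt.1 hcon) x
    omega
  | succ N ih =>
    rw [Function.iterate_succ_apply]
    rcases lt_or_ge (target I σ.level) 1 with h1 | h1
    · rw [σ.step_of_lt h1]
      refine ih σ ?_
      rw [Phase.rank, if_neg]
      · exact Nat.zero_le _
      · rw [lt_levels_iff]; exact not_le.2 h1
    · exact ih _ (by have := σ.rank_step h1 x; omega)

/-- The set that the procedure probes. -/
def finalSet (x : Outcome I) : Finset (Fin I.n) :=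
  ((Phase.step x)^[numSteps I] (Phase.start I)).probed

lemma Phase.inv_iterate (x : Outcome I) (N : ℕ) (σ : Phase I) (h : σ.Inv x) :
    ((Phase.step x)^[N] σ).Inv x := by
  induction N generalizing σ with
  | zero => exact h
  | succ N ih => exact ih _ h.step

/-- The expected number of weights that the procedure misses below the threshold `2 ^ j`. -/
lemma ev_deficit_finalSet {π : Policy I} (hπ : π.Admissible) {j : ℕ} (hj : j ≤ topExp I) :
    ev (fun x : Outcome I => (deficit (2 ^ j) (finalSet x) x : ℝ)) ≤
      3 * ev (fun x => (deficit (2 ^ j) (π.selected x) x : ℝ)) +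
      ∑ i ∈ Finset.range (levels I), ∑ j' ∈ Finset.Icc j (topExp I),
        1 / (1000 * target I i) * ev (fun x => (deficit (2 ^ j') (π.selected x) x : ℝ)) := by
  have h := Phase.cev_potential_iterate hπ hj (numSteps I) (Phase.start I) (fun _ => 0)
    (Phase.start_inv _)
  have hrem : (Phase.start I).remaining j =
      Finset.range (levels I) ×ˢ Finset.Icc j (topExp I) := by
    refine Finset.filter_true_of_mem fun p hp => ?_
    have := Finset.mem_Icc.1 (Finset.mem_product.1 hp).2
    simp only [Phase.start]
    omega
  have hs : (Phase.start I).potential π j (fun _ => 0) =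
      3 * ev (fun x => (deficit (2 ^ j) (π.selected x) x : ℝ)) +
      ∑ i ∈ Finset.range (levels I), ∑ j' ∈ Finset.Icc j (topExp I),
        1 / (1000 * target I i) * ev (fun x => (deficit (2 ^ j') (π.selected x) x : ℝ)) := by
    rw [Phase.potential, trialPotential, hrem, Finset.sum_product,
      if_neg (show ¬ j < (Phase.start I).lo from Nat.not_lt_zero _)]
    simp only [optDeficit, Phase.start, cev_empty]
  rw [hs] at h
  refine le_trans (le_of_eq_of_le (cev_empty (fun _ => 0) _).symm (cev_mono fun x _ => ?_)) h
  have hinv := Phase.inv_iterate x (numSteps I) (Phase.start I) (Phase.start_inv x)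
  have htar := Phase.target_iterate x (numSteps I) (Phase.start I) Phase.rank_start
  unfold finalSet Phase.potential
  set σ := (Phase.step x)^[numSteps I] (Phase.start I)
  have hp : 0 ≤ trialPotential π (σ.remaining j) σ.probed x :=
    Finset.sum_nonneg fun p _ => trialWeight_nonneg π p _ _
  -- The deficit of an exponent that was not given up is at most the last target, hence below `1`,
  -- hence `0`.
  split_ifs with hlo
  · linarith
  · have h1 := (hinv.deficit_lo j hj (not_lt.1 hlo)).trans_lt htar
    have h2 : deficit (2 ^ j) σ.probed x = 0 := by
      have : deficit (2 ^ j) σ.probed x < 1 := by exact_mod_cast h1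
      omega
    rw [h2]
    have := optDeficit_nonneg π j σ.probed x
    push_cast
    linarith

lemma Covered.mono {S : Finset (Fin I.n)} {c c' : ℕ} (h : Covered I S c) (hc : c ≤ c') :
    Covered I S c' := by
  obtain ⟨F, h1, h2⟩ := h
  exact ⟨F, h1.trans hc, h2⟩

lemma covered_finalSet (x : Outcome I) :
    Covered I (finalSet x) (numSteps I * (3 * trialLength)) := by
  unfold finalSet
  have : ∀ N, Covered I ((Phase.step x)^[N] (Phase.start I)).probed (N * (3 * trialLength)) := by
    intro N
    induction N with
    | zero => simpa [Phase.start] using covered_empty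
    | succ N ih =>
      rw [Function.iterate_succ_apply', Phase.step_probed, Nat.succ_mul]
      unfold Phase.next
      split_ifs
      · exact ih.trialSet _ _
      · exact ih.mono (Nat.le_add_right _ _)
  exact this _

/-! ### The procedure as a policy -/

/-- There is a policy that extends `R` to `S x` if the weights `x` of the elements of `R` are
those given by `y`. -/
def Realizable (R : Finset (Fin I.n)) (y : Outcome I) (S : Outcome I → Finset (Fin I.n)) : Prop :=
  ∃ π : Policy I, ∀ x, (∀ e ∈ R, x e = y e) → R ∪ π.selected x = S x

lemma Realizable.insert {R : Finset (Fin I.n)} {S : Outcome I → Finset (Fin I.n)} {e : Fin I.n}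
    (y : Outcome I)
    (h : ∀ y', (∀ f ∈ R, y' f = y f) → Realizable (insert e R) y' S) : Realizable R y S := by
  by_cases he : e ∈ R
  · simpa [Finset.insert_eq_of_mem he] using h y fun _ _ => rfl
  · have hy : ∀ u, ∀ f ∈ R, Function.update y e u f = y f := fun u f hf => by
      have : f ≠ e := fun h => he (h ▸ hf)
      simp [this]
    choose next hnext using fun u => h (Function.update y e u) (hy u)
    refine ⟨.probe e next, fun x hx => ?_⟩
    rw [selected_probe, ← hnext (x e) x, Finset.union_insert, Finset.insert_union]
    intro f hf
    rcases Finset.mem_insert.1 hf with rfl | hf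
    · simp
    · rw [hx f hf, hy _ f hf]

lemma Realizable.union {R : Finset (Fin I.n)} {S : Outcome I → Finset (Fin I.n)}
    (W : Finset (Fin I.n)) (y : Outcome I)
    (h : ∀ y', (∀ f ∈ R, y' f = y f) → Realizable (R ∪ W) y' S) : Realizable R y S := by
  induction W using Finset.induction_on generalizing R y with
  | empty => simpa using h y fun _ _ => rfl
  | insert e W _ ih =>
    refine Realizable.insert (e := e) y fun y' hy' => ih y' fun y'' hy'' => ?_
    rw [Finset.insert_union, ← Finset.union_insert]
    exact h y'' fun f hf => (hy'' f (Finset.mem_insert_of_mem hf)).trans (hy' f hf)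

/-- The tree probes `σ.next` element by element; then the next state is known, and induction
supplies the subtree. -/
lemma realizable_iterate (N : ℕ) (σ : Phase I) (y : Outcome I) :
    Realizable σ.probed y fun x => ((Phase.step x)^[N] σ).probed := by
  induction N generalizing σ y with
  | zero => exact ⟨.done, fun x _ => by simp [Policy.selected]⟩
  | succ N ih =>
    refine Realizable.union σ.next y fun y' _ => ?_
    rw [Finset.union_eq_right.2 σ.subset_next]
    obtain ⟨π, hπ⟩ := ih (σ.step y') y'
    rw [σ.step_probed] at hπ
    refine ⟨π, fun x hx => ?_⟩
    rw [hπ x hx]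
    simp only [Function.iterate_succ_apply, σ.step_congr hx]

lemma exists_policy_finalSet (I : Problem) :
    ∃ π : Policy I, ∀ x, π.selected x = finalSet x := by
  obtain ⟨π, hπ⟩ := realizable_iterate (numSteps I) (Phase.start I) fun _ => 0
  refine ⟨π, fun x => ?_⟩
  have := hπ x fun e he => by simp [Phase.start] at he
  simpa [Phase.start, finalSet] using this

/-! ### The objective -/

/-- Among the first `k` places of an ascending list, with absent entries counted as large, exactly
those filled by entries below `v` do not count. -/
lemma length_filter_take_of_pairwise (v : ℕ) (l : List ℕ) (hl : l.Pairwise (· ≤ ·)) (k : ℕ) :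
    ((l.take k).filter fun a => v ≤ a).length + (k - l.length) =
      k - (l.filter fun a => a < v).length := by
  induction l generalizing k with
  | nil => simp
  | cons a l ih =>
    rw [List.pairwise_cons] at hl
    have h := ih hl.2
    cases k with
    | zero => simp
    | succ k =>
      rw [List.take_succ_cons, List.filter_cons, List.filter_cons, List.length_cons]
      have hk := h k
      by_cases ha : a < v
      · have ha' : ¬ v ≤ a := not_le.2 ha
        simp only [ha, ha', decide_true, decide_false, if_true, List.length_cons]
        simp only [Bool.false_eq_true, if_false]
        omega
      · have ha' : v ≤ a := not_lt.1 ha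
        have hnil : l.filter (fun a => decide (a < v)) = [] := by
          rw [List.filter_eq_nil_iff]
          intro b hb
          have := hl.1 b hb
          simp
          omega
        rw [hnil] at hk
        simp only [ha, ha', decide_true, decide_false, if_true, List.length_cons, hnil]
        simp only [Bool.false_eq_true, if_false, List.length_nil]
        simp only [List.length_nil] at hk
        omega

lemma sum_eq_sum_length_filter (m : ℕ) (l : List ℕ) (hl : ∀ a ∈ l, a ≤ m) :
    l.sum = ∑ v ∈ Finset.Ico 1 (m + 1), (l.filter fun a => v ≤ a).length := by
  induction l with
  | nil => simp
  | cons a l ih =>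
    rw [List.sum_cons, ih fun b hb => hl b (List.mem_cons_of_mem _ hb)]
    have h1 : ∀ v, ((a :: l).filter fun a => v ≤ a).length =
        (if v ≤ a then 1 else 0) + (l.filter fun a => v ≤ a).length := by
      intro v
      rw [List.filter_cons]
      by_cases h : v ≤ a <;> simp [h, add_comm]
    simp only [h1, Finset.sum_add_distrib]
    congr 1
    have ha := hl a List.mem_cons_self
    rw [Finset.sum_ite, Finset.sum_const_zero, add_zero, ← Finset.card_eq_sum_ones]
    have : (Finset.Ico 1 (m + 1)).filter (fun v => v ≤ a) = Finset.Ico 1 (a + 1) := by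
      ext v; simp; omega
    rw [this]
    simp

/-- The total deficit over all thresholds. -/
def totalDeficit (S : Finset (Fin I.n)) (x : Outcome I) : ℕ :=
  ∑ v ∈ Finset.Ico 1 (I.m + 1), deficit v S x

lemma deficit_top (S : Finset (Fin I.n)) (x : Outcome I) :
    deficit (2 ^ topExp I) S x = I.k - S.card := by
  unfold deficit cnt
  rw [Finset.filter_true_of_mem]
  intro e _
  have h1 := (x e).2
  have h2 := Nat.lt_size_self I.m
  unfold topExp
  omega

/-- Each missing element counts as `m` plus a surcharge `w - m`. With the value `m` for missing
elements, layer `v` of the sum of the `k` smallest weights is `deficit v S x`. -/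
lemma objective_eq {w : ℝ≥0∞} (hw : (I.m : ℝ≥0∞) ≤ w) (x : Outcome I)
    (S : Finset (Fin I.n)) :
    objective I w x S =
      (totalDeficit S x : ℕ) + (w - I.m) * (deficit (2 ^ topExp I) S x : ℕ) := by
  unfold objective
  set s := S.val.map fun e => (x e : ℕ) with hs
  set l := s.sort (· ≤ ·) with hl
  have hcoe : (l : Multiset ℕ) = s := Multiset.sort_eq s (· ≤ ·)
  have hlen : l.length = S.card := by
    rw [hl, Multiset.length_sort, hs, Multiset.card_map]; rfl
  have hmem : ∀ a ∈ l, a ≤ I.m := by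
    intro a ha
    have : a ∈ s := by rw [← hcoe]; exact ha
    obtain ⟨e, -, rfl⟩ := Multiset.mem_map.1 this
    have := (x e).2
    omega
  have hcnt : ∀ v, (l.filter fun a => a < v).length = cnt v S x := by
    intro v
    have h1 : (l.filter fun a => a < v).length = (s.filter fun a => a < v).card := by
      rw [← hcoe, Multiset.filter_coe, Multiset.coe_card]
    rw [h1, hs, Multiset.filter_map, Multiset.card_map]
    rfl
  have hsum : (l.take I.k).sum + (I.k - S.card) * I.m = totalDeficit S x := by
    rw [sum_eq_sum_length_filter I.m (l.take I.k) fun a ha => hmem a (List.mem_of_mem_take ha),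
      totalDeficit]
    have : (I.k - S.card) * I.m = ∑ v ∈ Finset.Ico 1 (I.m + 1), (I.k - S.card) := by
      simp [mul_comm]
    rw [this, ← Finset.sum_add_distrib]
    refine Finset.sum_congr rfl fun v _ => ?_
    rw [← hlen, length_filter_take_of_pairwise v l (Multiset.pairwise_sort s (· ≤ ·)), hcnt, deficit]
  rw [deficit_top, ← hsum]
  have hw' : w = (w - I.m) + I.m := (tsub_add_cancel_of_le hw).symm
  conv_lhs => rw [hw']
  push_cast
  ring

lemma toReal_outcomeProb (x : Outcome I) : (outcomeProb I x).toReal = prob x :=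
  ENNReal.toReal_prod _ _

lemma outcomeProb_ne_top (x : Outcome I) : outcomeProb I x ≠ ∞ :=
  ENNReal.prod_ne_top fun _ _ => PMF.apply_ne_top _ _

lemma sum_outcomeProb_mul (G : Outcome I → ℕ) :
    ∑ x, outcomeProb I x * (G x : ℝ≥0∞) = ENNReal.ofReal (ev fun x => (G x : ℝ)) := by
  unfold ev
  rw [ENNReal.ofReal_sum_of_nonneg fun x _ => mul_nonneg (prob_nonneg x) (Nat.cast_nonneg _)]
  refine Finset.sum_congr rfl fun x _ => ?_
  rw [ENNReal.ofReal_mul (prob_nonneg x), ← toReal_outcomeProb,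
    ENNReal.ofReal_toReal (outcomeProb_ne_top x), ENNReal.ofReal_natCast]

lemma expectedObjective_eq {w : ℝ≥0∞} (hw : (I.m : ℝ≥0∞) ≤ w) (π : Policy I) :
    π.expectedObjective w =
      ENNReal.ofReal (∑ v ∈ Finset.Ico 1 (I.m + 1), ev fun x => (deficit v (π.selected x) x : ℝ)) +
      (w - I.m) *
        ENNReal.ofReal (ev fun x => (deficit (2 ^ topExp I) (π.selected x) x : ℝ)) := by
  unfold Policy.expectedObjective
  rw [← sum_outcomeProb_mul, Finset.mul_sum, ← ev_sum]
  have : (fun x => ∑ v ∈ Finset.Ico 1 (I.m + 1), (deficit v (π.selected x) x : ℝ)) =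
      fun x => ((totalDeficit (π.selected x) x : ℕ) : ℝ) := by
    funext x; rw [totalDeficit]; push_cast; rfl
  rw [this, ← sum_outcomeProb_mul, ← Finset.sum_add_distrib]
  refine Finset.sum_congr rfl fun x _ => ?_
  rw [objective_eq hw]
  ring

/-- Cauchy condensation: the block from `2 ^ n + 1` to `2 ^ (n + 1)` has `2 ^ n` terms, each at
least `d (2 ^ (n + 1))`. -/
lemma sum_condensed_le_two_mul {d : ℕ → ℝ} (h0 : ∀ v, 0 ≤ d v)
    (hd : ∀ v v', v ≤ v' → d v' ≤ d v) (n : ℕ) :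
    ∑ j ∈ Finset.range (n + 1), 2 ^ j * d (2 ^ j) ≤ 2 * ∑ v ∈ Finset.Ico 1 (2 ^ n + 1), d v := by
  induction n with
  | zero => simp; linarith [h0 1]
  | succ n ih =>
    rw [Finset.sum_range_succ]
    have h1 : ∑ v ∈ Finset.Ico 1 (2 ^ (n + 1) + 1), d v = ∑ v ∈ Finset.Ico 1 (2 ^ n + 1), d v +
        ∑ v ∈ Finset.Ico (2 ^ n + 1) (2 ^ (n + 1) + 1), d v :=
      (Finset.sum_Ico_consecutive _ (Nat.le_add_left _ _) (by rw [pow_succ]; omega)).symm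
    have h2 : (2 : ℝ) ^ n * d (2 ^ (n + 1)) ≤
        ∑ v ∈ Finset.Ico (2 ^ n + 1) (2 ^ (n + 1) + 1), d v := by
      have : ∑ v ∈ Finset.Ico (2 ^ n + 1) (2 ^ (n + 1) + 1), d (2 ^ (n + 1)) ≤
          ∑ v ∈ Finset.Ico (2 ^ n + 1) (2 ^ (n + 1) + 1), d v :=
        Finset.sum_le_sum fun v hv => hd _ _ (by have := Finset.mem_Ico.1 hv; omega)
      rw [Finset.sum_const, Nat.card_Ico, nsmul_eq_mul] at this
      have hc : 2 ^ (n + 1) + 1 - (2 ^ n + 1) = 2 ^ n := by rw [pow_succ]; omega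
      rw [hc] at this
      exact_mod_cast this
    rw [h1]
    have h3 : (2 : ℝ) ^ (n + 1) * d (2 ^ (n + 1)) = 2 * (2 ^ n * d (2 ^ (n + 1))) := by ring
    linarith

/-- After exchanging the sums, `d j'` has a coefficient of at most `2 * 2 ^ j'`. Only `j' = J` has
no counterpart on the right; by `d J ≤ d (J - 1)` the last term there absorbs it, which raises the
factor from `2` to `4`. -/
lemma sum_geometric_tail_le {d : ℕ → ℝ} (h0 : ∀ j, 0 ≤ d j) (hd : ∀ j, d (j + 1) ≤ d j)
    (J : ℕ) :
    ∑ j ∈ Finset.range J, 2 ^ j * ∑ j' ∈ Finset.Icc j J, d j' ≤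
      4 * ∑ j ∈ Finset.range J, 2 ^ j * d j := by
  have key : ∀ J, ∑ j ∈ Finset.range J, 2 ^ j * ∑ j' ∈ Finset.Icc j J, d j' ≤
      2 * (∑ j ∈ Finset.range J, 2 ^ j * d j) + 2 ^ J * d J := by
    intro J
    induction J with
    | zero => simpa using h0 0
    | succ J ih =>
      have h1 : ∀ j ∈ Finset.range (J + 1), (2 : ℝ) ^ j * ∑ j' ∈ Finset.Icc j (J + 1), d j' =
          2 ^ j * ∑ j' ∈ Finset.Icc j J, d j' + 2 ^ j * d (J + 1) := fun j hj => by
        rw [Finset.sum_Icc_succ_top (by have := Finset.mem_range.1 hj; omega), mul_add]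
      rw [Finset.sum_congr rfl h1, Finset.sum_add_distrib, Finset.sum_range_succ,
        ← Finset.sum_mul, Finset.Icc_self, Finset.sum_singleton,
        Finset.sum_range_succ (fun j => 2 ^ j * d j)]
      have h2 : ∑ j ∈ Finset.range (J + 1), (2 : ℝ) ^ j ≤ 2 ^ (J + 1) := by
        rw [geom_sum_eq (by norm_num)]; norm_num
      have := mul_le_mul_of_nonneg_right h2 (h0 (J + 1))
      linarith
  cases J with
  | zero => simp
  | succ J =>
    refine (key (J + 1)).trans ?_
    have h1 := Finset.sum_range_succ (fun j => 2 ^ j * d j) J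
    have h2 : 0 ≤ ∑ j ∈ Finset.range J, 2 ^ j * d j :=
      Finset.sum_nonneg fun j _ => mul_nonneg (by positivity) (h0 j)
    have h3 : (0 : ℝ) < 2 ^ J := by positivity
    have h4 := mul_le_mul_of_nonneg_left (hd J) h3.le
    rw [h1, pow_succ]
    linarith

/-- The weights grow geometrically with ratio `200 / 199`, so their sum is at most `200` times the
last one, whose target is at least `1`. -/
lemma sum_trialWeights_le : ∑ i ∈ Finset.range (levels I), 1 / (1000 * target I i) ≤ 1 / 5 := by
  have key : ∀ l, l < levels I →
      ∑ i ∈ Finset.range (l + 1), 1 / (1000 * target I i) ≤ 1 / (5 * target I l) := by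
    intro l
    induction l with
    | zero =>
      intro hl
      have : 1 ≤ target I 0 := lt_levels_iff.1 hl
      simp only [zero_add, Finset.range_one, Finset.sum_singleton]
      exact one_div_le_one_div_of_le (by linarith) (by linarith)
    | succ l ih =>
      intro hl
      have h1 : 1 ≤ target I (l + 1) := lt_levels_iff.1 hl
      have h2 := ih (by omega)
      have h3 := target_succ (I := I) l
      rw [Finset.sum_range_succ]
      have h4 : 0 < target I l := by
        have := target_anti (I := I) (Nat.le_succ l)
        simp only [Nat.succ_eq_add_one] at this
        linarith
      have h5 : 1 / (5 * target I l) + 1 / (1000 * target I (l + 1)) =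
          1 / (5 * target I (l + 1)) := by
        rw [h3]; field_simp; norm_num
      linarith
  rcases Nat.eq_zero_or_pos (levels I) with h | h
  · rw [h]; norm_num
  · obtain ⟨l, hl⟩ : ∃ l, levels I = l + 1 := ⟨levels I - 1, by omega⟩
    rw [hl]
    refine (key l (by omega)).trans ?_
    have : 1 ≤ target I l := lt_levels_iff.1 (by omega)
    exact one_div_le_one_div_of_le (by norm_num) (by linarith)

/-- The procedure has the approximation factor `8` compared with every admissible policy. -/
lemma expectedObjective_finalSet_le {w : ℝ≥0∞} (hw : (I.m : ℝ≥0∞) ≤ w) {π₀ π : Policy I}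
    (h₀ : ∀ x, π₀.selected x = finalSet x) (hπ : π.Admissible) :
    π₀.expectedObjective w ≤ 8 * π.expectedObjective w := by
  rw [expectedObjective_eq hw, expectedObjective_eq hw, mul_add, mul_left_comm]
  simp only [h₀]
  set d : ℕ → ℝ := fun v => ev fun x => (deficit v (π.selected x) x : ℝ) with hd
  set f : ℕ → ℝ := fun v => ev fun x : Outcome I => (deficit v (finalSet x) x : ℝ) with hf
  set J := topExp I with hJ
  set ω := ∑ i ∈ Finset.range (levels I), 1 / (1000 * target I i) with hω
  have hω1 : ω ≤ 1 / 5 := sum_trialWeights_le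
  have hω0 : 0 ≤ ω := Finset.sum_nonneg fun i _ => by
    have := target_nonneg (I := I) i
    positivity
  have hd0 : ∀ v, 0 ≤ d v := fun v => ev_nonneg fun _ => Nat.cast_nonneg _
  have hda : ∀ v v', v ≤ v' → d v' ≤ d v := fun v v' h => ev_mono fun x => by
    exact_mod_cast deficit_anti_left h _ _
  have hfa : ∀ v v', v ≤ v' → f v' ≤ f v := fun v v' h => ev_mono fun x => by
    exact_mod_cast deficit_anti_left h _ _
  have hf0 : ∀ v, 0 ≤ f v := fun v => ev_nonneg fun _ => Nat.cast_nonneg _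
  have hfd : ∀ j ≤ J, f (2 ^ j) ≤ 3 * d (2 ^ j) + ω * ∑ j' ∈ Finset.Icc j J, d (2 ^ j') := by
    intro j hj
    refine (ev_deficit_finalSet hπ hj).trans (le_of_eq ?_)
    rw [hω, Finset.sum_mul_sum]
  refine add_le_add ?_ ?_
  · rw [show (8 : ℝ≥0∞) = ENNReal.ofReal 8 by norm_num, ← ENNReal.ofReal_mul (by norm_num)]
    refine ENNReal.ofReal_le_ofReal ?_
    have h1 : ∑ v ∈ Finset.Ico 1 (I.m + 1), f v ≤ ∑ j ∈ Finset.range J, 2 ^ j * f (2 ^ j) := by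
      have hsub : Finset.Ico 1 (I.m + 1) ⊆ Finset.Ico 1 (2 ^ J) :=
        Finset.Ico_subset_Ico_right (Nat.lt_size_self I.m)
      refine (Finset.sum_le_sum_of_subset_of_nonneg hsub fun v _ _ => hf0 v).trans ?_
      have := Finset.le_sum_condensed' (f := f) (fun _ n _ h => hfa _ n h) J
      simpa [nsmul_eq_mul] using this
    have h2 : ∑ j ∈ Finset.range J, (2 : ℝ) ^ j * f (2 ^ j) ≤
        3 * ∑ j ∈ Finset.range J, 2 ^ j * d (2 ^ j) +
        ω * ∑ j ∈ Finset.range J, 2 ^ j * ∑ j' ∈ Finset.Icc j J, d (2 ^ j') := by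
      rw [Finset.mul_sum, Finset.mul_sum, ← Finset.sum_add_distrib]
      refine Finset.sum_le_sum fun j hj => ?_
      have := mul_le_mul_of_nonneg_left (hfd j (Finset.mem_range.1 hj).le)
        (show (0 : ℝ) ≤ 2 ^ j by positivity)
      linarith
    have h3 := sum_geometric_tail_le (d := fun j => d (2 ^ j)) (fun j => hd0 _)
      (fun j => hda _ _ (Nat.pow_le_pow_right (by norm_num) (Nat.le_succ j))) J
    set sd := ∑ j ∈ Finset.range J, 2 ^ j * d (2 ^ j)
    -- The largest threshold in `sd` is `2 ^ (J - 1)`, which does not exceed `m`.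
    have h4 : sd ≤ 2 * ∑ v ∈ Finset.Ico 1 (I.m + 1), d v := by
      rcases Nat.eq_zero_or_pos J with h | h
      · have : sd = 0 := by simp [sd, h]
        rw [this]
        exact mul_nonneg (by norm_num) (Finset.sum_nonneg fun v _ => hd0 v)
      · obtain ⟨n, hn⟩ : ∃ n, J = n + 1 := ⟨J - 1, by omega⟩
        have h5 : 2 ^ n ≤ I.m := Nat.lt_size.1 (show n < Nat.size I.m by
          rw [hJ, topExp] at hn; omega)
        have h6 := sum_condensed_le_two_mul hd0 hda n
        rw [← hn] at h6
        refine h6.trans (mul_le_mul_of_nonneg_left ?_ (by norm_num))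
        exact Finset.sum_le_sum_of_subset_of_nonneg
          (Finset.Ico_subset_Ico_right (by omega)) fun v _ _ => hd0 v
    have h7 : 0 ≤ sd := Finset.sum_nonneg fun j _ => mul_nonneg (by positivity) (hd0 _)
    have h8 := mul_le_mul_of_nonneg_left h3 hω0
    have h9 := mul_le_mul_of_nonneg_right hω1 h7
    -- The factor is `2 * (3 + 4 / 5) = 7.6`.
    linarith
  -- At the top exponent the inner sum has only the term `j' = J`, so the factor is `3 + 1 / 5`.
  · refine mul_le_mul_right ?_ _
    rw [show (8 : ℝ≥0∞) = ENNReal.ofReal 8 by norm_num, ← ENNReal.ofReal_mul (by norm_num)]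
    refine ENNReal.ofReal_le_ofReal ?_
    have h1 := hfd J le_rfl
    rw [Finset.Icc_self, Finset.sum_singleton] at h1
    have h2 := mul_le_mul_of_nonneg_right hω1 (hd0 (2 ^ J))
    linarith [hd0 (2 ^ J)]

/-- If `k` is large compared with `n`, then it is good enough to select nothing. -/
lemma expectedObjective_done_le {w : ℝ≥0∞} (hk : 2 * I.n ≤ I.k) (π : Policy I) :
    (Policy.done : Policy I).expectedObjective w ≤ 8 * π.expectedObjective w := by
  unfold Policy.expectedObjective
  rw [Finset.mul_sum]
  refine Finset.sum_le_sum fun x _ => ?_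
  rw [mul_left_comm]
  refine mul_le_mul_right ?_ _
  have h1 : objective I w x (Policy.done.selected x) = I.k * w := by
    simp [objective, Policy.selected]
  have h2 : ((I.k - (π.selected x).card : ℕ) : ℝ≥0∞) * w ≤ objective I w x (π.selected x) :=
    le_add_self
  have h3 : I.k ≤ 8 * (I.k - (π.selected x).card) := by
    have := Finset.card_le_univ (π.selected x)
    rw [Fintype.card_fin] at this
    omega
  rw [h1]
  calc (I.k : ℝ≥0∞) * w ≤ ((8 * (I.k - (π.selected x).card) : ℕ) : ℝ≥0∞) * w := by
        gcongr
    _ = 8 * (((I.k - (π.selected x).card : ℕ) : ℝ≥0∞) * w) := by push_cast; ring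
    _ ≤ _ := by gcongr

lemma le_mul_optimum {w a : ℝ≥0∞}
    (h : ∀ π : Policy I, π.Admissible → a ≤ 8 * π.expectedObjective w) :
    a ≤ 8 * optimum I w := by
  rw [mul_comm, ← ENNReal.div_le_iff_le_mul (by simp) (by simp)]
  refine le_iInf₂ fun π hπ => ?_
  rw [ENNReal.div_le_iff_le_mul (by simp) (by simp), mul_comm]
  exact h π hπ

/-! ### The number of steps -/

/-- `1 ≤ k * (199 / 200) ^ l` at the last level `l` and `log (199 / 200) ≤ -1 / 200` give `l ≤ 200 *
log k`. -/
lemma levels_le (I : Problem) : (levels I : ℝ) ≤ 201 * max 1 (Real.log I.k) := by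
  have hm : (1 : ℝ) ≤ max 1 (Real.log I.k) := le_max_left _ _
  have hm' : Real.log I.k ≤ max 1 (Real.log I.k) := le_max_right _ _
  rcases Nat.eq_zero_or_pos (levels I) with h | h
  · rw [h]; push_cast; linarith
  · obtain ⟨l, hl⟩ : ∃ l, levels I = l + 1 := ⟨levels I - 1, by omega⟩
    have h1 : 1 ≤ target I l := lt_levels_iff.1 (by omega)
    unfold target at h1
    have hp : (0 : ℝ) < (199 / 200) ^ l := by positivity
    have hk : (0 : ℝ) < I.k := by
      by_contra hk
      have : (I.k : ℝ) * (199 / 200) ^ l ≤ 0 := mul_nonpos_of_nonpos_of_nonneg (not_lt.1 hk) hp.le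
      linarith
    have h2 := Real.log_nonneg h1
    rw [Real.log_mul hk.ne' hp.ne', Real.log_pow] at h2
    have h3 := Real.log_le_sub_one_of_pos (show (0 : ℝ) < 199 / 200 by norm_num)
    have h4 : (l : ℝ) * Real.log (199 / 200) ≤ l * (199 / 200 - 1) :=
      mul_le_mul_of_nonneg_left h3 (Nat.cast_nonneg _)
    rw [hl]
    push_cast
    linarith

/-- The binary length of `m` is at most `1 + 2 * log m`, and the binary length of that is of order
`log (log m)`; the maximum with `1` takes care of small `m`. -/
lemma size_topExp_le (I : Problem) :
    (Nat.size (topExp I + 1) : ℝ) ≤ 7 * max 1 (Real.log (Real.log I.m)) := by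
  set y := max 1 (Real.log (Real.log I.m)) with hy
  have hy1 : 1 ≤ y := le_max_left _ _
  have hl2 := Real.log_two_gt_d9
  have hey : Real.log I.m ≤ Real.exp y := by
    rcases le_or_gt (Real.log I.m) 0 with h | h
    · exact h.trans (Real.exp_pos _).le
    · calc Real.log I.m = Real.exp (Real.log (Real.log I.m)) := (Real.exp_log h).symm
        _ ≤ Real.exp y := Real.exp_le_exp.2 (le_max_right _ _)
  have he2 : 2 ≤ Real.exp y := by linarith [Real.add_one_le_exp y]
  have h1 : (topExp I : ℝ) ≤ 1 + 2 * Real.log I.m := by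
    unfold topExp
    rcases Nat.eq_zero_or_pos I.m with h | h
    · rw [h]; simp
    · have hs : 0 < Nat.size I.m := Nat.size_pos.2 h
      obtain ⟨s, hs⟩ : ∃ s, Nat.size I.m = s + 1 := ⟨Nat.size I.m - 1, by omega⟩
      have h2 : 2 ^ s ≤ I.m := Nat.lt_size.1 (by omega)
      have h3 : Real.log ((2 : ℝ) ^ s) ≤ Real.log I.m :=
        Real.log_le_log (by positivity) (by exact_mod_cast h2)
      rw [Real.log_pow] at h3
      rw [hs]
      push_cast
      have : (s : ℝ) * (1 / 2) ≤ s * Real.log 2 :=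
        mul_le_mul_of_nonneg_left (by linarith) (Nat.cast_nonneg _)
      linarith
  have h2 : ((topExp I + 1 : ℕ) : ℝ) ≤ Real.exp (2 + y) := by
    push_cast
    have : 3 * Real.exp y ≤ Real.exp (2 + y) := by
      rw [Real.exp_add]
      have := Real.add_one_le_exp (2 : ℝ)
      nlinarith
    linarith
  obtain ⟨s, hs⟩ : ∃ s, Nat.size (topExp I + 1) = s + 1 :=
    ⟨Nat.size (topExp I + 1) - 1, by
      have : 0 < Nat.size (topExp I + 1) := Nat.size_pos.2 (Nat.succ_pos _)
      omega⟩
  have h3 : 2 ^ s ≤ topExp I + 1 := Nat.lt_size.1 (by omega)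
  have h4 : Real.log ((2 : ℝ) ^ s) ≤ 2 + y := by
    rw [Real.log_le_iff_le_exp (by positivity)]
    refine le_trans ?_ h2
    exact_mod_cast h3
  rw [Real.log_pow] at h4
  have : (s : ℝ) * (1 / 2) ≤ s * Real.log 2 :=
    mul_le_mul_of_nonneg_left (by linarith) (Nat.cast_nonneg _)
  rw [hs]
  push_cast
  linarith

/-- The constant of the theorem. -/
def approxConst : ℝ := 201 * 8 * (3 * trialLength)

lemma numSteps_mul_le (I : Problem) :
    ((numSteps I * (3 * trialLength) : ℕ) : ℝ) ≤
      approxConst * max 1 (Real.log (Real.log I.m)) * (max 1 (Real.log I.k)) ^ 2 := by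
  have h1 := levels_le I
  have h2 := size_topExp_le I
  set y := max 1 (Real.log (Real.log I.m))
  set z := max 1 (Real.log I.k)
  have hy : 1 ≤ y := le_max_left _ _
  have hz : 1 ≤ z := le_max_left _ _
  unfold numSteps approxConst
  push_cast
  calc (levels I : ℝ) * (Nat.size (topExp I + 1) + 1) * (3 * trialLength)
      ≤ (201 * z) * (8 * y) * (3 * trialLength) := by
        gcongr
        linarith
    _ = 201 * 8 * (3 * trialLength) * y * z := by ring
    -- The count has a single factor `z`; the square is slack, as `z ≥ 1`.
    _ ≤ _ := by
        gcongr
        nlinarith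

/-- The procedure is a good approximation. -/
lemma isApproximation_of_selected {π : Policy I}
    (hπ : (2 * I.n ≤ I.k → π = .done) ∧ (I.k < 2 * I.n → ∀ x, π.selected x = finalSet x))
    {w : ℝ≥0∞} (hw : (I.m : ℝ≥0∞) ≤ w) :
    π.IsApproximation w 8
      (approxConst * max 1 (Real.log (Real.log I.m)) * (max 1 (Real.log I.k)) ^ 2) := by
  have hnn := (Nat.cast_nonneg (α := ℝ) _).trans (numSteps_mul_le I)
  rcases le_or_gt (2 * I.n) I.k with h | h
  · rw [hπ.1 h]
    exact ⟨fun x => ⟨∅, by simpa using hnn, by simp, by simp [Policy.selected]⟩,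
      le_mul_optimum fun π' _ => expectedObjective_done_le h π'⟩
  · refine ⟨fun x => ?_, le_mul_optimum fun π' hπ' => expectedObjective_finalSet_le hw (hπ.2 h) hπ'⟩
    obtain ⟨F, h1, h2, h3⟩ := covered_finalSet x
    refine ⟨F, le_trans ?_ (numSteps_mul_le I), h2, by rw [h3, hπ.2 h]⟩
    exact_mod_cast h1

/-! ### The memory of the program -/

/-- The variables of the program. -/
@[ext]
structure Memory (I : Problem) where
  size : ℕ
  lo : ℕ
  hi : ℕ
  mid : ℕ
  thr : ℕ
  round : ℕ
  quota : ℕ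
  count : ℕ
  cur : ℕ
  best : ℕ
  val : ℕ
  good : ℕ
  out : ℕ
  bound : ℝ
  cut : ℝ
  spent : ℝ
  tail : ℕ → ℝ
  probed : Finset (Fin I.n)

/-- The entry for element number `i` in the table of results: `0` if it has not been probed,
otherwise its weight plus `1`. -/
def entry (x : Outcome I) (R : Finset (Fin I.n)) (i : ℕ) : ℕ :=
  if h : i < I.n then if ⟨i, h⟩ ∈ R then x ⟨i, h⟩ + 1 else 0 else 0

/-- The layout of the natural memory. -/
def Memory.natMem (M : Memory I) (x : Outcome I) : ℕ → ℕ
  | 0 => I.n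
  | 1 => I.m
  | 2 => I.k
  | 3 => M.size
  | 4 => M.lo
  | 5 => M.hi
  | 6 => M.mid
  | 7 => M.thr
  | 8 => M.round
  | 9 => M.quota
  | 10 => M.count
  | 11 => M.cur
  | 12 => M.best
  | 13 => M.val
  | 14 => M.good
  | 15 => M.out
  | i + 16 => entry x M.probed i

/-- The layout of the real memory. -/
def Memory.realMem (M : Memory I) : ℕ → ℝ
  | 0 => M.bound
  | 1 => M.cut
  | 2 => M.spent
  | i + 3 => M.tail i

/-- The state of the machine with given values of the variables. -/
def Memory.state (M : Memory I) (x : Outcome I) : State I := ⟨M.natMem x, M.realMem, M.probed⟩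

/-- The memory at the start. -/
def Memory.initial (I : Problem) : Memory I :=
  ⟨0, 0, 0, 0, 0, 0, 0, 0, 0, 0, 0, 0, 0, 0, 0, 0, fun _ => 0, ∅⟩

lemma Memory.state_initial (x : Outcome I) :
    (Memory.initial I).state x = State.initial I := by
  unfold Memory.state State.initial
  congr 1
  · funext i
    unfold Memory.natMem
    split <;> simp [Memory.initial, entry]
  · funext i
    unfold Memory.realMem
    split <;> simp [Memory.initial]

/-- Started with memory `M`, the program ends within `T` steps with a memory that satisfies
`Q`. -/
def Runs (x : Outcome I) (p : Program) (M : Memory I) (T : ℕ) (Q : Memory I → Prop) : Prop :=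
  ∃ M' t, t ≤ T ∧ Exec x p (M.state x) (M'.state x) t ∧ Q M'

section Rules

variable {x : Outcome I} {p q : Program} {c : Test} {M M' : Memory I} {T T' : ℕ}
  {Q Q' : Memory I → Prop}

lemma Runs.mono (hT : T ≤ T') (h : Runs x p M T Q) (hQ : ∀ M', Q M' → Q' M') :
    Runs x p M T' Q' := by
  obtain ⟨M', t, ht, he, h⟩ := h
  exact ⟨M', t, ht.trans hT, he, hQ _ h⟩

lemma Runs.le (hT : T ≤ T') (h : Runs x p M T Q) : Runs x p M T' Q := h.mono hT fun _ => id

lemma Runs.skip (h : Q M) : Runs x .skip M 1 Q := ⟨M, 1, le_rfl, .skip _, h⟩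

lemma Runs.seq (hp : Runs x p M T Q) (hq : ∀ M', Q M' → Runs x q M' T' Q') :
    Runs x (.seq p q) M (T + T') Q' := by
  obtain ⟨M₁, t₁, ht₁, he₁, h₁⟩ := hp
  obtain ⟨M₂, t₂, ht₂, he₂, h₂⟩ := hq _ h₁
  exact ⟨M₂, t₁ + t₂, add_le_add ht₁ ht₂, .seq he₁ he₂, h₂⟩

lemma Runs.step (hp : Runs x p M T (· = M')) (hq : Runs x q M' T' Q') :
    Runs x (.seq p q) M (T + T') Q' :=
  hp.seq (by rintro _ rfl; exact hq)

lemma Runs.ite (hp : c.Holds (M.state x) → Runs x p M T Q)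
    (hq : ¬ c.Holds (M.state x) → Runs x q M T Q) : Runs x (.ite c p q) M (T + 1) Q := by
  by_cases h : c.Holds (M.state x)
  · obtain ⟨M', t, ht, he, h'⟩ := hp h
    exact ⟨M', t + 1, by omega, .iteTrue h he, h'⟩
  · obtain ⟨M', t, ht, he, h'⟩ := hq h
    exact ⟨M', t + 1, by omega, .iteFalse h he, h'⟩

lemma Runs.iteTrue (h : c.Holds (M.state x)) (hp : Runs x p M T Q) :
    Runs x (.ite c p q) M (T + 1) Q := .ite (fun _ => hp) fun h' => absurd h h'

lemma Runs.iteFalse (h : ¬ c.Holds (M.state x)) (hq : Runs x q M T Q) :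
    Runs x (.ite c p q) M (T + 1) Q := .ite (fun h' => absurd h' h) fun _ => hq

/-- A loop with an invariant that depends on an upper bound for the number of rounds left. -/
lemma Runs.while (J : ℕ → Memory I → Prop) (h0 : ∀ M, J 0 M → ¬ c.Holds (M.state x))
    (hs : ∀ j M, J (j + 1) M → c.Holds (M.state x) → Runs x p M T (J j)) (N : ℕ)
    (hM : J N M) (hQ : ∀ j M', J j M' → ¬ c.Holds (M'.state x) → Q M') :
    Runs x (.while c p) M (N * (T + 1) + 1) Q := by
  induction N generalizing M with
  | zero => exact ⟨M, 1, by omega, .whileFalse (h0 M hM), hQ _ _ hM (h0 M hM)⟩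
  | succ N ih =>
    by_cases h : c.Holds (M.state x)
    · obtain ⟨M₁, t₁, ht₁, he₁, h₁⟩ := hs N M hM h
      obtain ⟨M₂, t₂, ht₂, he₂, h₂⟩ := ih h₁
      exact ⟨M₂, t₁ + t₂ + 1, by rw [Nat.succ_mul]; omega, .whileTrue h he₁ he₂, h₂⟩
    · exact ⟨M, 1, by omega, .whileFalse h, hQ _ _ hM h⟩

lemma runs_setNat {a b : NatExp}
    (h1 : M'.natMem x = Function.update (M.natMem x) (a.eval (M.state x)) (b.eval (M.state x)))
    (h2 : M'.realMem = M.realMem) (h3 : M'.probed = M.probed) :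
    Runs x (.setNat a b) M 1 (· = M') := by
  refine ⟨M', 1, le_rfl, ?_, rfl⟩
  rw [show M'.state x = ⟨Function.update (M.natMem x) (a.eval (M.state x)) (b.eval (M.state x)),
    M.realMem, M.probed⟩ by rw [Memory.state, h1, h2, h3]]
  exact Exec.setNat a b (M.state x)

lemma runs_setReal {a : NatExp} {b : RealExp}
    (h1 : M'.natMem x = M.natMem x)
    (h2 : M'.realMem = Function.update M.realMem (a.eval (M.state x)) (b.eval (M.state x)))
    (h3 : M'.probed = M.probed) :
    Runs x (.setReal a b) M 1 (· = M') := by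
  refine ⟨M', 1, le_rfl, ?_, rfl⟩
  rw [show M'.state x = ⟨M.natMem x,
    Function.update M.realMem (a.eval (M.state x)) (b.eval (M.state x)), M.probed⟩ by
      rw [Memory.state, h1, h2, h3]]
  exact Exec.setReal a b (M.state x)

/-- The variable at a fixed address. -/
abbrev NatExp.var (i : ℕ) : NatExp := .mem (.const i)

/-- The real variable at a fixed address. -/
abbrev RealExp.var (i : ℕ) : RealExp := .mem (.const i)

variable (M)

lemma runs_size (b : NatExp) : Runs x (.setNat (.const 3) b) M 1
    (· = { M with size := b.eval (M.state x) }) := by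
  refine runs_setNat ?_ rfl rfl
  funext i; unfold Memory.natMem; split <;> simp [NatExp.eval, Function.update]

lemma runs_lo (b : NatExp) : Runs x (.setNat (.const 4) b) M 1
    (· = { M with lo := b.eval (M.state x) }) := by
  refine runs_setNat ?_ rfl rfl
  funext i; unfold Memory.natMem; split <;> simp [NatExp.eval, Function.update]

lemma runs_hi (b : NatExp) : Runs x (.setNat (.const 5) b) M 1
    (· = { M with hi := b.eval (M.state x) }) := by
  refine runs_setNat ?_ rfl rfl
  funext i; unfold Memory.natMem; split <;> simp [NatExp.eval, Function.update]

lemma runs_mid (b : NatExp) : Runs x (.setNat (.const 6) b) M 1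
    (· = { M with mid := b.eval (M.state x) }) := by
  refine runs_setNat ?_ rfl rfl
  funext i; unfold Memory.natMem; split <;> simp [NatExp.eval, Function.update]

lemma runs_thr (b : NatExp) : Runs x (.setNat (.const 7) b) M 1
    (· = { M with thr := b.eval (M.state x) }) := by
  refine runs_setNat ?_ rfl rfl
  funext i; unfold Memory.natMem; split <;> simp [NatExp.eval, Function.update]

lemma runs_round (b : NatExp) : Runs x (.setNat (.const 8) b) M 1
    (· = { M with round := b.eval (M.state x) }) := by
  refine runs_setNat ?_ rfl rfl
  funext i; unfold Memory.natMem; split <;> simp [NatExp.eval, Function.update]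

lemma runs_quota (b : NatExp) : Runs x (.setNat (.const 9) b) M 1
    (· = { M with quota := b.eval (M.state x) }) := by
  refine runs_setNat ?_ rfl rfl
  funext i; unfold Memory.natMem; split <;> simp [NatExp.eval, Function.update]

lemma runs_count (b : NatExp) : Runs x (.setNat (.const 10) b) M 1
    (· = { M with count := b.eval (M.state x) }) := by
  refine runs_setNat ?_ rfl rfl
  funext i; unfold Memory.natMem; split <;> simp [NatExp.eval, Function.update]

lemma runs_cur (b : NatExp) : Runs x (.setNat (.const 11) b) M 1
    (· = { M with cur := b.eval (M.state x) }) := by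
  refine runs_setNat ?_ rfl rfl
  funext i; unfold Memory.natMem; split <;> simp [NatExp.eval, Function.update]

lemma runs_best (b : NatExp) : Runs x (.setNat (.const 12) b) M 1
    (· = { M with best := b.eval (M.state x) }) := by
  refine runs_setNat ?_ rfl rfl
  funext i; unfold Memory.natMem; split <;> simp [NatExp.eval, Function.update]

lemma runs_val (b : NatExp) : Runs x (.setNat (.const 13) b) M 1
    (· = { M with val := b.eval (M.state x) }) := by
  refine runs_setNat ?_ rfl rfl
  funext i; unfold Memory.natMem; split <;> simp [NatExp.eval, Function.update]

lemma runs_good (b : NatExp) : Runs x (.setNat (.const 14) b) M 1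
    (· = { M with good := b.eval (M.state x) }) := by
  refine runs_setNat ?_ rfl rfl
  funext i; unfold Memory.natMem; split <;> simp [NatExp.eval, Function.update]

lemma runs_bound (b : RealExp) : Runs x (.setReal (.const 0) b) M 1
    (· = { M with bound := b.eval (M.state x) }) := by
  refine runs_setReal rfl ?_ rfl
  funext i; unfold Memory.realMem; split <;> simp [NatExp.eval, Function.update]

lemma runs_cut (b : RealExp) : Runs x (.setReal (.const 1) b) M 1
    (· = { M with cut := b.eval (M.state x) }) := by
  refine runs_setReal rfl ?_ rfl
  funext i; unfold Memory.realMem; split <;> simp [NatExp.eval, Function.update]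

lemma runs_spent (b : RealExp) : Runs x (.setReal (.const 2) b) M 1
    (· = { M with spent := b.eval (M.state x) }) := by
  refine runs_setReal rfl ?_ rfl
  funext i; unfold Memory.realMem; split <;> simp [NatExp.eval, Function.update]

lemma runs_tail (a : NatExp) (b : RealExp) : Runs x (.setReal (.add a (.const 3)) b) M 1
    (· = { M with tail := Function.update M.tail (a.eval (M.state x)) (b.eval (M.state x)) }) := by
  refine runs_setReal rfl ?_ rfl
  funext i
  unfold Memory.realMem
  split
  case h_4 i => simp [NatExp.eval, Function.update_apply]
  all_goals simp [NatExp.eval, Function.update]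

/-- Probe the element in the variable `best` and enter the result into the table. -/
def probeBest : Program :=
  .seq (.probe (.const 15) (.var 12))
    (.setNat (.add (.var 12) (.const 16)) (.add (.var 15) (.const 1)))

lemma runs_probeBest (e : Fin I.n) (he : M.best = e) : Runs x probeBest M 2
    (· = { M with out := x e, probed := insert e M.probed }) := by
  refine ⟨_, 2, le_rfl, ?_, rfl⟩
  have hb : NatExp.eval (M.state x) (.var 12) = e := he
  have hp : (M.state x).doProbe x (NatExp.eval (M.state x) (.const 15))
      (NatExp.eval (M.state x) (.var 12)) =
      ⟨Function.update (M.natMem x) 15 (x e : ℕ), M.realMem, insert e M.probed⟩ := by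
    rw [hb, State.doProbe, dif_pos e.2]
    rfl
  have h1 := Exec.probe (x := x) (.const 15) (.var 12) (M.state x)
  rw [hp] at h1
  have h := Exec.seq h1 (Exec.setNat (.add (.var 12) (.const 16)) (.add (.var 15) (.const 1)) _)
  rw [probeBest]
  convert h using 1
  simp only [Memory.state, State.mk.injEq]
  refine ⟨?_, rfl, trivial⟩
  have h12 : Function.update (M.natMem x) 15 (x e : ℕ) 12 = e := by
    rw [Function.update_of_ne (by norm_num)]; exact he
  have h15 : Function.update (M.natMem x) 15 (x e : ℕ) 15 = x e := Function.update_self ..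
  simp only [NatExp.eval, h12, h15]
  funext i
  by_cases hi : i < 16
  · rw [Function.update_of_ne (by omega)]
    by_cases h : i = 15
    · subst h
      rw [h15]
      rfl
    · rw [Function.update_of_ne h]
      unfold Memory.natMem
      split <;> first | rfl | omega
  · obtain ⟨i, rfl⟩ := Nat.exists_eq_add_of_le' (not_lt.1 hi)
    by_cases h : i = (e : ℕ)
    · subst h
      rw [Function.update_self]
      simp [Memory.natMem, entry]
    · rw [Function.update_of_ne (by omega), Function.update_of_ne (by omega)]
      by_cases hn : i < I.n
      · have : (⟨i, hn⟩ : Fin I.n) ≠ e := fun h' => h (by rw [← h'])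
        simp [Memory.natMem, entry, hn, this]
      · simp [Memory.natMem, entry, hn]

end Rules

/-! ### Subroutines -/

/-- The number of an optional element, where `n` stands for no element. -/
def number {n : ℕ} (o : Option (Fin n)) : ℕ := o.elim n fun e => e

@[simp] lemma number_none {n : ℕ} : number (none : Option (Fin n)) = n := rfl

@[simp] lemma number_some {n : ℕ} (e : Fin n) : number (some e) = e := rfl

/-- Store in `best` the element with property `q` and smallest key. -/
def pickBest (q : Test) (key : NatExp → RealExp) : Program :=
  .seq (.setNat (.const 11) (.const 0)) <|
  .seq (.setNat (.const 12) (.var 0)) <|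
  .while (.natLT (.var 11) (.var 0)) <|
    .seq
      (.ite (.and q (.not (.and (.natLT (.var 12) (.var 0))
          (.not (.realLT (key (.var 11)) (key (.var 12)))))))
        (.setNat (.const 12) (.var 11)) .skip)
      (.setNat (.const 11) (.add (.var 11) (.const 1)))

/-- A bound for the running time of `pickBest`. -/
def pickTime (Q : ℕ) : ℕ := 4 * Q + 3

/-- Invariant of the scan: `best` is the number of `pickUpTo p κ cur`, with `n` for no element. The
test and the keys must not be disturbed by changes of the scanning variables. -/
lemma runs_pickBest {x : Outcome I} {q : Test} {key : NatExp → RealExp} {M : Memory I}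
    {p : Fin I.n → Prop} {κ : Fin I.n → ℝ}
    (hq : ∀ (e : Fin I.n) b, q.Holds (({ M with cur := e, best := b } : Memory I).state x) ↔ p e)
    (hcur : ∀ (e : Fin I.n) b,
      (key (.var 11)).eval (({ M with cur := e, best := b } : Memory I).state x) = κ e)
    (hbest : ∀ c (e : Fin I.n),
      (key (.var 12)).eval (({ M with cur := c, best := e } : Memory I).state x) = κ e)
    {Q : ℕ} (hQ : I.n ≤ Q) :
    Runs x (pickBest q key) M (pickTime Q)
      (· = { M with cur := I.n, best := number (pick p κ) }) := by
  refine Runs.le (T := 1 + (1 + (I.n * (2 + 1 + 1) + 1))) (by unfold pickTime; omega) ?_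
  refine .step (runs_cur _ _) (.step (runs_best _ _) ?_)
  refine Runs.while (fun j M' => ∃ i, i + j = I.n ∧
      M' = { M with cur := i, best := number (pickUpTo p κ i) }) ?_ ?_ _
    ⟨0, by omega, rfl⟩ ?_
  · rintro _ ⟨i, hi, rfl⟩
    show ¬ (i < I.n)
    omega
  · rintro j _ ⟨i, hi, rfl⟩ -
    have hin : i < I.n := by omega
    refine Runs.seq (T := 1 + 1) (T' := 1) (Q :=
      (· = ({ M with cur := i, best := number (pickUpTo p κ (i + 1)) } : Memory I))) ?_ ?_
    · have key : Test.Holds (({ M with cur := i, best := number (pickUpTo p κ i) } :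
            Memory I).state x)
          (.and q (.not (.and (.natLT (.var 12) (.var 0))
          (.not (.realLT (key (.var 11)) (key (.var 12))))))) ↔
          (p ⟨i, hin⟩ ∧ ∀ b ∈ pickUpTo p κ i, κ ⟨i, hin⟩ < κ b) := by
        refine and_congr (hq ⟨i, hin⟩ _) ?_
        show ¬ (number (pickUpTo p κ i) < I.n ∧ ¬ (RealExp.eval _ _ < RealExp.eval _ _)) ↔ _
        rw [hcur ⟨i, hin⟩]
        cases h : pickUpTo p κ i with
        | none => simp
        | some b => rw [number_some, hbest]; simp
      refine .ite (fun h => ?_) (fun h => ?_)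
      · refine (runs_best _ _).mono le_rfl ?_
        rintro _ rfl
        rw [key] at h
        rw [pickUpTo, dif_pos hin, if_pos h]
        rfl
      · refine .skip ?_
        rw [key] at h
        rw [pickUpTo, dif_pos hin, if_neg h]
    · rintro _ rfl
      refine (runs_cur _ _).mono le_rfl ?_
      rintro _ rfl
      exact ⟨i + 1, by omega, rfl⟩
  · rintro j _ ⟨i, hi, rfl⟩ h
    replace h : ¬ (i < I.n) := h
    obtain rfl : i = I.n := by omega
    rfl

/-- The entry of the table of results for an element. -/
abbrev NatExp.entry (e : NatExp) : NatExp := .mem (.add e (.const 16))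

/-- The tail probability of an element. -/
abbrev RealExp.tail (e : NatExp) : RealExp := .mem (.add e (.const 3))

/-- The real number with a given natural value. -/
abbrev RealExp.lit (a : ℕ) : RealExp := .ofNat (.const a)

lemma entry_pos {x : Outcome I} {R : Finset (Fin I.n)} (e : Fin I.n) :
    entry x R e < 1 ↔ e ∉ R := by
  unfold entry
  rw [dif_pos e.2]
  split_ifs with h <;> simp [h]

lemma eval_cost {s : State I} {a : NatExp} {e : Fin I.n} (h : a.eval s = e) :
    (RealExp.cost a).eval s = I.cost e := by
  rw [RealExp.eval, dif_pos (h ▸ e.2)]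
  simp [h]

@[simp] lemma eval_lit (s : State I) (a : ℕ) : (RealExp.lit a).eval s = a := rfl

/-- Add unprobed cheap elements with smallest tail probabilities. -/
def topProgram : Program :=
  .seq (.setReal (.const 1) (.lit 1)) <|
  .seq (.setNat (.const 10) (.const 0)) <|
  .while (.natLT (.var 10) (.var 9)) <|
    .seq (pickBest (.and (.natLT (.entry (.var 11)) (.const 1))
        (.not (.realLT .budget (.mul (.cost (.var 11)) (.ofNat (.var 9)))))) .tail) <|
    .seq (.ite (.natLT (.var 12) (.var 0))
      (.seq (.setReal (.const 1) (.tail (.var 12))) probeBest)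
      (.setReal (.const 1) (.lit 1))) <|
    .setNat (.const 10) (.add (.var 10) (.const 1))

lemma runs_topProgram {x : Outcome I} {M : Memory I} {Q g : ℕ} {D : ℝ} (hQ : I.n ≤ Q)
    (hM : M.quota = topCount D) (hc : topCount D ≤ Q + 1)
    (ht : ∀ e : Fin I.n, M.tail e = surv I g e) :
    Runs x topProgram M (2 + ((Q + 1) * (4 * Q + 9) + 1))
      (fun M' => ∃ a₁ a₂ a₃ a₄, M' =
        { M with
          count := a₁, cur := a₂, best := a₃, out := a₄
          cut := (batchTop I g D M.probed).2, probed := (batchTop I g D M.probed).1 }) := by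
  refine Runs.le (T := 1 + (1 + (topCount D * (pickTime Q + (3 + 1 + 1) + 1) + 1))) ?_ ?_
  · unfold pickTime
    nlinarith [Nat.mul_le_mul_right (4 * Q + 9) hc]
  refine .step (runs_cut _ _) (.step (runs_count _ _) ?_)
  -- Invariant: the remaining `j` rounds of `top` lead from the current set to `batchTop`. When no
  -- element is left, both idle with the value `1`.
  refine Runs.while (fun j M' => ∃ a₁ a₂ a₃ a₄ ρ R, M' =
        { M with count := a₁, cur := a₂, best := a₃, out := a₄, cut := ρ, probed := R } ∧
        a₁ + j = topCount D ∧
        top (fun e => (I.cost e : ℝ) * (topCount D : ℕ) ≤ I.budget) (surv I g) j R ρ =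
          batchTop I g D M.probed) ?_ ?_ _
    ⟨0, M.cur, M.best, M.out, 1, M.probed,
      by rw [eval_lit, Nat.cast_one]; rfl, by omega, rfl⟩ ?_
  · rintro _ ⟨a₁, a₂, a₃, a₄, ρ, R, rfl, h1, h2⟩
    show ¬ (a₁ < M.quota)
    omega
  · rintro j _ ⟨a₁, a₂, a₃, a₄, ρ, R, rfl, h1, h2⟩ -
    refine .step (runs_pickBest
      (p := fun e => e ∉ R ∧ (I.cost e : ℝ) * (topCount D : ℕ) ≤ I.budget)
      (κ := surv I g) ?_ ?_ ?_ hQ) ?_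
    · intro e b
      refine and_congr (entry_pos e) ?_
      show ¬ ((I.budget : ℝ) < RealExp.eval _ (.cost (.var 11)) * (M.quota : ℝ)) ↔ _
      rw [hM, not_lt]
      rw [eval_cost (e := e) rfl]
    · exact fun e b => ht e
    · exact fun c e => ht e
    rw [top] at h2
    cases hp : pick (fun e => e ∉ R ∧ (I.cost e : ℝ) * (topCount D : ℕ) ≤ I.budget)
      (surv I g) with
    | none =>
      rw [hp] at h2
      refine Runs.step (T := 3 + 1) (T' := 1)
        (.iteFalse (lt_irrefl I.n) ((runs_cut _ _).le (by omega))) ?_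
      refine (runs_count _ _).mono le_rfl ?_
      rintro _ rfl
      refine ⟨a₁ + 1, I.n, I.n, a₄, 1, R, ?_, by omega, h2⟩
      rw [eval_lit, Nat.cast_one]
      rfl
    | some e =>
      rw [hp] at h2
      refine Runs.step (T := 3 + 1) (T' := 1)
        (.iteTrue e.2 (.step (T := 1) (T' := 2) (runs_cut _ _) (runs_probeBest _ e rfl))) ?_
      refine (runs_count _ _).mono le_rfl ?_
      rintro _ rfl
      exact ⟨a₁ + 1, I.n, e, x e, surv I g e, insert e R, by rw [← ht e]; rfl, by omega, h2⟩
  · rintro j _ ⟨a₁, a₂, a₃, a₄, ρ, R, rfl, h1, h2⟩ h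
    replace h : ¬ (a₁ < M.quota) := h
    obtain rfl : j = 0 := by omega
    exact ⟨a₁, a₂, a₃, a₄, by rw [← h2]; rfl⟩

/-- Add unprobed elements with largest ratios of exponent and cost. -/
def fillProgram : Program :=
  .seq (.setReal (.const 2) (.lit 0)) <|
  .while (.not (.realLT .budget (.var 2))) <|
    .seq (pickBest (.and (.natLT (.entry (.var 11)) (.const 1))
        (.and (.not (.realLT (.tail (.var 11)) (.var 1)))
        (.and (.realLT (.tail (.var 11)) (.lit 1))
        (.not (.realLT .budget (.cost (.var 11)))))))
        fun e => .div (.cost e) (.sub (.lit 0) (.log (.tail e)))) <|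
    .ite (.natLT (.var 12) (.var 0))
      (.seq (.setReal (.const 2) (.add (.var 2) (.cost (.var 12)))) probeBest)
      (.setReal (.const 2) (.add .budget (.lit 1)))

lemma runs_fillProgram {x : Outcome I} {M : Memory I} {Q g : ℕ} (hQ : I.n ≤ Q)
    (ht : ∀ e : Fin I.n, M.tail e = surv I g e) :
    Runs x fillProgram M (1 + ((Q + 2) * (4 * Q + 8) + 1))
      (fun M' => ∃ a₁ a₂ a₃ r, M' =
        { M with
          cur := a₁, best := a₂, out := a₃, spent := r
          probed := batchFill I g M.cut M.probed }) := by
  refine Runs.le (T := 1 + ((I.n + 2) * (pickTime Q + (3 + 1) + 1) + 1)) ?_ ?_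
  · unfold pickTime
    nlinarith [Nat.mul_le_mul_right (4 * Q + 8) hQ]
  refine .step (runs_spent _ _) ?_
  set key : Fin I.n → ℝ := fun e => (I.cost e : ℝ) / (0 - Real.log (surv I g e)) with hkey
  -- Either the final set is reached and the loop is about to stop, or fuel `f` is left; each probe
  -- enlarges `R`, so `I.n < R.card + f` keeps `f` positive.
  refine Runs.while (fun j M' => ∃ a₁ a₂ a₃ r R, M' =
        { M with cur := a₁, best := a₂, out := a₃, spent := r, probed := R } ∧
        (((I.budget : ℝ) < r ∧ R = batchFill I g M.cut M.probed) ∨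
        ∃ f, f + 1 = j ∧ I.n < R.card + f ∧ 
          fill (Eligible I g M.cut) key (fun e => (I.cost e : ℝ)) I.budget f R r =
            batchFill I g M.cut M.probed)) ?_ ?_ _
    ⟨M.cur, M.best, M.out, 0, M.probed,
      by rw [eval_lit, Nat.cast_zero], .inr ⟨I.n + 1, rfl, by omega, rfl⟩⟩ ?_
  · rintro _ ⟨a₁, a₂, a₃, r, R, rfl, h | ⟨f, h, -⟩⟩
    · exact fun hn => hn h.1
    · omega
  · rintro j _ ⟨a₁, a₂, a₃, r, R, rfl, h | ⟨f, hf, hc, h⟩⟩ hr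
    · exact absurd h.1 hr
    replace hr : r ≤ I.budget := not_lt.1 hr
    have hR := card_finset_fin_le R
    obtain ⟨f, rfl⟩ : ∃ f', f = f' + 1 := ⟨f - 1, by omega⟩
    refine .step (T' := 3 + 1) (runs_pickBest
      (p := fun e => e ∉ R ∧ Eligible I g M.cut e) (κ := key) ?_ ?_ ?_ hQ) ?_
    · intro e b
      refine and_congr (entry_pos e) (and_congr ?_ (and_congr ?_ ?_))
      · show ¬ (M.tail e < M.cut) ↔ _
        rw [ht, not_lt]
      · show M.tail e < RealExp.eval _ (.lit 1) ↔ _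
        rw [ht, eval_lit, Nat.cast_one]
      · show ¬ ((I.budget : ℝ) < RealExp.eval _ (.cost (.var 11))) ↔ _
        rw [eval_cost (e := e) rfl, not_lt]
    · intro e b
      show RealExp.eval _ (.cost (.var 11)) / (RealExp.eval _ (.lit 0) - Real.log (M.tail e)) = _
      rw [ht, eval_cost (e := e) rfl, eval_lit, Nat.cast_zero]
    · intro c e
      show RealExp.eval _ (.cost (.var 12)) / (RealExp.eval _ (.lit 0) - Real.log (M.tail e)) = _
      rw [ht, eval_cost (e := e) rfl, eval_lit, Nat.cast_zero]
    rw [fill, if_pos hr] at h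
    cases hp : pick (fun e => e ∉ R ∧ Eligible I g M.cut e) key with
    | none =>
      rw [hp] at h
      -- If no element is left, the fictitious cost `budget + 1` ends the loop.
      refine .iteFalse (lt_irrefl I.n) ((runs_spent _ _).mono (by omega) ?_)
      rintro _ rfl
      refine ⟨I.n, I.n, a₃, _, R, rfl, .inl ⟨?_, h⟩⟩
      show (I.budget : ℝ) < I.budget + RealExp.eval _ (.lit 1)
      rw [eval_lit, Nat.cast_one]
      exact lt_add_one _
    | some e =>
      rw [hp] at h
      refine .iteTrue e.2 ((Runs.step (T := 1) (T' := 2) (runs_spent _ _)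
        (runs_probeBest _ e rfl)).mono le_rfl ?_)
      rintro _ rfl
      have he := (pick_some hp).1.1
      refine ⟨I.n, e, x e, _, insert e R, rfl,
        .inr ⟨f, by omega, by rw [Finset.card_insert_of_notMem he]; omega, ?_⟩⟩
      rw [RealExp.eval, eval_cost (e := e) rfl]
      exact h
  · rintro j _ ⟨a₁, a₂, a₃, r, R, rfl, h | ⟨f, hf, hc, h⟩⟩ hr
    · exact ⟨a₁, a₂, a₃, r, by rw [h.2]⟩
    · replace hr : (I.budget : ℝ) < r := not_not.1 hr
      refine ⟨a₁, a₂, a₃, r, ?_⟩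
      rw [← h]
      cases f with
      | zero => rfl
      | succ f => rw [fill, if_neg (not_le.2 hr)]

/-- Determine the number of cheap elements in a batch. -/
def quotaProgram : Program :=
  .seq (.setNat (.const 9) (.const 1)) <|
  .while (.not (.realLT (.div (.var 0) (.lit 24)) (.ofNat (.var 9)))) <|
    .setNat (.const 9) (.add (.var 9) (.const 1))

lemma runs_quotaProgram {x : Outcome I} {M : Memory I} {Q : ℕ} (hM : 0 ≤ M.bound)
    (hc : topCount M.bound ≤ Q + 1) :
    Runs x quotaProgram M (2 * Q + 2) (· = { M with quota := topCount M.bound }) := by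
  refine Runs.le (T := 1 + ((topCount M.bound - 1) * (1 + 1) + 1)) (by omega) ?_
  refine .step (runs_quota _ _) ?_
  have key (a : ℕ) : (¬ (M.bound / 24 < a)) ↔ a < topCount M.bound := by
    rw [not_lt, topCount, Nat.lt_succ_iff, Nat.le_floor_iff (by positivity)]
  refine Runs.while (fun j M' => ∃ a, a + j = topCount M.bound ∧ M' = { M with quota := a })
    ?_ ?_ _ ⟨1, by unfold topCount; omega, rfl⟩ ?_
  · rintro _ ⟨a, h, rfl⟩ hn
    have := (key a).1 hn
    omega
  · rintro j _ ⟨a, h, rfl⟩ -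
    refine (runs_quota _ _).mono le_rfl ?_
    rintro _ rfl
    exact ⟨a + 1, by omega, rfl⟩
  · rintro j _ ⟨a, h, rfl⟩ hn
    have : ¬ (a < topCount M.bound) := by
      rw [← key]
      exact hn
    rw [show a = topCount M.bound by omega]

/-- Probe a batch of elements. -/
def batchProgram : Program := .seq topProgram fillProgram

/-- A bound for the running time of `batchProgram`. -/
def batchTime (Q : ℕ) : ℕ :=
  2 + ((Q + 1) * (4 * Q + 9) + 1) + (1 + ((Q + 2) * (4 * Q + 8) + 1))

/-- The memories that agree on the variables which are fixed during a trial. -/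
def Memory.Similar (M M' : Memory I) : Prop :=
  M'.size = M.size ∧ M'.lo = M.lo ∧ M'.hi = M.hi ∧ M'.mid = M.mid ∧ M'.thr = M.thr ∧
    M'.bound = M.bound

lemma runs_batchProgram {x : Outcome I} {M : Memory I} {Q g : ℕ} {D : ℝ} (hQ : I.n ≤ Q)
    (hM : M.quota = topCount D) (hc : topCount D ≤ Q + 1)
    (ht : ∀ e : Fin I.n, M.tail e = surv I g e) :
    Runs x batchProgram M (batchTime Q) (fun M' => M.Similar M' ∧ M'.quota = M.quota ∧
      M'.round = M.round ∧ M'.tail = M.tail ∧ M'.probed = batch I g D M.probed) := by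
  refine Runs.seq (runs_topProgram hQ hM hc ht) ?_
  rintro _ ⟨a₁, a₂, a₃, a₄, rfl⟩
  refine Runs.mono le_rfl (runs_fillProgram (g := g) hQ ?_) ?_
  · exact ht
  rintro _ ⟨b₁, b₂, b₃, r, rfl⟩
  exact ⟨⟨rfl, rfl, rfl, rfl, rfl, rfl⟩, rfl, rfl, rfl, rfl⟩

lemma Memory.Similar.trans {M M' M'' : Memory I} (h : M.Similar M') (h' : M'.Similar M'') :
    M.Similar M'' := by
  obtain ⟨h1, h2, h3, h4, h5, h6⟩ := h
  obtain ⟨k1, k2, k3, k4, k5, k6⟩ := h'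
  exact ⟨k1.trans h1, k2.trans h2, k3.trans h3, k4.trans h4, k5.trans h5, k6.trans h6⟩

/-- Probe the elements of a trial. -/
def batchesProgram : Program :=
  .seq (.setNat (.const 8) (.const 0)) <|
  .while (.natLT (.var 8) (.const trialLength)) <|
    .seq batchProgram (.setNat (.const 8) (.add (.var 8) (.const 1)))

lemma runs_batchesProgram {x : Outcome I} {M : Memory I} {Q g : ℕ} {D : ℝ} (hQ : I.n ≤ Q)
    (hM : M.quota = topCount D) (hc : topCount D ≤ Q + 1)
    (ht : ∀ e : Fin I.n, M.tail e = surv I g e) :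
    Runs x batchesProgram M (1 + (trialLength * (batchTime Q + 1 + 1) + 1))
      (fun M' => M.Similar M' ∧ M'.probed = trialSet I g D M.probed) := by
  refine .step (runs_round _ _) ?_
  refine Runs.while (fun j M' => M.Similar M' ∧ M'.quota = M.quota ∧ M'.tail = M.tail ∧
    M'.round + j = trialLength ∧ (batch I g D)^[j] M'.probed = trialSet I g D M.probed)
    ?_ ?_ _ ⟨⟨rfl, rfl, rfl, rfl, rfl, rfl⟩, rfl, rfl, Nat.zero_add _, rfl⟩ ?_
  · rintro M' ⟨-, -, -, h, -⟩
    show ¬ (M'.round < trialLength)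
    omega
  · rintro j M' ⟨h1, h2, h3, h4, h5⟩ -
    refine Runs.seq (runs_batchProgram hQ (h2.trans hM) hc (h3 ▸ ht)) ?_
    rintro M'' ⟨k1, k2, k3, k4, k5⟩
    refine (runs_round _ _).mono le_rfl ?_
    rintro _ rfl
    refine ⟨h1.trans k1, k2.trans h2, k4.trans h3, ?_, ?_⟩
    · show M''.round + 1 + j = _
      omega
    · rw [← h5, Function.iterate_succ_apply, ← k5]
  · rintro j M' ⟨h1, -, -, h4, h5⟩ h
    replace h : ¬ (M'.round < trialLength) := h
    obtain rfl : j = 0 := by omega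
    exact ⟨h1, h5⟩

/-- Compute the tail probability of the current element. -/
def tailProgram : Program :=
  .seq (.setReal (.add (.var 11) (.const 3)) (.lit 0)) <|
  .seq (.setNat (.const 13) (.const 0)) <|
  .while (.natLT (.var 13) (.add (.var 1) (.const 1))) <|
    .seq (.ite (.natLT (.var 13) (.var 7)) .skip
      (.setReal (.add (.var 11) (.const 3))
        (.add (.tail (.var 11)) (.prob (.var 11) (.var 13))))) <|
    .setNat (.const 13) (.add (.var 13) (.const 1))

/-- The probability that the weight of an element is `v`, if this is at least `g`. -/
def tailTerm (I : Problem) (g : ℕ) (e : Fin I.n) (v : ℕ) : ℝ :=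
  if h : v < I.m + 1 then if g ≤ v then (I.law e ⟨v, h⟩).toReal else 0 else 0

lemma sum_tailTerm (g : ℕ) (e : Fin I.n) :
    ∑ v ∈ Finset.range (I.m + 1), tailTerm I g e v = surv I g e := by
  rw [Finset.sum_range, surv]
  refine Finset.sum_congr rfl fun u _ => ?_
  rw [tailTerm, dif_pos u.2]

lemma runs_tailProgram {x : Outcome I} {M : Memory I} {Q : ℕ} (hQ : I.m ≤ Q) (e : Fin I.n)
    (he : M.cur = e) :
    Runs x tailProgram M (1 + (1 + ((Q + 1) * (2 + 1 + 1) + 1)))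
      (fun M' => ∃ a, M' =
        { M with val := a, tail := Function.update M.tail e (surv I M.thr e) }) := by
  refine Runs.le (T := 1 + (1 + ((I.m + 1) * (2 + 1 + 1) + 1))) (by omega) ?_
  refine .step (runs_tail _ _ _) (.step (runs_val _ _) ?_)
  refine Runs.while (fun j M' => ∃ i, i + j = I.m + 1 ∧ M' = { M with
    val := i
    tail := Function.update M.tail e (∑ v ∈ Finset.range i, tailTerm I M.thr e v) })
    ?_ ?_ _ ⟨0, Nat.zero_add _, ?_⟩ ?_
  · rintro _ ⟨i, h, rfl⟩
    show ¬ (i < I.m + 1)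
    omega
  · rintro j _ ⟨i, h, rfl⟩ -
    have hi : i < I.m + 1 := by omega
    refine Runs.seq (T := 2) (T' := 1) (Q := (· = ({ M with
      val := i
      tail := Function.update M.tail e (∑ v ∈ Finset.range (i + 1), tailTerm I M.thr e v) } :
        Memory I))) (.ite (fun hg => .skip ?_) fun hg => ?_) ?_
    · replace hg : i < M.thr := hg
      rw [Finset.sum_range_succ, tailTerm, dif_pos hi, if_neg (not_le.2 hg), add_zero]
    · replace hg : M.thr ≤ i := not_lt.1 hg
      refine (runs_tail _ _ _).mono le_rfl ?_
      rintro _ rfl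
      ext1 <;> try rfl
      show Function.update (Function.update M.tail e _) M.cur
        (Function.update M.tail e (∑ v ∈ Finset.range i, tailTerm I M.thr e v) M.cur +
          if h : M.cur < I.n ∧ i < I.m + 1 then (I.law ⟨M.cur, h.1⟩ ⟨i, h.2⟩).toReal else 0) =
        Function.update M.tail e _
      rw [dif_pos ⟨he ▸ e.2, hi⟩]
      simp only [he, Function.update_self, Function.update_idem]
      rw [Finset.sum_range_succ, tailTerm, dif_pos hi, if_pos hg]
    · rintro _ rfl
      refine (runs_val _ _).mono le_rfl ?_
      rintro _ rfl
      exact ⟨i + 1, by omega, rfl⟩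
  · rw [Finset.range_zero, Finset.sum_empty]
    ext1 <;> try rfl
    show Function.update M.tail M.cur (RealExp.eval _ (.lit 0)) = _
    rw [he, eval_lit, Nat.cast_zero]
  · rintro j _ ⟨i, h, rfl⟩ hn
    replace hn : ¬ (i < I.m + 1) := hn
    obtain rfl : i = I.m + 1 := by omega
    exact ⟨_, by rw [sum_tailTerm]⟩

/-- Compute the tail probabilities of all elements. -/
def tailsProgram : Program :=
  .seq (.setNat (.const 11) (.const 0)) <|
  .while (.natLT (.var 11) (.var 0)) <|
    .seq tailProgram (.setNat (.const 11) (.add (.var 11) (.const 1)))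

/-- A bound for the running time of `tailsProgram`. -/
def tailsTime (Q : ℕ) : ℕ :=
  1 + (Q * (1 + (1 + ((Q + 1) * (2 + 1 + 1) + 1)) + 1 + 1) + 1)

lemma runs_tailsProgram {x : Outcome I} {M : Memory I} {Q : ℕ} (hn : I.n ≤ Q) (hm : I.m ≤ Q) :
    Runs x tailsProgram M (tailsTime Q) (fun M' => M.Similar M' ∧ M'.probed = M.probed ∧
      ∀ e : Fin I.n, M'.tail e = surv I M.thr e) := by
  refine Runs.le (T := 1 + (I.n * (1 + (1 + ((Q + 1) * (2 + 1 + 1) + 1)) + 1 + 1) + 1))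
    (by unfold tailsTime; gcongr) ?_
  refine .step (runs_cur _ _) ?_
  refine Runs.while (fun j M' => M.Similar M' ∧ M'.probed = M.probed ∧ M'.cur + j = I.n ∧
    ∀ e : Fin I.n, (e : ℕ) < M'.cur → M'.tail e = surv I M.thr e) ?_ ?_ _
    ⟨⟨rfl, rfl, rfl, rfl, rfl, rfl⟩, rfl, Nat.zero_add _,
      fun e h => absurd h (Nat.not_lt_zero _)⟩ ?_
  · rintro M' ⟨-, -, h, -⟩
    show ¬ (M'.cur < I.n)
    omega
  · rintro j M' ⟨h1, h2, h3, h4⟩ -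
    have hi : M'.cur < I.n := by omega
    refine Runs.seq (T' := 1) (runs_tailProgram hm ⟨M'.cur, hi⟩ rfl) ?_
    rintro _ ⟨a, rfl⟩
    refine (runs_cur _ _).mono le_rfl ?_
    rintro _ rfl
    refine ⟨h1, h2, ?_, fun e he => ?_⟩
    · show M'.cur + 1 + j = _
      omega
    · replace he : (e : ℕ) < M'.cur + 1 := he
      show Function.update M'.tail M'.cur (surv I M'.thr ⟨M'.cur, hi⟩) e = _
      by_cases h : (e : ℕ) = M'.cur
      · obtain rfl : e = ⟨M'.cur, hi⟩ := Fin.ext h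
        rw [Function.update_self, h1.2.2.2.2.1]
      · rw [Function.update_of_ne h, h4 e (by omega)]
  · rintro j M' ⟨h1, h2, h3, h4⟩ h
    replace h : ¬ (M'.cur < I.n) := h
    exact ⟨h1, h2, fun e => h4 e (by have := e.2; omega)⟩

/-- Count the elements of weight less than the threshold. -/
def countProgram : Program :=
  .seq (.setNat (.const 14) (.const 0)) <|
  .seq (.setNat (.const 11) (.const 0)) <|
  .while (.natLT (.var 11) (.var 0)) <|
    .seq (.ite (.and (.natLT (.const 0) (.entry (.var 11)))
        (.natLT (.entry (.var 11)) (.add (.var 7) (.const 1))))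
      (.setNat (.const 14) (.add (.var 14) (.const 1))) .skip) <|
    .setNat (.const 11) (.add (.var 11) (.const 1))

-- The table stores the weight plus `1`, so `0 < entry < g + 1` means that the element was probed
-- and weighs less than `g`.
open Classical in
lemma sum_entry (g : ℕ) (R : Finset (Fin I.n)) (x : Outcome I) :
    ∑ i ∈ Finset.range I.n, (if 0 < entry x R i ∧ entry x R i < g + 1 then 1 else 0) =
      cnt g R x := by
  rw [Finset.sum_range, cnt, Finset.card_filter, ← Finset.sum_filter, ← Finset.sum_filter]
  refine Finset.sum_congr ?_ fun _ _ => rfl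
  ext e
  by_cases h : e ∈ R <;> simp [entry, h]

lemma runs_countProgram {x : Outcome I} {M : Memory I} {Q : ℕ} (hQ : I.n ≤ Q) :
    Runs x countProgram M (4 * Q + 3) (fun M' => M.Similar M' ∧ M'.probed = M.probed ∧
      M'.good = cnt M.thr M.probed x) := by
  classical
  refine Runs.le (T := 1 + (1 + (I.n * (2 + 1 + 1) + 1))) (by omega) ?_
  refine .step (runs_good _ _) (.step (runs_cur _ _) ?_)
  set G : ℕ → ℕ := fun i => ∑ i ∈ Finset.range i,
    (if 0 < entry x M.probed i ∧ entry x M.probed i < M.thr + 1 then 1 else 0) with hG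
  refine Runs.while (fun j M' => ∃ i, i + j = I.n ∧ M' = { M with good := G i, cur := i })
    ?_ ?_ _ ⟨0, Nat.zero_add _, rfl⟩ ?_
  · rintro _ ⟨i, h, rfl⟩
    show ¬ (i < I.n)
    omega
  · rintro j _ ⟨i, h, rfl⟩ -
    refine Runs.seq (T := 2) (T' := 1)
      (Q := (· = ({ M with good := G (i + 1), cur := i } : Memory I)))
      (.ite (fun hg => ?_) fun hg => .skip ?_) ?_
    · replace hg : 0 < entry x M.probed i ∧ entry x M.probed i < M.thr + 1 := hg
      refine (runs_good _ _).mono le_rfl ?_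
      rintro _ rfl
      rw [show G (i + 1) = G i + 1 by simp only [hG]; rw [Finset.sum_range_succ, if_pos hg]]
      rfl
    · replace hg : ¬ (0 < entry x M.probed i ∧ entry x M.probed i < M.thr + 1) := hg
      rw [show G (i + 1) = G i by simp only [hG]; rw [Finset.sum_range_succ, if_neg hg, add_zero]]
    · rintro _ rfl
      refine (runs_cur _ _).mono le_rfl ?_
      rintro _ rfl
      exact ⟨i + 1, by omega, rfl⟩
  · rintro j _ ⟨i, h, rfl⟩ hn
    replace hn : ¬ (i < I.n) := hn
    obtain rfl : i = I.n := by omega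
    exact ⟨⟨rfl, rfl, rfl, rfl, rfl, rfl⟩, rfl, sum_entry _ _ _⟩

/-- Compute the middle of the interval of exponents, and the threshold. -/
def midProgram : Program :=
  .seq (.setNat (.const 6) (.const 0)) <|
  .seq (.setNat (.const 7) (.const 1)) <|
  .while (.natLT (.add (.add (.var 6) (.var 6)) (.const 1)) (.add (.var 4) (.var 5))) <|
    .seq (.setNat (.const 6) (.add (.var 6) (.const 1)))
      (.setNat (.const 7) (.add (.var 7) (.var 7)))

/-- The candidate `i` is incremented, and the threshold doubled, while `2 * i + 1 < lo + hi`; this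
stops exactly at half of `lo + hi`, rounded down. -/
lemma runs_midProgram {x : Outcome I} {M : Memory I} {Q : ℕ} (hQ : (M.lo + M.hi) / 2 ≤ Q) :
    Runs x midProgram M (3 * Q + 3)
      (· = { M with mid := (M.lo + M.hi) / 2, thr := 2 ^ ((M.lo + M.hi) / 2) }) := by
  refine Runs.le (T := 1 + (1 + ((M.lo + M.hi) / 2 * (1 + 1 + 1) + 1))) (by omega) ?_
  refine .step (runs_mid _ _) (.step (runs_thr _ _) ?_)
  refine Runs.while (fun j M' => ∃ i, i + j = (M.lo + M.hi) / 2 ∧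
    M' = { M with mid := i, thr := 2 ^ i }) ?_ ?_ _ ⟨0, Nat.zero_add _, rfl⟩ ?_
  · rintro _ ⟨i, h, rfl⟩
    show ¬ (i + i + 1 < M.lo + M.hi)
    omega
  · rintro j _ ⟨i, h, rfl⟩ -
    refine .step (runs_mid _ _) ((runs_thr _ _).mono le_rfl ?_)
    rintro _ rfl
    refine ⟨i + 1, by omega, ?_⟩
    rw [show 2 ^ (i + 1) = 2 ^ i + 2 ^ i by ring]
    rfl
  · rintro j _ ⟨i, h, rfl⟩ hn
    replace hn : ¬ (i + i + 1 < M.lo + M.hi) := hn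
    obtain rfl : i = (M.lo + M.hi) / 2 := by omega
    rfl

/-! ### The program -/

/-- A trial for the middle exponent. -/
def trialProgram : Program :=
  .seq midProgram <| .seq tailsProgram <| .seq quotaProgram <| .seq batchesProgram <|
  .seq countProgram <|
  .ite (.realLT (.mul (.div (.lit 199) (.lit 200)) (.var 0)) (.ofNat (.sub (.var 2) (.var 14))))
    (.setNat (.const 4) (.add (.var 6) (.const 1)))
    (.setNat (.const 5) (.var 6))

/-- The passage to the next level. -/
def levelProgram : Program :=
  .seq (.setReal (.const 0) (.mul (.div (.lit 199) (.lit 200)) (.var 0)))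
    (.setNat (.const 5) (.add (.var 3) (.const 1)))

/-- One step of the procedure. -/
def stepProgram : Program := .ite (.natLT (.var 4) (.var 5)) trialProgram levelProgram

/-- The program that carries out the procedure, unless half of the `k` weights are missing
anyway. -/
def mainProgram : Program :=
  .seq (.setNat (.const 7) (.const 1)) <|
  .seq (.while (.natLT (.var 7) (.add (.var 1) (.const 1)))
    (.seq (.setNat (.const 7) (.add (.var 7) (.var 7)))
      (.setNat (.const 3) (.add (.var 3) (.const 1))))) <|
  .seq (.setReal (.const 0) (.ofNat (.var 2))) <|
  .seq (.setNat (.const 5) (.add (.var 3) (.const 1))) <|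
  .ite (.natLT (.var 2) (.add (.var 0) (.var 0)))
    (.while (.not (.realLT (.var 0) (.lit 1))) stepProgram) .skip

/-- The memory holds a state of the procedure. -/
structure Memory.Represents (M : Memory I) (σ : Phase I) : Prop where
  probed : M.probed = σ.probed
  bound : M.bound = target I σ.level
  lo : M.lo = σ.lo
  hi : M.hi = σ.hi
  size : M.size = topExp I

/-- A bound for the running time of `trialProgram`. -/
def trialTime (Q : ℕ) : ℕ :=
  3 * (Q + 1) + 3 + (tailsTime Q + (2 * Q + 2 +
    (1 + (trialLength * (batchTime Q + 1 + 1) + 1) + (4 * Q + 3 + (1 + 1)))))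

lemma size_le_self (a : ℕ) : Nat.size a ≤ a := Nat.size_le.2 Nat.lt_two_pow_self

/-- Here `k < 2 * n` enters the running time: a quota counted up one by one stays linear in `n`. -/
lemma topCount_target_le (hk : I.k < 2 * I.n) (i : ℕ) : topCount (target I i) ≤ I.n + 1 := by
  have h : target I i ≤ I.k := by simpa [target] using target_anti (I := I) (Nat.zero_le i)
  have hk' : (I.k : ℝ) ≤ 2 * I.n := by exact_mod_cast hk.le
  have : ⌊target I i / 24⌋₊ ≤ I.n := by
    refine Nat.floor_le_of_le ?_
    have : (0 : ℝ) ≤ I.n := Nat.cast_nonneg _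
    linarith
  unfold topCount
  omega

lemma runs_stepProgram {x : Outcome I} {M : Memory I} {σ : Phase I} {Q : ℕ}
    (hM : M.Represents σ) (hn : I.n ≤ Q) (hm : I.m ≤ Q) (hk : I.k < 2 * I.n)
    (hσ : 1 ≤ target I σ.level) (hhi : σ.hi ≤ topExp I + 1) :
    Runs x stepProgram M (trialTime Q + 1) (Memory.Represents · (σ.step x)) := by
  obtain ⟨M1, M2, M3, M4, M5⟩ := hM
  have hlt : Test.Holds (M.state x) (.natLT (.var 4) (.var 5)) ↔ σ.lo < σ.hi := by
    rw [← M3, ← M4]; rfl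
  rw [Phase.step, if_pos hσ]
  refine .ite (fun h => ?_) fun h => ?_
  · rw [hlt] at h
    have hmid : (M.lo + M.hi) / 2 = (σ.lo + σ.hi) / 2 := by rw [M3, M4]
    have htop : topExp I ≤ I.m := size_le_self _
    have hQ : topCount M.bound ≤ Q + 1 := by
      rw [M2]; exact (topCount_target_le hk _).trans (by omega)
    rw [if_pos h]
    refine .step (runs_midProgram (by omega)) ?_
    refine Runs.seq (runs_tailsProgram hn hm) ?_
    rintro M₁ ⟨⟨a1, a2, a3, a4, a5, a6⟩, b1, b2⟩
    refine .step (runs_quotaProgram (a6 ▸ M2 ▸ target_nonneg _) (a6 ▸ hQ)) ?_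
    refine Runs.seq (runs_batchesProgram (g := 2 ^ ((σ.lo + σ.hi) / 2))
      (D := M₁.bound) hn rfl (a6 ▸ hQ) ?_) ?_
    · intro e
      rw [← hmid]
      exact b2 e
    rintro M₂ ⟨⟨c1, c2, c3, c4, c5, c6⟩, d⟩
    refine Runs.seq (runs_countProgram hn) ?_
    rintro M₃ ⟨⟨e1, e2, e3, e4, e5, e6⟩, f1, f2⟩
    replace d : M₂.probed = σ.next := by
      rw [Phase.next, if_pos ⟨hσ, h⟩, d]
      show trialSet I _ M₁.bound M₁.probed = _
      rw [b1, a6, ← M1, ← M2]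
    have hthr : M₂.thr = 2 ^ ((σ.lo + σ.hi) / 2) := by
      rw [c5, ← hmid]; exact a5
    have hmid' : M₃.mid = (σ.lo + σ.hi) / 2 := by
      rw [e4, c4, ← hmid]; exact a4
    have hbound : M₃.bound = target I σ.level := by
      rw [e6, c6, ← M2]; exact a6
    have htest : Test.Holds (M₃.state x) (.realLT (.mul (.div (.lit 199) (.lit 200)) (.var 0))
        (.ofNat (.sub (.var 2) (.var 14)))) ↔
        199 / 200 * target I σ.level < deficit (2 ^ ((σ.lo + σ.hi) / 2)) σ.next x := by
      rw [← hbound, deficit, ← hthr, ← d, ← f2]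
      rfl
    have hsize : M₃.size = topExp I := by
      rw [e1, c1, ← M5]; exact a1
    have hlo : M₃.lo = σ.lo := by
      rw [e2, c2, ← M3]; exact a2
    have hhi : M₃.hi = σ.hi := by
      rw [e3, c3, ← M4]; exact a3
    refine .ite (fun ht => ?_) fun ht => ?_
    · rw [htest] at ht
      rw [if_pos ht]
      refine (runs_lo _ _).mono le_rfl ?_
      rintro _ rfl
      exact ⟨f1.trans d, hbound, congrArg (· + 1) hmid', hhi, hsize⟩
    · rw [htest] at ht
      rw [if_neg ht]
      refine (runs_hi _ _).mono le_rfl ?_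
      rintro _ rfl
      exact ⟨f1.trans d, hbound, hlo, hmid', hsize⟩
  · rw [hlt] at h
    rw [if_neg h]
    refine Runs.le (T := 1 + 1) (by unfold trialTime; omega) ?_
    refine .step (runs_bound _ _) ((runs_hi _ _).mono le_rfl ?_)
    rintro _ rfl
    refine ⟨?_, ?_, M3, congrArg (· + 1) M5, M5⟩
    · rw [Phase.next, if_neg (fun hn => h hn.2)]
      exact M1
    · rw [target_succ, ← M2]
      rfl

/-- A bound for the running time of `mainProgram`. -/
def mainTime (Q : ℕ) : ℕ :=
  1 + (Q * (1 + 1 + 1) + 1 + (1 + (1 + (402 * Q * (Q + 2) * (trialTime Q + 1 + 1) + 1 + 1))))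

lemma numSteps_le {Q : ℕ} (hn : I.n ≤ Q) (hm : I.m ≤ Q) (hk : I.k < 2 * I.n) :
    numSteps I ≤ 402 * Q * (Q + 2) := by
  have h1 : levels I ≤ 402 * I.n := by
    have hn1 : (1 : ℝ) ≤ I.n := by
      have : 1 ≤ I.n := by omega
      exact_mod_cast this
    have hk' : (I.k : ℝ) ≤ 2 * I.n := by exact_mod_cast hk.le
    have hlog : max 1 (Real.log I.k) ≤ 2 * I.n :=
      max_le (by linarith) ((Real.log_le_self (Nat.cast_nonneg _)).trans hk')
    have := levels_le I
    have h : (levels I : ℝ) ≤ (402 * I.n : ℕ) := by push_cast; linarith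
    exact_mod_cast h
  have h2 : Nat.size (topExp I + 1) + 1 ≤ Q + 2 := by
    have h3 := size_le_self (topExp I + 1)
    have h4 : topExp I ≤ I.m := size_le_self _
    omega
  exact Nat.mul_le_mul (h1.trans (by omega)) h2

lemma runs_mainProgram (x : Outcome I) {Q : ℕ} (hn : I.n ≤ Q) (hm : I.m ≤ Q) :
    Runs x mainProgram (Memory.initial I) (mainTime Q)
      (fun M => M.probed = if I.k < 2 * I.n then finalSet x else ∅) := by
  have htop : topExp I ≤ I.m := size_le_self _
  refine .step (runs_thr _ _) ?_
  refine Runs.seq (Q := fun M => M.size = topExp I ∧ M.lo = 0 ∧ M.probed = ∅) ?_ ?_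
  · refine Runs.le (T := topExp I * (1 + 1 + 1) + 1) (by omega) ?_
    have key (i : ℕ) : 2 ^ i < I.m + 1 ↔ i < topExp I := by
      rw [topExp, Nat.lt_size, Nat.lt_succ_iff]
    refine Runs.while (fun j M => M.size + j = topExp I ∧ M.thr = 2 ^ M.size ∧ M.lo = 0 ∧
      M.probed = ∅) ?_ ?_ _ ⟨Nat.zero_add _, rfl, rfl, rfl⟩ ?_
    · rintro M ⟨h1, h2, -⟩
      show ¬ (M.thr < I.m + 1)
      rw [h2, key]
      omega
    · rintro j M ⟨h1, h2, h3, h4⟩ -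
      refine .step (runs_thr _ _) ((runs_size _ _).mono le_rfl ?_)
      rintro _ rfl
      refine ⟨?_, ?_, h3, h4⟩
      · show M.size + 1 + j = _
        omega
      · show M.thr + M.thr = 2 ^ (M.size + 1)
        rw [h2]
        ring
    · rintro j M ⟨h1, h2, h3, h4⟩ h
      replace h : ¬ (M.thr < I.m + 1) := h
      rw [h2, key] at h
      exact ⟨by omega, h3, h4⟩
  rintro M ⟨h1, h2, h3⟩
  refine .step (runs_bound _ _) (.step (runs_hi _ _) (.ite (fun hk => ?_) fun hk =>
    Runs.le (by omega) (.skip ?_)))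
  · replace hk : I.k < I.n + I.n := hk
    rw [← two_mul] at hk
    rw [if_pos hk]
    have htest {M : Memory I} {σ : Phase I} (h : M.Represents σ) :
        Test.Holds (M.state x) (.not (.realLT (.var 0) (.lit 1))) ↔ 1 ≤ target I σ.level := by
      rw [← h.bound]
      show ¬ (M.bound < RealExp.eval _ (.lit 1)) ↔ _
      rw [eval_lit, Nat.cast_one, not_lt]
    refine Runs.le (T := numSteps I * (trialTime Q + 1 + 1) + 1) ?_ ?_
    · gcongr
      exact numSteps_le hn hm hk
    refine Runs.while (fun j M => ∃ σ : Phase I, M.Represents σ ∧ σ.Inv x ∧ σ.rank ≤ j ∧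
      ((Phase.step x)^[j] σ).probed = finalSet x) ?_ ?_ _
      ⟨Phase.start I, ⟨h3, ?_, h2, congrArg (· + 1) h1, h1⟩, Phase.start_inv x,
        Phase.rank_start, rfl⟩ ?_
    · rintro M ⟨σ, hM, -, hr, -⟩ ht
      have := Phase.rank_step ((htest hM).1 ht) x
      omega
    · rintro j M ⟨σ, hM, hi, hr, hf⟩ ht
      have h1 := (htest hM).1 ht
      refine (runs_stepProgram hM hn hm hk h1 hi.hi_le).mono le_rfl ?_
      intro M' hM'
      have := Phase.rank_step h1 x
      exact ⟨_, hM', hi.step, by omega, hf⟩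
    · simp only [target, Phase.start, pow_zero, mul_one]
      rfl
    · rintro j M ⟨σ, hM, -, -, hf⟩ ht
      rw [htest hM] at ht
      -- The loop may stop before `numSteps I` rounds, because states with target below `1` are
      -- fixed points.
      have hfix : σ.step x = σ := by rw [Phase.step, if_neg ht]
      rw [hM.probed, ← hf, Function.iterate_fixed hfix]
  · replace hk : ¬ (I.k < I.n + I.n) := hk
    rw [if_neg (by omega)]
    exact h3

lemma exists_polynomial_mainTime : ∃ T : Polynomial ℕ, ∀ Q, T.eval Q = mainTime Q := by
  refine ⟨1 + (.X * (1 + 1 + 1) + 1 + (1 + (1 + (402 * .X * (.X + 2) *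
    (3 * (.X + 1) + 3 + ((1 + (.X * (1 + (1 + ((.X + 1) * (2 + 1 + 1) + 1)) + 1 + 1) + 1)) +
      (2 * .X + 2 + (1 + (trialLength * ((2 + ((.X + 1) * (4 * .X + 9) + 1) +
        (1 + ((.X + 2) * (4 * .X + 8) + 1))) + 1 + 1) + 1) + (4 * .X + 3 + (1 + 1))))) +
          1 + 1) + 1 + 1)))), fun Q => ?_⟩
  simp only [mainTime, trialTime, tailsTime, batchTime, Polynomial.eval_add, Polynomial.eval_mul,
    Polynomial.eval_X, Polynomial.eval_one, Polynomial.eval_ofNat, Polynomial.eval_natCast, Nat.cast_id]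

end MinKKnapsack

end

theorem theorem2 :
    ∃ (p : MinKKnapsack.Program) (T : Polynomial ℕ) (C : ℝ),
      ∀ I : MinKKnapsack.Problem, ∃ π : MinKKnapsack.Policy I,
        p.Implements π (T.eval (I.n + I.m)) ∧
        ∀ w : ENNReal, (I.m : ENNReal) ≤ w →
          π.IsApproximation w 8
            (C * max 1 (Real.log (Real.log I.m)) * (max 1 (Real.log I.k)) ^ 2) := by
  obtain ⟨T, hT⟩ := MinKKnapsack.exists_polynomial_mainTime
  refine ⟨MinKKnapsack.mainProgram, T, MinKKnapsack.approxConst, fun I => ?_⟩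
  obtain ⟨π, h1, h2⟩ : ∃ π : MinKKnapsack.Policy I,
      (∀ x, π.selected x = if I.k < 2 * I.n then MinKKnapsack.finalSet x else ∅) ∧
      (2 * I.n ≤ I.k → π = .done) := by
    -- The polynomial bounds the time in terms of `n` and `m` only, so for `k ≥ 2 * n` nothing is
    -- probed.
    by_cases hk : I.k < 2 * I.n
    · obtain ⟨π, hπ⟩ := MinKKnapsack.exists_policy_finalSet I
      exact ⟨π, fun x => by rw [if_pos hk, hπ], fun h => absurd hk (not_lt.2 h)⟩
    · exact ⟨.done, fun x => by rw [if_neg hk]; rfl, fun _ => rfl⟩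
  refine ⟨π, fun x => ?_, fun w hw =>
    MinKKnapsack.isApproximation_of_selected ⟨h2, fun hk x => by rw [h1, if_pos hk]⟩ hw⟩
  obtain ⟨M, t, ht, he, hM⟩ := MinKKnapsack.runs_mainProgram x
    (Nat.le_add_right I.n I.m) (Nat.le_add_left I.m I.n)
  rw [MinKKnapsack.Memory.state_initial] at he
  exact ⟨M.state x, t, ht.trans (hT _).ge, he, hM.trans (h1 x).symm⟩
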